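/- Let $e\ge 1$ and $k\ge 1$ be integers with $3\nmid k$, put $n=3^e k$, and let $u$ be an integer with $3^e u\equiv 1 \pmod k$ (no condition if $k=1$). Write $g^h=h^{-1}gh$, $[g,h]=g^{-1}h^{-1}gh$, and let $$G_3(k,e)=\langle a,b \mid a^{2\cdot 3^e k}=b^2=1,\ [x_1,y_1]=1,\ c^{3^{e+1}}=1,\ y_1^{a}=x_1^{-1}y_1^{-1},\ c^a=c^2x_1^{u}y_1^{\frac{1-3^e}{2}u}\rangle,$$ where $c=a^{3^e}b$, $x_1=a^{2\cdot 3^e}$, $y_1=x_1^b$. An oriented map is given by its set of arcs (darts), the local rotation $R$ (taking each arc to the next one around its initial vertex) and the arc-reversing involution $L$, such that $\langle R,L\rangle$ is transitive on the arcs. Isomorphisms of maps are bijections of the arcs commuting with $R$ and $L$ (orientation-preserving isomorphisms); $\mathrm{Aut}^+(\mathcal M)$ is the group of automorphisms, and $\mathcal M$ is orientably-regular if $\mathrm{Aut}^+(\mathcal M)$ is transitive on the arcs. An orientably-regular map is chiral if it is not isomorphic to its mirror image (obtained by replacing $R$ with $R^{-1}$). The map has type $\{s,t\}$ if all its faces are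 $s$-gons and all its vertices have valency $t$. It is an embedding of a simple graph $\Gamma$ without isolated vertices if its underlying graph is isomorphic to $\Gamma$. For a group $G$ generated by $a$ and an involution $b$, the map $\mathcal M(G;a,b)$ has the elements $g\in G$ as arcs ($g$ being the arc from the vertex $\langle a\rangle g$ to the vertex $\langle a\rangle bg$), local rotation $g\mapsto ag$ and arc reversal $g\mapsto bg$. For $j\in\mathbb Z_{2\cdot 3^e k}^*$ let $\mathcal M_3(k,e,j)=\mathcal M(G_3(k,e);a^j,b)$. Let $K_{3[n]}$ be the complete 3-partite graph with three parts of size $n$. Then: 1. If $\mathcal M$ is an orientably-regular embedding of $K_{3[n]}$ such that a Sylow 3-subgroup $P$ of $\mathrm{Aut}^+(\mathcal M)$ has exponent $\mathrm{Exp}(P)=3^{e+1}$, then $\mathrm{Aut}^+(\mathcal M)\cong G_3(k,e)$ and $\mathcal M\cong\mathcal M_3(k,e,j)$ for some $j\in\mathbb Z_{2\cdot 3^e k}^*$. 2. For $j_1,j_2\in\mathbb Z_{2\cdot 3^e k}^*$, $\mathcal M_3(k,e,j_1)\cong\mathcal M_3(k,e,j_2)$ if and only if $j_1\equiv j_2\pmod{2\cdot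 3^e}$. 3. Every map $\mathcal M_3(k,e,j)$ with $j\in\mathbb Z_{2\cdot 3^e k}^*$ is an orientably-regular embedding of $K_{3[n]}$, is chiral, has type $\{3^{e+1},2\cdot 3^e k\}$, and every Sylow 3-subgroup of its group $\mathrm{Aut}^+$ has exponent $3^{e+1}$. 4. Up to isomorphism there are exactly $2\cdot 3^{e-1}$ maps $\mathcal M_3(k,e,j)$ with $j\in\mathbb Z_{2\cdot 3^e k}^*$. -/

import Mathlib

/-- A (connected) oriented map, given combinatorially on its set `D` of darts (arcs): `rot` is the
local rotation, sending each dart to the next dart around its initial vertex, and `rev` reverses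
every dart. Vertices are the cycles of `rot`, edges are the pairs `{d, rev d}`, and faces are the
cycles of `d ↦ rot (rev d)`. -/
structure OrientedMap (D : Type*) where
  rot : Equiv.Perm D
  rev : Equiv.Perm D
  rev_rev : ∀ d, rev (rev d) = d
  rev_ne : ∀ d, rev d ≠ d
  connected : ∀ d d' : D, ∃ g ∈ Subgroup.closure ({rot, rev} : Set (Equiv.Perm D)), g d = d'

namespace OrientedMap

/-- Two oriented maps are isomorphic if some bijection of the darts carries local rotation to local
rotation and dart reversal to dart reversal (an orientation-preserving isomorphism). -/
def IsIso {D D' : Type*} (M : OrientedMap D) (N : OrientedMap D') : Prop :=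
  ∃ f : D ≃ D', (∀ d, f (M.rot d) = N.rot (f d)) ∧ ∀ d, f (M.rev d) = N.rev (f d)

/-- Isomorphism as an equivalence relation on the oriented maps with a given set of darts. -/
def isoSetoid (D : Type*) : Setoid (OrientedMap D) where
  r := IsIso
  iseqv :=
    { refl := fun _ => ⟨Equiv.refl _, fun _ => rfl, fun _ => rfl⟩
      symm := by
        rintro M N ⟨f, h1, h2⟩
        refine ⟨f.symm, fun d => ?_, fun d => ?_⟩
        · rw [Equiv.symm_apply_eq, h1, Equiv.apply_symm_apply]
        · rw [Equiv.symm_apply_eq, h2, Equiv.apply_symm_apply]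
      trans := by
        rintro M N L ⟨f, h1, h2⟩ ⟨g, h3, h4⟩
        exact ⟨f.trans g, fun d => by simp [h1, h3], fun d => by simp [h2, h4]⟩ }

/-- The group of orientation-preserving automorphisms: the permutations of the darts that commute
with the local rotation and with dart reversal. -/
def autPlus {D : Type*} (M : OrientedMap D) : Subgroup (Equiv.Perm D) :=
  Subgroup.centralizer {M.rot, M.rev}

/-- The map is orientably-regular: its orientation-preserving automorphisms act transitively (hence,
by connectedness, regularly) on the darts. -/
def IsOrientablyRegular {D : Type*} (M : OrientedMap D) : Prop :=
  ∀ d d' : D, ∃ f ∈ M.autPlus, f d = d'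

/-- The mirror image of a map: the same graph with all local rotations inverted. -/
def mirror {D : Type*} (M : OrientedMap D) : OrientedMap D where
  rot := M.rot⁻¹
  rev := M.rev
  rev_rev := M.rev_rev
  rev_ne := M.rev_ne
  connected := by
    intro d d'
    obtain ⟨g, hg, h⟩ := M.connected d d'
    refine ⟨g, ?_, h⟩
    refine (Subgroup.closure_le _).2 ?_ hg
    rintro x (rfl | rfl)
    · exact inv_mem_iff.1 (Subgroup.subset_closure (Set.mem_insert _ _))
    · exact Subgroup.subset_closure (Set.mem_insert_of_mem _ rfl)

/-- An orientably-regular map is chiral if it is not isomorphic to its mirror image. -/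
def IsChiral {D : Type*} (M : OrientedMap D) : Prop :=
  M.IsOrientablyRegular ∧ ¬ M.IsIso M.mirror

/-- `M` is an embedding of the simple graph `Γ` (a graph without isolated vertices): its darts can
be identified with the arcs of `Γ` in such a way that `rev` is arc reversal and two darts lie in the
same cycle of `rot` exactly when the arcs have the same initial vertex. -/
def IsEmbeddingOf {D V : Type*} (M : OrientedMap D) (Γ : SimpleGraph V) : Prop :=
  ∃ φ : D ≃ Γ.Dart, (∀ d, φ (M.rev d) = (φ d).symm) ∧
    ∀ d d', M.rot.SameCycle d d' ↔ (φ d).fst = (φ d').fst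

/-- The map has type `{s, t}`: all faces are `s`-gons and all vertices have valency `t`. -/
def HasType {D : Type*} (M : OrientedMap D) (s t : ℕ) : Prop :=
  ∀ d, Function.minimalPeriod (fun x => M.rot (M.rev x)) d = s ∧
    Function.minimalPeriod M.rot d = t

/-- The algebraic map of a group `G` generated by `a` and an involution `b`. The element `g` is the
arc from the vertex `⟨a⟩g` to the vertex `⟨a⟩bg`; the local rotation carries it to the arc from
`⟨a⟩g = ⟨a⟩ag` to `⟨a⟩bag`, that is, to `ag`; its reverse is `bg`. The group acts on the
arcs by right multiplication. -/
def algebraic {G : Type*} [Group G] (a b : G) (hb : b * b = 1) (hb1 : b ≠ 1)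
    (hgen : Subgroup.closure {a, b} = ⊤) : OrientedMap G where
  rot := Equiv.mulLeft a
  rev := Equiv.mulLeft b
  rev_rev := fun g => by simp [← mul_assoc, hb]
  rev_ne := fun g h => hb1 (by simpa using h)
  connected := by
    intro g g'
    have key : ∀ x : G, Equiv.mulLeft x ∈
        Subgroup.closure ({Equiv.mulLeft a, Equiv.mulLeft b} : Set (Equiv.Perm G)) := by
      intro x
      have hx : x ∈ Subgroup.closure ({a, b} : Set G) := by rw [hgen]; trivial
      induction hx using Subgroup.closure_induction with
      | mem y hy =>
        rcases hy with rfl | rfl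
        · exact Subgroup.subset_closure (Set.mem_insert _ _)
        · exact Subgroup.subset_closure (Set.mem_insert_of_mem _ rfl)
      | one => simp
      | mul y z _ _ hy hz =>
        have : Equiv.mulLeft (y * z) = Equiv.mulLeft y * Equiv.mulLeft z := by
          ext t; simp
        rw [this]; exact mul_mem hy hz
      | inv y _ hy =>
        have : Equiv.mulLeft y⁻¹ = (Equiv.mulLeft y)⁻¹ := by
          ext t; simp
        rw [this]; exact inv_mem hy
    exact ⟨_, key (g' * g⁻¹), by simp⟩

end OrientedMap

/-- The defining relators, in the free group on `a` and `b`, of `G₃(k, e)`: with `c = a ^ 3 ^ e * b`,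
`x₁ = a ^ (2 * 3 ^ e)` and `y₁ = x₁ ^ b = b⁻¹ x₁ b`, the relations are `a ^ (2 * 3 ^ e * k) = 1`,
`b ^ 2 = 1`, `[x₁, y₁] = 1`, `c ^ 3 ^ (e + 1) = 1`, `y₁ ^ a = x₁⁻¹ y₁⁻¹` and
`c ^ a = c ^ 2 x₁ ^ u y₁ ^ ((1 - 3 ^ e) / 2 * u)`. -/
def relators₃ (k e : ℕ) (u : ℤ) : Set (FreeGroup (Fin 2)) :=
  let a : FreeGroup (Fin 2) := FreeGroup.of 0
  let b : FreeGroup (Fin 2) := FreeGroup.of 1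
  let c := a ^ 3 ^ e * b
  let x₁ := a ^ (2 * 3 ^ e)
  let y₁ := b⁻¹ * x₁ * b
  {a ^ (2 * 3 ^ e * k), b ^ 2, x₁⁻¹ * y₁⁻¹ * x₁ * y₁, c ^ 3 ^ (e + 1),
    (a⁻¹ * y₁ * a) * (x₁⁻¹ * y₁⁻¹)⁻¹,
    (a⁻¹ * c * a) * (c ^ 2 * x₁ ^ u * y₁ ^ ((1 - 3 ^ e) / 2 * u : ℤ))⁻¹}

/-- The group `G₃(k, e)`, for an integer `u` with `u * 3 ^ e ≡ 1` modulo `k`. For `k = 1` we have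
`x₁ = y₁ = 1`, so the last relation reads `c ^ a = c ^ 2`, whatever `u` is. -/
abbrev G₃ (k e : ℕ) (u : ℤ) : Type := PresentedGroup (relators₃ k e u)

namespace G₃

variable (k e : ℕ) (u : ℤ)

/-- The generator `a`. -/
def a : G₃ k e u := PresentedGroup.of 0

/-- The generator `b`. -/
def b : G₃ k e u := PresentedGroup.of 1

theorem b_mul_b : b k e u * b k e u = 1 := by
  have h : PresentedGroup.mk (relators₃ k e u) (FreeGroup.of 1 ^ 2) = 1 :=
    PresentedGroup.one_of_mem (by simp [relators₃])
  rw [map_pow, pow_two] at h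
  exact h

theorem a_pow : a k e u ^ (2 * 3 ^ e * k) = 1 := by
  have h : PresentedGroup.mk (relators₃ k e u) (FreeGroup.of 0 ^ (2 * 3 ^ e * k)) = 1 :=
    PresentedGroup.one_of_mem (by simp [relators₃])
  rw [map_pow] at h
  exact h

theorem b_ne_one : b k e u ≠ 1 := by
  intro h
  have hodd : ((3 : ZMod 2)) ^ e = 1 := by
    rw [show (3 : ZMod 2) = 1 from rfl, one_pow]
  have h2 : (2 : ZMod 2) = 0 := rfl
  have h11 : (1 : ZMod 2) + 1 = 0 := rfl
  let f : Fin 2 → Multiplicative (ZMod 2) := fun _ => Multiplicative.ofAdd 1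
  have hf : ∀ r ∈ relators₃ k e u, FreeGroup.lift f r = 1 := by
    intro r hr
    simp only [relators₃, Set.mem_insert_iff, Set.mem_singleton_iff] at hr
    rcases hr with rfl | rfl | rfl | rfl | rfl | rfl <;>
      · apply Multiplicative.toAdd.injective
        simp [f, hodd, h2, h11]
  have := congrArg (PresentedGroup.toGroup hf) h
  rw [b, PresentedGroup.toGroup.of, map_one] at this
  exact absurd (Multiplicative.ofAdd.injective this) (by decide)

theorem closure_eq_top (j : (ZMod (2 * 3 ^ e * k))ˣ) :
    Subgroup.closure {a k e u ^ (j : ZMod (2 * 3 ^ e * k)).val, b k e u} = ⊤ := by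
  rw [eq_top_iff, ← PresentedGroup.closure_range_of, Subgroup.closure_le]
  have hj : (j : ZMod (2 * 3 ^ e * k)).val.Coprime (orderOf (a k e u)) :=
    (ZMod.val_coe_unit_coprime j).coprime_dvd_right (orderOf_dvd_of_pow_eq_one (a_pow k e u))
  obtain ⟨m, hm⟩ := exists_pow_eq_self_of_coprime hj
  rintro _ ⟨i, rfl⟩
  fin_cases i
  · change a k e u ∈ _
    have := Subgroup.pow_mem _ (Subgroup.subset_closure (Set.mem_insert
      (a k e u ^ (j : ZMod (2 * 3 ^ e * k)).val) {b k e u})) m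
    rwa [hm] at this
  · exact Subgroup.subset_closure (Set.mem_insert_of_mem _ rfl)

end G₃

/-- The map `M₃(k, e, j)`, the algebraic map of `G₃(k, e)` with generators `a ^ j` and `b`. -/
def M₃ (k e : ℕ) (u : ℤ) (j : (ZMod (2 * 3 ^ e * k))ˣ) : OrientedMap (G₃ k e u) :=
  OrientedMap.algebraic (G₃.a k e u ^ (j : ZMod (2 * 3 ^ e * k)).val) (G₃.b k e u)
    (G₃.b_mul_b k e u) (G₃.b_ne_one k e u) (G₃.closure_eq_top k e u j)

/-! An orientably-regular map is the algebraic map of its automorphism group `G = ⟨a, b⟩`, where `a`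
generates the stabiliser of a vertex and `b` reverses an arc at it. For `K_{3[n]}` the subgroup `K`
preserving the three parts has index six and is the product of `⟨x⟩` and `⟨y⟩`, cyclic of order `n`
with trivial intersection, where `x = a ^ 2` and `y` is its conjugate by `b`. This situation is
abstracted in `TripartitePair`.

The structure of `K` comes by induction on `n`. By Itô's argument `K` is metabelian, and a
nontrivial normal subgroup of `K` lies in one of the factors (`exists_normal_le_zpowers`). Hence
some subgroup of prime order `p` of `⟨x⟩` is normalised by `K`; with its conjugate by `b` it spans
an elementary abelian group of order `p ^ 2` that is central in `K` and normal in `G`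
(`central_of_normalized`). Dividing by it replaces `n` by `n / p`.

With `n = 3 ^ e * k`, put `X = x ^ 3 ^ e` and `Y = y ^ 3 ^ e`. Primes other than three create no new
commutators, so `X` and `Y` commute and `a` maps `Y` to `X⁻¹ * Y⁻¹` (`relations`). They span a
normal subgroup `W` of exponent dividing `k`, and `G / W` is the case `n = 3 ^ e`. There the
exponent hypothesis forces `c = a ^ 3 ^ e * b` to have order `3 ^ (e + 1)` and to generate a normal
subgroup (`exists_rconj_eq_zpow`), on which `a` acts as a primitive root (`not_nine_dvd`); a
suitable power of `a` therefore squares `c`. Back in `G`, the correction in `W` is forced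
(`rconj_a_c_eq`), so all defining relations of `G₃` hold and `G` is a quotient of `G₃`.

The relations give at most `6 * n ^ 2` elements in `G₃`. An affine action modulo `3 ^ (e + 1)` and
an action on the torus modulo `k` show that `x` and `y` are independent of order `n`, so the order
is exactly `6 * n ^ 2` and the quotient map is an isomorphism. Finally, `a ^ j` acts on its element
`c` as `2 ^ j` modulo `3 ^ (e + 1)`, and `2` has order `2 * 3 ^ e` there. This separates the maps by
`j` modulo `2 * 3 ^ e`, which also gives their number, and chirality since the mirror image replaces
`j` by `-j`. -/

/-! ### Products of two cyclic groups. -/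

section CyclicProduct

open scoped commutatorElement

variable {K : Type*} [Group K] {x y : K}

theorem exists_zpow_mul_zpow_swap (h : ∀ g : K, ∃ i j : ℤ, g = x ^ i * y ^ j) (g : K) :
    ∃ i j : ℤ, g = y ^ j * x ^ i := by
  obtain ⟨i, j, hg⟩ := h g⁻¹
  refine ⟨-i, -j, ?_⟩
  rw [← inv_inv g, hg]
  simp

/-- Conjugation by `x ^ r` only affects the second entry of the commutator; writing the conjugate of
`y ^ j` as `y ^ j' * x ^ s`, the factor `x ^ s` commutes with `x ^ i` and drops out. That `j'` does
not depend on `i` is what Itô's argument needs. -/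
theorem conj_zpow_commutator_left (h : ∀ g : K, ∃ i j : ℤ, g = x ^ i * y ^ j) (r j : ℤ) :
    ∃ j' : ℤ, ∀ i : ℤ, x ^ r * ⁅x ^ i, y ^ j⁆ * (x ^ r)⁻¹ = ⁅x ^ i, y ^ j'⁆ := by
  obtain ⟨s, j', hs⟩ := exists_zpow_mul_zpow_swap h (x ^ r * y ^ j * (x ^ r)⁻¹)
  refine ⟨j', fun i => ?_⟩
  have h1 : x ^ r * ⁅x ^ i, y ^ j⁆ * (x ^ r)⁻¹ = ⁅x ^ i, x ^ r * y ^ j * (x ^ r)⁻¹⁆ := by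
    simp only [commutatorElement_def]
    have : x ^ r * x ^ i = x ^ i * x ^ r := by rw [← zpow_add, ← zpow_add, add_comm]
    have h2 : (x ^ i)⁻¹ * x ^ r = x ^ r * (x ^ i)⁻¹ := by
      rw [inv_mul_eq_iff_eq_mul, ← mul_assoc, ← this, mul_inv_cancel_right]
    calc x ^ r * (x ^ i * y ^ j * (x ^ i)⁻¹ * (y ^ j)⁻¹) * (x ^ r)⁻¹
        = (x ^ r * x ^ i) * y ^ j * (x ^ i)⁻¹ * (y ^ j)⁻¹ * (x ^ r)⁻¹ := by group
      _ = x ^ i * x ^ r * y ^ j * (x ^ r)⁻¹ * (x ^ r * (x ^ i)⁻¹) * (y ^ j)⁻¹ * (x ^ r)⁻¹ := by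
          rw [this]; group
      _ = _ := by rw [← h2]; group
  rw [h1, hs]
  simp only [commutatorElement_def]
  have : x ^ s * (x ^ i)⁻¹ * (x ^ s)⁻¹ = (x ^ i)⁻¹ := by
    rw [← zpow_neg, ← zpow_neg, ← zpow_add, ← zpow_add]; congr 1; ring
  calc x ^ i * (y ^ j' * x ^ s) * (x ^ i)⁻¹ * (y ^ j' * x ^ s)⁻¹
      = x ^ i * y ^ j' * (x ^ s * (x ^ i)⁻¹ * (x ^ s)⁻¹) * (y ^ j')⁻¹ := by group
    _ = _ := by rw [this]

theorem conj_zpow_commutator_right (h : ∀ g : K, ∃ i j : ℤ, g = x ^ i * y ^ j) (r i : ℤ) :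
    ∃ i' : ℤ, ∀ j : ℤ, y ^ r * ⁅x ^ i, y ^ j⁆ * (y ^ r)⁻¹ = ⁅x ^ i', y ^ j⁆ := by
  have h' : ∀ g : K, ∃ i j : ℤ, g = y ^ i * x ^ j := fun g => by
    obtain ⟨i, j, hg⟩ := exists_zpow_mul_zpow_swap h g
    exact ⟨j, i, hg⟩
  obtain ⟨i', hi⟩ := conj_zpow_commutator_left h' r i
  refine ⟨i', fun j => ?_⟩
  rw [← commutatorElement_inv (y ^ j) (x ^ i), ← commutatorElement_inv (y ^ j) (x ^ i'), ← hi j]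
  group

/-- Itô's argument: in a product of two cyclic groups, the commutators between the factors
commute. -/
theorem commute_commutator_zpow (h : ∀ g : K, ∃ i j : ℤ, g = x ^ i * y ^ j) (i j i₁ j₁ : ℤ) :
    Commute ⁅x ^ i, y ^ j⁆ ⁅x ^ i₁, y ^ j₁⁆ := by
  obtain ⟨j', hj⟩ := conj_zpow_commutator_left h (-i₁) j
  obtain ⟨i', hi⟩ := conj_zpow_commutator_right h (-j₁) i
  -- One conjugation changes only the exponent of `y`, the other only that of `x`, each uniformly in
  -- the other exponent. So they commute on this commutator, and the commutator of the two
  -- conjugating elements centralises it.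
  have e1 : x ^ (-i₁) * (y ^ (-j₁) * ⁅x ^ i, y ^ j⁆ * (y ^ (-j₁))⁻¹) * (x ^ (-i₁))⁻¹ =
      y ^ (-j₁) * (x ^ (-i₁) * ⁅x ^ i, y ^ j⁆ * (x ^ (-i₁))⁻¹) * (y ^ (-j₁))⁻¹ := by
    rw [hi, hj, hj, hi]
  generalize ⁅x ^ i, y ^ j⁆ = u at *
  rw [commute_iff_eq, commutatorElement_def]
  simp only [zpow_neg, inv_inv] at e1
  generalize x ^ i₁ = a at *
  generalize y ^ j₁ = b at *
  have e2 : b⁻¹ * u * b = a * (b⁻¹ * (a⁻¹ * u * a) * b) * a⁻¹ := by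
    rw [← e1]; group
  have e3 : u = b * a * b⁻¹ * a⁻¹ * u * (a * b * a⁻¹ * b⁻¹) := by
    calc u = b * (b⁻¹ * u * b) * b⁻¹ := by group
      _ = _ := by rw [e2]; group
  calc u * (a * b * a⁻¹ * b⁻¹)
      = (a * b * a⁻¹ * b⁻¹) * (b * a * b⁻¹ * a⁻¹ * u * (a * b * a⁻¹ * b⁻¹)) := by group
    _ = _ := by rw [← e3]

/-- A finite product of two cyclic groups has an abelian normal subgroup containing all
commutators. -/
theorem exists_abelian_normal_of_zpow_mul_zpow (h : ∀ g : K, ∃ i j : ℤ, g = x ^ i * y ^ j) :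
    ∃ M : Subgroup K, M.Normal ∧ (∀ g ∈ M, ∀ g' ∈ M, g * g' = g' * g) ∧
      ∀ g g' : K, g⁻¹ * g'⁻¹ * g * g' ∈ M := by
  let S : Set K := {g | ∃ i j : ℤ, g = ⁅x ^ i, y ^ j⁆}
  have hS : ∀ g ∈ S, ∀ u : K, u * g * u⁻¹ ∈ S := by
    rintro _ ⟨i, j, rfl⟩ u
    obtain ⟨r, s, rfl⟩ := h u
    obtain ⟨i', hi⟩ := conj_zpow_commutator_right h s i
    obtain ⟨j', hj⟩ := conj_zpow_commutator_left h r j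
    refine ⟨i', j', ?_⟩
    rw [← hj, ← hi]; group
  have hn : (Subgroup.closure S).Normal := by
    refine ⟨fun g hg u => ?_⟩
    induction hg using Subgroup.closure_induction with
    | mem g hg => exact Subgroup.subset_closure (hS g hg u)
    | one => simp
    | mul g g' _ _ h1 h2 =>
      have : u * (g * g') * u⁻¹ = (u * g * u⁻¹) * (u * g' * u⁻¹) := by group
      rw [this]; exact mul_mem h1 h2
    | inv g _ h1 =>
      have : u * g⁻¹ * u⁻¹ = (u * g * u⁻¹)⁻¹ := by group
      rw [this]; exact inv_mem h1
  refine ⟨Subgroup.closure S, hn, ?_, ?_⟩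
  · intro g hg g' hg'
    have hc : ∀ a ∈ S, ∀ b ∈ S, a * b = b * a := by
      rintro _ ⟨i, j, rfl⟩ _ ⟨i', j', rfl⟩
      exact commute_commutator_zpow h i j i' j'
    induction hg, hg' using Subgroup.closure_induction₂ with
    | mem a b ha hb => exact hc a ha b hb
    | one_left => simp
    | one_right => simp
    | mul_left a b c _ _ _ h1 h2 => exact Commute.mul_left (a := a) (b := b) (c := c) h1 h2
    | mul_right a b c _ _ _ h1 h2 => exact Commute.mul_right (a := c) (b := a) (c := b) h1 h2
    | inv_left a b _ _ h1 => exact Commute.inv_left (a := a) (b := b) h1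
    | inv_right a b _ _ h1 => exact Commute.inv_right (a := a) (b := b) h1
  · have key : ∀ g : K, ∃ i j : ℤ, (QuotientGroup.mk' (Subgroup.closure S) g) =
        QuotientGroup.mk' (Subgroup.closure S) x ^ i *
        QuotientGroup.mk' (Subgroup.closure S) y ^ j := by
      intro g
      obtain ⟨i, j, hg⟩ := h g
      exact ⟨i, j, by rw [hg]; simp⟩
    have hxy : Commute (QuotientGroup.mk' (Subgroup.closure S) x)
        (QuotientGroup.mk' (Subgroup.closure S) y) := by
      rw [← commutatorElement_eq_one_iff_commute, ← map_commutatorElement]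
      refine (QuotientGroup.eq_one_iff _).2 (Subgroup.subset_closure ⟨1, 1, by simp⟩)
    intro g g'
    rw [← QuotientGroup.eq_one_iff]
    have hc : Commute (QuotientGroup.mk' (Subgroup.closure S) g)
        (QuotientGroup.mk' (Subgroup.closure S) g') := by
      obtain ⟨i, j, hg⟩ := key g
      obtain ⟨i', j', hg'⟩ := key g'
      rw [hg, hg']
      refine Commute.mul_left (Commute.mul_right ?_ ?_) (Commute.mul_right ?_ ?_)
      · exact (Commute.refl _).zpow_zpow _ _
      · exact hxy.zpow_zpow _ _
      · exact hxy.symm.zpow_zpow _ _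
      · exact (Commute.refl _).zpow_zpow _ _
    change QuotientGroup.mk' (Subgroup.closure S) (g⁻¹ * g'⁻¹ * g * g') = 1
    simp only [map_mul, map_inv]
    rw [mul_assoc, hc.eq, ← mul_assoc]
    simp

/-- In a product of two cyclic groups with trivial intersection, no conjugate of a nontrivial
element of the first lies in the second. -/
theorem zpow_eq_one_of_conj_eq_zpow (h : ∀ g : K, ∃ i j : ℤ, g = x ^ i * y ^ j)
    (hd : ∀ i j : ℤ, x ^ i = y ^ j → x ^ i = 1) (m : K) (i j : ℤ)
    (hm : m * x ^ i * m⁻¹ = y ^ j) : x ^ i = 1 := by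
  obtain ⟨r, s, rfl⟩ := exists_zpow_mul_zpow_swap h m
  apply hd i j
  have hc : x ^ r * x ^ i * (x ^ r)⁻¹ = x ^ i := by
    rw [← zpow_neg, ← zpow_add, ← zpow_add]; congr 1; ring
  have hy : (y ^ s)⁻¹ * y ^ j * y ^ s = y ^ j := by
    rw [← zpow_neg, ← zpow_add, ← zpow_add]; congr 1; ring
  calc x ^ i = (y ^ s)⁻¹ * (y ^ s * (x ^ r * x ^ i * (x ^ r)⁻¹) * (y ^ s)⁻¹) * y ^ s := by
        rw [hc]; group
    _ = (y ^ s)⁻¹ * (y ^ s * x ^ r * x ^ i * (y ^ s * x ^ r)⁻¹) * y ^ s := by group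
    _ = y ^ j := by rw [hm, hy]

end CyclicProduct

section CyclicProduct

variable {K : Type*} [Group K] {x y : K}

theorem exists_mem_ne_one_of_ne_bot {H : Subgroup K} (hH : H ≠ ⊥) : ∃ g ∈ H, g ≠ 1 := by
  obtain ⟨⟨g, hg⟩, hg1⟩ := Subgroup.ne_bot_iff_exists_ne_one.1 hH
  exact ⟨g, hg, fun h => hg1 (Subtype.ext h)⟩

/-- The elements of an abelian group `N` fixed by `k` are stable under conjugation, modulo an abelian
normal subgroup containing the commutators; so for `N` minimal they are trivial or everything. -/
theorem forall_or_forall_of_minimal {M N : Subgroup K}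
    (hMc : ∀ g ∈ M, ∀ g' ∈ M, g * g' = g' * g) (hM : ∀ g g' : K, g⁻¹ * g'⁻¹ * g * g' ∈ M)
    (hN : N.Normal) (hNM : N ≤ M)
    (hmin : ∀ N' : Subgroup K, N'.Normal → N' ≤ N → N' ≠ ⊥ → N' = N) (k : K) :
    (∀ g ∈ N, Commute g k) ∨ ∀ g ∈ N, Commute g k → g = 1 := by
  let C : Subgroup K := N ⊓ Subgroup.centralizer {k}
  have hC : ∀ g, g ∈ C ↔ g ∈ N ∧ Commute g k := by
    intro g
    simp [C, Subgroup.mem_inf, Subgroup.mem_centralizer_iff, commute_iff_eq, eq_comm]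
  have hCn : C.Normal := by
    refine ⟨fun g hg u => ?_⟩
    rw [hC] at hg ⊢
    refine ⟨hN.conj_mem g hg.1 u, ?_⟩
    have h1 : Commute g (k⁻¹ * u⁻¹ * k * u) := hMc _ (hNM hg.1) _ (hM k u)
    have h2 : Commute g (u⁻¹ * k * u) := by
      have := hg.2.mul_right h1
      have e : k * (k⁻¹ * u⁻¹ * k * u) = u⁻¹ * k * u := by group
      rwa [e] at this
    have h3 : Commute (u * g * u⁻¹) (u * (u⁻¹ * k * u) * u⁻¹) := Commute.conj_iff u |>.2 h2
    have e : u * (u⁻¹ * k * u) * u⁻¹ = k := by group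
    rwa [e] at h3
  by_cases hb : C = ⊥
  · right
    intro g hg hgk
    have : g ∈ C := (hC g).2 ⟨hg, hgk⟩
    rwa [hb, Subgroup.mem_bot] at this
  · left
    intro g hg
    rw [← hmin C hCn inf_le_left hb] at hg
    exact ((hC g).1 hg).2

theorem commute_of_forall_zpow_mul_zpow (h : ∀ g : K, ∃ i j : ℤ, g = x ^ i * y ^ j) {u : K}
    (hx : Commute u x) (hy : Commute u y) (g : K) : Commute u g := by
  obtain ⟨i, j, rfl⟩ := h g
  exact (hx.zpow_right i).mul_right (hy.zpow_right j)

/-- In a centreless product of two cyclic groups with trivial intersection, a minimal normal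
abelian subgroup that is centralised by the second factor lies in it. -/
theorem le_zpowers_of_commute (h : ∀ g : K, ∃ i j : ℤ, g = x ^ i * y ^ j)
    (hz : Subgroup.center K = ⊥) {N : Subgroup K} (hy : ∀ g ∈ N, Commute g y) :
    N ≤ Subgroup.zpowers y := by
  intro g hg
  obtain ⟨i, j, rfl⟩ := h g
  have h1 : Commute (x ^ i) y := by
    have := (hy _ hg).mul_left ((Commute.refl y).zpow_left (-j))
    simpa [mul_assoc] using this
  have h2 : x ^ i ∈ Subgroup.center K := by
    rw [Subgroup.mem_center_iff]
    exact fun g => (commute_of_forall_zpow_mul_zpow h ((Commute.refl x).zpow_left i) h1 g).symm.eq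
  rw [hz, Subgroup.mem_bot] at h2
  rw [h2, one_mul]
  exact ⟨j, rfl⟩

/-- If `x ^ i * y ^ j` is central, each of its two factors commutes with both `x` and `y`, hence is
central; one of them is nontrivial. -/
theorem exists_normal_of_center_ne_bot (h : ∀ g : K, ∃ i j : ℤ, g = x ^ i * y ^ j)
    (hz : Subgroup.center K ≠ ⊥) :
    ∃ N : Subgroup K, N.Normal ∧ N ≠ ⊥ ∧
      (N ≤ Subgroup.zpowers x ∨ N ≤ Subgroup.zpowers y) := by
  obtain ⟨g, hg, hg1⟩ := exists_mem_ne_one_of_ne_bot hz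
  have key : ∀ u : K, (∀ g : K, Commute u g) → (Subgroup.zpowers u).Normal := by
    intro u hu
    refine ⟨?_⟩
    rintro _ ⟨i, rfl⟩ g
    refine ⟨i, ?_⟩
    have := ((hu g).zpow_left i).eq
    simp only
    rw [← this, mul_inv_cancel_right]
  rw [Subgroup.mem_center_iff] at hg
  obtain ⟨i, j, rfl⟩ := h g
  have h1 : Commute (x ^ i) y := by
    have : Commute (x ^ i * y ^ j) y := (hg y).symm
    have := this.mul_left ((Commute.refl y).zpow_left (-j))
    simpa [mul_assoc] using this
  have h2 : Commute (y ^ j) x := by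
    have : Commute (x ^ i * y ^ j) x := (hg x).symm
    have := ((Commute.refl x).zpow_left (-i)).mul_left this
    simpa [mul_assoc] using this
  by_cases hx : x ^ i = 1
  · have hy : y ^ j ≠ 1 := fun hy => hg1 (by rw [hx, hy, one_mul])
    refine ⟨Subgroup.zpowers (y ^ j), key _ (commute_of_forall_zpow_mul_zpow h h2
      ((Commute.refl y).zpow_left j)), ?_, Or.inr ?_⟩
    · rwa [ne_eq, Subgroup.zpowers_eq_bot]
    · rw [Subgroup.zpowers_le]; exact ⟨j, rfl⟩
  · refine ⟨Subgroup.zpowers (x ^ i), key _ (commute_of_forall_zpow_mul_zpow h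
      ((Commute.refl x).zpow_left i) h1), ?_, Or.inl ?_⟩
    · rwa [ne_eq, Subgroup.zpowers_eq_bot]
    · rw [Subgroup.zpowers_le]; exact ⟨i, rfl⟩

/-- If two commuting elements `u`, `v` satisfy `g⁻¹ u g = u v ^ c` and `g⁻¹ v g = v`, then
`g ^ r` maps `u` to `u v ^ (c r)`. -/
theorem conj_pow_eq_of_unipotent {u v g : K} {c : ℤ} (hu : g⁻¹ * u * g = u * v ^ c)
    (hv : Commute v g) (r : ℕ) : (g ^ r)⁻¹ * u * g ^ r = u * v ^ (c * r) := by
  induction r with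
  | zero => simp
  | succ r ih =>
    have h1 : g⁻¹ * v ^ (c * r) * g = v ^ (c * r) := by
      rw [mul_assoc, (hv.zpow_left (c * r)).eq, inv_mul_cancel_left]
    calc (g ^ (r + 1))⁻¹ * u * g ^ (r + 1) = g⁻¹ * ((g ^ r)⁻¹ * u * g ^ r) * g := by
          rw [pow_succ]; group
      _ = (g⁻¹ * u * g) * (g⁻¹ * v ^ (c * r) * g) := by rw [ih]; group
      _ = _ := by rw [hu, h1, mul_assoc, ← zpow_add]; congr 2; push_cast; ring

/-- In the cyclic group generated by `x`, any two nontrivial elements killed by a prime are powers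
of each other. -/
theorem exists_zpow_eq_of_pow_prime {p : ℕ} (hp : p.Prime) {i j : ℤ}
    (hi : (x ^ i) ^ p = 1) (hj : (x ^ j) ^ p = 1) (hj1 : x ^ j ≠ 1) :
    ∃ r : ℤ, x ^ i = (x ^ j) ^ r := by
  have hp' : Prime (p : ℤ) := Nat.prime_iff_prime_int.1 hp
  rw [← zpow_natCast, ← zpow_mul, ← orderOf_dvd_iff_zpow_eq_one] at hi hj
  rw [ne_eq, ← orderOf_dvd_iff_zpow_eq_one] at hj1
  have hpN : (p : ℤ) ∣ orderOf x := by
    by_contra hc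
    exact hj1 (((hp'.coprime_iff_not_dvd.2 hc).symm).dvd_of_dvd_mul_right hj)
  obtain ⟨q, hq⟩ := hpN
  have hp0 : (p : ℤ) ≠ 0 := hp'.ne_zero
  rw [hq] at hi hj hj1
  obtain ⟨i', rfl⟩ : q ∣ i := by
    obtain ⟨t, ht⟩ := hi
    exact ⟨t, mul_right_cancel₀ hp0 (by rw [ht]; ring)⟩
  obtain ⟨j', rfl⟩ : q ∣ j := by
    obtain ⟨t, ht⟩ := hj
    exact ⟨t, mul_right_cancel₀ hp0 (by rw [ht]; ring)⟩
  have hc : IsCoprime (p : ℤ) j' := by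
    rw [hp'.coprime_iff_not_dvd]
    rintro ⟨t, rfl⟩
    exact hj1 ⟨t, by ring⟩
  obtain ⟨s, t, hst⟩ := hc
  refine ⟨t * i', ?_⟩
  rw [← zpow_mul, ← mul_inv_eq_one, ← zpow_neg, ← zpow_add, ← orderOf_dvd_iff_zpow_eq_one, hq]
  refine ⟨s * i', ?_⟩
  linear_combination (-q * i') * hst

end CyclicProduct

section CyclicProduct

variable {K : Type*} [Group K] {x y : K}

/-- A finite nontrivial product of two cyclic groups with trivial intersection has a nontrivial
normal subgroup contained in one of the factors. -/
theorem exists_normal_le_zpowers [Finite K] [Nontrivial K]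
    (h : ∀ g : K, ∃ i j : ℤ, g = x ^ i * y ^ j) (hd : ∀ i j : ℤ, x ^ i = y ^ j → x ^ i = 1) :
    ∃ N : Subgroup K, N.Normal ∧ N ≠ ⊥ ∧
      (N ≤ Subgroup.zpowers x ∨ N ≤ Subgroup.zpowers y) := by
  by_cases hz : Subgroup.center K ≠ ⊥
  · exact exists_normal_of_center_ne_bot h hz
  rw [not_not] at hz
  have h' : ∀ g : K, ∃ i j : ℤ, g = y ^ i * x ^ j := fun g => by
    obtain ⟨i, j, hg⟩ := exists_zpow_mul_zpow_swap h g
    exact ⟨j, i, hg⟩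
  obtain ⟨M, hMn, hMc, hM⟩ := exists_abelian_normal_of_zpow_mul_zpow h
  have hMb : M ≠ ⊥ := by
    intro hb
    obtain ⟨g, hg⟩ := exists_ne (1 : K)
    apply hg
    have : g ∈ Subgroup.center K := by
      rw [Subgroup.mem_center_iff]
      intro u
      have := hM u g
      rw [hb, Subgroup.mem_bot] at this
      calc u * g = g * u * (u⁻¹ * g⁻¹ * u * g) := by group
        _ = _ := by rw [this, mul_one]
    rwa [hz, Subgroup.mem_bot] at this
  obtain ⟨N, ⟨hN, hNb, hNM⟩, hmin⟩ : ∃ N : Subgroup K, (N.Normal ∧ N ≠ ⊥ ∧ N ≤ M) ∧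
      ∀ N' : Subgroup K, N'.Normal → N' ≤ N → N' ≠ ⊥ → N' = N := by
    obtain ⟨N, hN⟩ := Set.Finite.exists_minimal
      (Set.toFinite {N : Subgroup K | N.Normal ∧ N ≠ ⊥ ∧ N ≤ M}) ⟨M, hMn, hMb, le_rfl⟩
    exact ⟨N, hN.prop, fun N' h1 h2 h3 =>
      le_antisymm h2 (hN.2 ⟨h1, h3, h2.trans hN.prop.2.2⟩ h2)⟩
  have hNc : ∀ g ∈ N, ∀ g' ∈ N, Commute g g' := fun g hg g' hg' => hMc g (hNM hg) g' (hNM hg')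
  have dich := forall_or_forall_of_minimal hMc hM hN hNM hmin
  refine ⟨N, hN, hNb, ?_⟩
  -- If `x` or `y` centralises `N`, then `N` lies in that factor. What remains is the case where
  -- both act on `N` without nontrivial fixed points, which is impossible.
  rcases dich y with hy | hy
  · exact Or.inr (le_zpowers_of_commute h hz hy)
  rcases dich x with hx | hx
  · exact Or.inl (le_zpowers_of_commute h' hz hx)
  exfalso
  -- every element of `N` is a product of commuting elements of the factors centralising `N`
  have hcent : ∀ i j : ℤ, x ^ i * y ^ j ∈ N → ∀ g ∈ N, Commute g (x ^ i) := by
    intro i j hn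
    rcases dich (x ^ i) with h1 | h1
    · exact h1
    intro g hg
    -- If `x ^ i` has no nontrivial fixed point on `N`, commutation with it is injective on the
    -- finite group `N`, hence onto. Then `x ^ i * y ^ j` is itself such a commutator, which makes
    -- `y ^ j` conjugate to `x ^ (-i)`, so `x ^ i = 1`.
    let f : N → N := fun m => ⟨x ^ i * m * (x ^ i)⁻¹ * m⁻¹,
      mul_mem (hN.conj_mem _ m.2 _) (inv_mem m.2)⟩
    have hf : Function.Injective f := by
      intro m m' hm
      have hm' : x ^ i * m * (x ^ i)⁻¹ * (m : K)⁻¹ = x ^ i * m' * (x ^ i)⁻¹ * (m' : K)⁻¹ :=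
        congrArg Subtype.val hm
      have hc := hNc _ (hN.conj_mem _ m'.2 (x ^ i)) _ (inv_mem m'.2)
      have h2 : (m' : K)⁻¹ * m = (x ^ i)⁻¹ * ((m' : K)⁻¹ * m) * x ^ i := by
        have h3 : x ^ i * m * (x ^ i)⁻¹ = x ^ i * m' * (x ^ i)⁻¹ * ((m' : K)⁻¹ * m) := by
          rw [← mul_assoc, ← hm']; group
        have h4 : x ^ i * ((m' : K)⁻¹ * m) * (x ^ i)⁻¹ = (m' : K)⁻¹ * m := by
          calc _ = (x ^ i * m' * (x ^ i)⁻¹)⁻¹ * (x ^ i * m * (x ^ i)⁻¹) := by group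
            _ = _ := by rw [h3]; group
        calc _ = (x ^ i)⁻¹ * (x ^ i * ((m' : K)⁻¹ * m) * (x ^ i)⁻¹) * x ^ i := by group
          _ = _ := by rw [h4]
      have h3 : (m' : K)⁻¹ * m = 1 := h1 _ (mul_mem (inv_mem m'.2) m.2) (by
        rw [commute_iff_eq]
        nth_rewrite 2 [h2]
        group)
      exact Subtype.ext (inv_mul_eq_one.1 h3).symm
    obtain ⟨m, hm⟩ := Finite.surjective_of_injective hf ⟨_, hn⟩
    have hm' : x ^ i * m * (x ^ i)⁻¹ * (m : K)⁻¹ = x ^ i * y ^ j := congrArg Subtype.val hm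
    have h2 : (m : K) * x ^ (-i) * (m : K)⁻¹ = y ^ j := by
      rw [zpow_neg]
      have := congrArg (fun t => (x ^ i)⁻¹ * t) hm'
      simpa [mul_assoc] using this
    have h3 := zpow_eq_one_of_conj_eq_zpow h hd m (-i) j h2
    rw [zpow_neg, inv_eq_one] at h3
    rw [h3]
    exact Commute.one_right g
  -- Minimality makes `N` elementary abelian: the elements killed by a prime `p` dividing its order
  -- form a nontrivial normal subgroup.
  obtain ⟨p, hp, hNp⟩ : ∃ p : ℕ, p.Prime ∧ ∀ g ∈ N, g ^ p = 1 := by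
    have hcard : Nat.card N ≠ 1 := by rwa [ne_eq, Subgroup.card_eq_one]
    obtain ⟨p, hp, hpd⟩ := Nat.exists_prime_and_dvd hcard
    have : Fact p.Prime := ⟨hp⟩
    obtain ⟨g, hg⟩ := exists_prime_orderOf_dvd_card' p hpd
    refine ⟨p, hp, ?_⟩
    let Ω : Subgroup K :=
      { carrier := {g | g ∈ N ∧ g ^ p = 1}
        one_mem' := ⟨one_mem _, one_pow _⟩
        mul_mem' := fun {a b} ha hb => ⟨mul_mem ha.1 hb.1, by
          rw [(hNc a ha.1 b hb.1).mul_pow, ha.2, hb.2, one_mul]⟩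
        inv_mem' := fun {a} ha => ⟨inv_mem ha.1, by rw [inv_pow, ha.2, inv_one]⟩ }
    have hΩ : Ω.Normal := ⟨fun a ha u => ⟨hN.conj_mem a ha.1 u, by
      rw [conj_pow, ha.2, mul_one, mul_inv_cancel]⟩⟩
    have hΩb : Ω ≠ ⊥ := by
      intro hb
      have h1 : (g : K) ∈ Ω := ⟨g.2, by
        rw [← hg]; exact_mod_cast congrArg Subtype.val (pow_orderOf_eq_one g)⟩
      rw [hb, Subgroup.mem_bot] at h1
      have : g = 1 := Subtype.ext h1
      rw [this, orderOf_one] at hg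
      exact hp.one_lt.ne hg
    have hΩN := hmin Ω hΩ (fun a ha => ha.1) hΩb
    intro a ha
    rw [← hΩN] at ha
    exact ha.2
  have : Fact p.Prime := ⟨hp⟩
  have hsplit : ∀ i j : ℤ, x ^ i * y ^ j ∈ N →
      Commute (x ^ i) (y ^ j) ∧ (x ^ i) ^ p = 1 ∧ (y ^ j) ^ p = 1 := by
    intro i j hn
    have h1 : Commute (x ^ i) (y ^ j) := by
      have := ((Commute.refl (x ^ i)).inv_left.mul_left (hcent i j hn _ hn)).symm
      rwa [inv_mul_cancel_left] at this
    have h2 := hNp _ hn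
    rw [h1.mul_pow] at h2
    have h3 : (x ^ i) ^ p = 1 := by
      have := hd (i * p) (-(j * p)) (by
        rw [zpow_neg, zpow_mul, zpow_mul, zpow_natCast, zpow_natCast]
        exact eq_inv_of_mul_eq_one_left h2)
      rwa [zpow_mul, zpow_natCast] at this
    exact ⟨h1, h3, by rwa [h3, one_mul] at h2⟩
  obtain ⟨n₀, hn₀, hn₀1⟩ := exists_mem_ne_one_of_ne_bot hNb
  obtain ⟨i₀, j₀, hxy₀⟩ := h n₀
  have hn₀' := hn₀
  rw [hxy₀] at hn₀'
  obtain ⟨hc₀, hx₀, hy₀⟩ := hsplit i₀ j₀ hn₀'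
  have hx₀1 : x ^ i₀ ≠ 1 := by
    intro h1
    apply hn₀1
    apply hy _ hn₀
    rw [hxy₀, h1, one_mul]
    exact (Commute.refl y).zpow_left j₀
  -- `N` has order `p`: the `x`-parts of its elements lie in the only subgroup of order `p` of
  -- `⟨x⟩`. Dividing by a power of `n₀` leaves a power of `y` in `N`, which `y` fixes and which is
  -- therefore trivial.
  have hgen : ∀ g ∈ N, ∃ r : ℤ, g = n₀ ^ r := by
    intro g hg
    obtain ⟨i, j, rfl⟩ := h g
    obtain ⟨h1, h2, h3⟩ := hsplit i j hg
    obtain ⟨r, hr⟩ := exists_zpow_eq_of_pow_prime hp h2 hx₀ hx₀1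
    refine ⟨r, ?_⟩
    have h4 : n₀ ^ (-r) * (x ^ i * y ^ j) ∈ N := mul_mem (zpow_mem hn₀ _) hg
    have h5 : n₀ ^ (-r) * (x ^ i * y ^ j) = y ^ (-(j₀ * r) + j) := by
      rw [hxy₀, hc₀.mul_zpow, hr, (hc₀.zpow_zpow _ _).eq, zpow_neg (x ^ i₀), mul_assoc,
        inv_mul_cancel_left, ← zpow_mul, ← zpow_add]
      congr 1; ring
    have h6 := hy _ h4 (by rw [h5]; exact (Commute.refl y).zpow_left _)
    rw [zpow_neg, inv_mul_eq_one] at h6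
    exact h6.symm
  obtain ⟨t, ht⟩ := hgen (x⁻¹ * n₀ * x) (by simpa using hN.conj_mem _ hn₀ x⁻¹)
  obtain ⟨s, hs⟩ := hgen (y⁻¹ * n₀ * y) (by simpa using hN.conj_mem _ hn₀ y⁻¹)
  set u := x ^ i₀ with hu
  set v := y ^ j₀ with hv
  have hun : Commute u n₀ := by rw [hxy₀]; exact (Commute.refl u).mul_right hc₀
  have hux : Commute u x := (Commute.refl x).zpow_left i₀
  have huy : y⁻¹ * u * y = u * n₀ ^ (s - 1) := by
    have h1 : u = n₀ * v⁻¹ := by rw [hxy₀, mul_inv_cancel_right]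
    have hvy : Commute v⁻¹ y := ((Commute.refl y).zpow_left j₀).inv_left
    have hnv : Commute n₀ v⁻¹ := by
      rw [hxy₀]; exact (hc₀.mul_left (Commute.refl v)).inv_right
    calc y⁻¹ * u * y = (y⁻¹ * n₀ * y) * (y⁻¹ * (v⁻¹ * y)) := by
          nth_rewrite 1 [h1]; group
      _ = n₀ ^ s * v⁻¹ := by rw [hvy.eq, hs]; group
      _ = u * n₀ ^ (s - 1) := by
        rw [h1, mul_assoc, (hnv.zpow_left (s - 1)).symm.eq, ← mul_assoc, ← zpow_one_add]
        congr 2; ring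
  set g := (y * x)⁻¹ * (x * y) with hg
  have hgM : g ∈ M := by
    have := hM x y
    have e : g = x⁻¹ * y⁻¹ * x * y := by rw [hg]; group
    rwa [e]
  have hng : Commute n₀ g := hMc _ (hNM hn₀) _ hgM
  have hconjx : ∀ r : ℤ, x⁻¹ * n₀ ^ r * x = n₀ ^ (t * r) := by
    intro r
    have := conj_zpow (i := r) (a := x⁻¹) (b := n₀)
    rw [inv_inv] at this
    rw [← this, ht, zpow_mul]
  -- The commutator of `x` and `y` acts unipotently on `⟨u, n₀⟩`. Its off-diagonal entry is nonzero
  -- modulo `p`, because neither `x` nor `y` centralises `n₀`.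
  have hug : g⁻¹ * u * g = u * n₀ ^ ((s - 1) * (1 - t)) := by
    have e1 : (y * x)⁻¹ * u * (y * x) = u * n₀ ^ (t * (s - 1)) := by
      calc (y * x)⁻¹ * u * (y * x) = x⁻¹ * (y⁻¹ * u * y) * x := by group
        _ = (x⁻¹ * (u * x)) * (x⁻¹ * n₀ ^ (s - 1) * x) := by rw [huy]; group
        _ = _ := by rw [hux.eq, inv_mul_cancel_left, hconjx]
    have e2 : (x * y)⁻¹ * u * (x * y) = u * n₀ ^ (s - 1) := by
      rw [← huy]
      calc (x * y)⁻¹ * u * (x * y) = y⁻¹ * (x⁻¹ * (u * x)) * y := by group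
        _ = _ := by rw [hux.eq, inv_mul_cancel_left]
    have e3 : g⁻¹ * (u * n₀ ^ (t * (s - 1))) * g = u * n₀ ^ (s - 1) := by
      rw [← e1, ← e2, hg]; group
    have e4 : g⁻¹ * n₀ ^ (t * (s - 1)) * g = n₀ ^ (t * (s - 1)) := by
      rw [mul_assoc, (hng.zpow_left _).eq, inv_mul_cancel_left]
    have e5 : (g⁻¹ * u * g) * n₀ ^ (t * (s - 1)) = u * n₀ ^ (s - 1) := by
      rw [← e3]; nth_rewrite 1 [← e4]; group
    rw [← eq_mul_inv_iff_mul_eq, ← zpow_neg, mul_assoc u, ← zpow_add] at e5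
    rw [e5]; congr 2; ring
  have hp' : Prime (p : ℤ) := Nat.prime_iff_prime_int.1 hp
  have hord : orderOf n₀ = p := orderOf_eq_prime (hNp _ hn₀) hn₀1
  have hne : ∀ (r : ℤ) (z : K), z⁻¹ * n₀ * z = n₀ ^ r →
      (∀ g ∈ N, Commute g z → g = 1) → ¬ (p : ℤ) ∣ r - 1 := by
    intro r z hz' hz1 hdvd
    apply hn₀1
    apply hz1 _ hn₀
    rw [← hord, orderOf_dvd_iff_zpow_eq_one, zpow_sub_one, mul_inv_eq_one] at hdvd
    rw [hdvd, mul_assoc, inv_mul_eq_iff_eq_mul] at hz'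
    exact hz'
  have hcp : IsCoprime (p : ℤ) ((s - 1) * (1 - t)) := by
    rw [hp'.coprime_iff_not_dvd, hp'.dvd_mul]
    rintro (h1 | h1)
    · exact hne s y hs hy h1
    · exact hne t x ht hx ((dvd_neg.2 h1).trans (by rw [neg_sub]))
  obtain ⟨a, b, hab⟩ := hcp
  have hp0 : (0 : ℤ) < p := by exact_mod_cast hp.pos
  -- The Bézout coefficient `-b` selects the power of `g` that maps `u` to `u * n₀⁻¹ = v⁻¹`. A
  -- nontrivial power of `x` thus becomes conjugate to a power of `y`, a contradiction.
  have hr := conj_pow_eq_of_unipotent hug hng ((-b) % p).toNat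
  rw [Int.toNat_of_nonneg (Int.emod_nonneg _ hp0.ne')] at hr
  have h1 : n₀ ^ ((s - 1) * (1 - t) * ((-b) % p)) = n₀⁻¹ := by
    rw [← mul_inv_eq_one, inv_inv, ← zpow_add_one, ← orderOf_dvd_iff_zpow_eq_one, hord,
      Int.emod_def]
    exact ⟨a - (s - 1) * (1 - t) * (-b / p), by linear_combination (-1 : ℤ) * hab⟩
  rw [h1, hxy₀, hc₀.eq, mul_inv_rev, mul_inv_cancel_left] at hr
  refine hx₀1 (zpow_eq_one_of_conj_eq_zpow h hd (g ^ ((-b) % p).toNat)⁻¹ i₀ (-j₀) ?_)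
  rw [inv_inv, zpow_neg]
  exact hr

end CyclicProduct

/-! ### Tripartite pairs and the central elementary abelian subgroup. -/

/-- Conjugation `u ↦ g⁻¹ u g` as an endomorphism. -/
def rconj {G : Type*} [Group G] (g : G) : G →* G := (MulAut.conj g⁻¹).toMonoidHom

theorem rconj_apply {G : Type*} [Group G] (g u : G) : rconj g u = g⁻¹ * u * g := by
  simp [rconj]

theorem rconj_mul {G : Type*} [Group G] (g h u : G) : rconj (g * h) u = rconj h (rconj g u) := by
  simp only [rconj_apply]; group

theorem rconj_injective {G : Type*} [Group G] (g : G) : Function.Injective (rconj g) :=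
  (MulAut.conj g⁻¹).injective

theorem rconj_eq_self_iff {G : Type*} [Group G] (g u : G) : rconj g u = u ↔ Commute u g := by
  rw [rconj_apply, mul_assoc, inv_mul_eq_iff_eq_mul, commute_iff_eq]

theorem rconj_inv_apply {G : Type*} [Group G] (g u : G) : rconj g (rconj g⁻¹ u) = u := by
  simp only [rconj_apply]; group

/-- Generators `a`, `b` of a group acting on the arcs of an embedding of `K_{3[n]}`: the normal
subgroup `K`, which preserves the three parts, is the product of the cyclic groups of order `n`
generated by `a ^ 2` and its conjugate under `b`, which intersect trivially. -/
structure TripartitePair {G : Type*} [Group G] (a b : G) (K : Subgroup G) (n : ℕ) : Prop where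
  closure_eq : Subgroup.closure {a, b} = ⊤
  b_mul_b : b * b = 1
  normal : K.Normal
  mem_iff : ∀ g, g ∈ K ↔ ∃ i j : ℤ, g = (a ^ 2) ^ i * rconj b (a ^ 2) ^ j
  pow_eq_one : (a ^ 2) ^ n = 1
  dvd_of_eq_one : ∀ i j : ℤ, (a ^ 2) ^ i * rconj b (a ^ 2) ^ j = 1 → (n : ℤ) ∣ i ∧ (n : ℤ) ∣ j
  cube_mem : (a * b) ^ 3 ∈ K
  pos : 0 < n

namespace TripartitePair

variable {G : Type*} [Group G] {a b : G} {K : Subgroup G} {n : ℕ}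

section Basic

variable (T : TripartitePair a b K n)
include T

theorem b_inv : b⁻¹ = b := inv_eq_of_mul_eq_one_left T.b_mul_b

theorem rconj_b_rconj_b (u : G) : rconj b (rconj b u) = u := by
  rw [← rconj_mul, T.b_mul_b]; simp [rconj_apply]

theorem x_mem : a ^ 2 ∈ K := (T.mem_iff _).2 ⟨1, 0, by simp⟩

theorem y_mem : rconj b (a ^ 2) ∈ K := (T.mem_iff _).2 ⟨0, 1, by simp⟩

theorem rconj_mem {g : G} (hg : g ∈ K) (u : G) : rconj u g ∈ K := by
  have := T.normal.conj_mem g hg u⁻¹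
  rwa [inv_inv, ← rconj_apply] at this

theorem x_zpow_eq_one_iff (i : ℤ) : (a ^ 2) ^ i = 1 ↔ (n : ℤ) ∣ i := by
  constructor
  · intro h
    exact (T.dvd_of_eq_one i 0 (by rw [h]; simp)).1
  · rintro ⟨t, rfl⟩
    rw [zpow_mul, zpow_natCast, T.pow_eq_one, one_zpow]

theorem y_zpow_eq_one_iff (i : ℤ) : rconj b (a ^ 2) ^ i = 1 ↔ (n : ℤ) ∣ i := by
  rw [← T.x_zpow_eq_one_iff, ← map_zpow, map_eq_one_iff _ (rconj_injective b)]

theorem dvd_sub_of_eq {i j i' j' : ℤ}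
    (h : (a ^ 2) ^ i * rconj b (a ^ 2) ^ j = (a ^ 2) ^ i' * rconj b (a ^ 2) ^ j') :
    (n : ℤ) ∣ i - i' ∧ (n : ℤ) ∣ j - j' := by
  have h1 : (a ^ 2) ^ (i - i') * rconj b (a ^ 2) ^ (j - j') = 1 := by
    rw [sub_eq_neg_add, zpow_add, sub_eq_add_neg, zpow_add, zpow_neg, zpow_neg, mul_assoc,
      ← mul_assoc _ _ (rconj b (a ^ 2) ^ j')⁻¹, h]
    group
  exact T.dvd_of_eq_one _ _ h1

theorem zpow_eq_one_of_conj {m : G} (hm : m ∈ K) (i j : ℤ)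
    (h : m * (a ^ 2) ^ i * m⁻¹ = rconj b (a ^ 2) ^ j) : (a ^ 2) ^ i = 1 := by
  have := zpow_eq_one_of_conj_eq_zpow (K := K) (x := ⟨a ^ 2, T.x_mem⟩)
    (y := ⟨rconj b (a ^ 2), T.y_mem⟩) (fun g => by
      obtain ⟨i, j, hg⟩ := (T.mem_iff g).1 g.2
      exact ⟨i, j, Subtype.ext hg⟩)
    (fun i j hij => by
      have h1 : (a ^ 2) ^ i = rconj b (a ^ 2) ^ j := congrArg Subtype.val hij
      have h2 := (T.dvd_sub_of_eq (i := i) (j := 0) (i' := 0) (j' := j) (by simpa using h1)).1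
      rw [sub_zero, ← T.x_zpow_eq_one_iff] at h2
      exact Subtype.ext h2)
    ⟨m, hm⟩ i j (Subtype.ext h)
  exact congrArg Subtype.val this

theorem finite : Finite K := by
  have hfin : IsOfFinOrder (a ^ 2) := isOfFinOrder_iff_pow_eq_one.2 ⟨n, T.pos, T.pow_eq_one⟩
  have h1 : (Subgroup.zpowers (a ^ 2) : Set G).Finite := by
    have := hfin.finite_zpowers
    exact this
  have h2 : ((rconj b) '' (Subgroup.zpowers (a ^ 2) : Set G)).Finite := h1.image _
  refine ((h1.mul h2).subset ?_).to_subtype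
  intro g hg
  obtain ⟨i, j, rfl⟩ := (T.mem_iff g).1 hg
  exact Set.mul_mem_mul ⟨i, rfl⟩ ⟨_, ⟨j, rfl⟩, by simp⟩

/-- A property stable under conjugation by `b` transfers between the two cyclic factors. -/
theorem commute_of_commute_x_y {u : G} (hx : Commute u (a ^ 2))
    (hy : Commute u (rconj b (a ^ 2))) {g : G} (hg : g ∈ K) : Commute u g := by
  obtain ⟨i, j, rfl⟩ := (T.mem_iff g).1 hg
  exact (hx.zpow_right i).mul_right (hy.zpow_right j)

end Basic

/-- If `n > 1`, then for some prime `p` dividing `n` the subgroup of order `p` of `⟨a ^ 2⟩` is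
normalised by `K`. -/
theorem exists_prime_normalized (T : TripartitePair a b K n) (hn : 1 < n) :
    ∃ p q : ℕ, p.Prime ∧ n = p * q ∧
      ∀ g ∈ K, ∃ r : ℤ, rconj g ((a ^ 2) ^ q) = ((a ^ 2) ^ q) ^ r := by
  obtain ⟨S, hSx, hSb, hSn⟩ : ∃ S : Subgroup G, S ≤ Subgroup.zpowers (a ^ 2) ∧ S ≠ ⊥ ∧
      ∀ g ∈ K, ∀ s ∈ S, rconj g s ∈ S := by
    have := T.finite
    have hx1 : a ^ 2 ≠ 1 := by
      intro h
      have h2 := (T.x_zpow_eq_one_iff 1).1 (by rw [h, one_zpow])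
      have h3 := Int.le_of_dvd one_pos h2
      lia
    have : Nontrivial K := ⟨⟨⟨a ^ 2, T.x_mem⟩, 1, fun h => hx1 (congrArg Subtype.val h)⟩⟩
    obtain ⟨N, hN, hNb, hNx⟩ := exists_normal_le_zpowers (K := K) (x := ⟨a ^ 2, T.x_mem⟩)
      (y := ⟨rconj b (a ^ 2), T.y_mem⟩) (fun g => by
        obtain ⟨i, j, hg⟩ := (T.mem_iff g).1 g.2
        exact ⟨i, j, Subtype.ext hg⟩)
      (fun i j hij => by
        have h1 : (a ^ 2) ^ i = rconj b (a ^ 2) ^ j := congrArg Subtype.val hij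
        have h2 := (T.dvd_sub_of_eq (i := i) (j := 0) (i' := 0) (j' := j) (by simpa using h1)).1
        rw [sub_zero, ← T.x_zpow_eq_one_iff] at h2
        exact Subtype.ext h2)
    have hS : ∀ g ∈ K, ∀ s ∈ N.map K.subtype, rconj g s ∈ N.map K.subtype := by
      rintro g hg _ ⟨s, hs, rfl⟩
      refine ⟨_, hN.conj_mem s hs ⟨g, hg⟩⁻¹, ?_⟩
      simp [rconj_apply]
    have hSb : N.map K.subtype ≠ ⊥ := by
      rw [ne_eq, Subgroup.map_eq_bot_iff_of_injective _ K.subtype_injective]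
      exact hNb
    -- Conjugation by `b` exchanges the two factors and preserves `K`, so the normal subgroup may be
    -- taken inside `⟨a ^ 2⟩`.
    rcases hNx with hNx | hNy
    · refine ⟨N.map K.subtype, ?_, hSb, hS⟩
      rintro _ ⟨s, hs, rfl⟩
      obtain ⟨i, rfl⟩ := hNx hs
      exact ⟨i, by simp⟩
    · refine ⟨(N.map K.subtype).map (rconj b), ?_, ?_, ?_⟩
      · rintro _ ⟨_, ⟨s, hs, rfl⟩, rfl⟩
        obtain ⟨i, rfl⟩ := hNy hs
        exact ⟨i, by simp [T.rconj_b_rconj_b]⟩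
      · rw [ne_eq, Subgroup.map_eq_bot_iff_of_injective _ (rconj_injective b)]
        exact hSb
      · rintro g hg _ ⟨s, hs, rfl⟩
        refine ⟨_, hS _ (T.rconj_mem hg b) s hs, ?_⟩
        rw [rconj_apply _ s]
        simp only [map_mul, map_inv, T.rconj_b_rconj_b]
        rw [rconj_apply g]
  obtain ⟨s, hs, hs1⟩ := exists_mem_ne_one_of_ne_bot hSb
  obtain ⟨i, hi⟩ := hSx hs
  simp only at hi
  have hsn : s ^ n = 1 := by
    rw [← hi, ← zpow_natCast, ← zpow_mul, mul_comm, zpow_mul, zpow_natCast, T.pow_eq_one,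
      one_zpow]
  have hord1 : orderOf s ≠ 1 := by rwa [ne_eq, orderOf_eq_one_iff]
  obtain ⟨p, hp, t, hpt⟩ := Nat.exists_prime_and_dvd hord1
  obtain ⟨q, hq⟩ : p ∣ n := (Dvd.intro t hpt.symm).trans (orderOf_dvd_of_pow_eq_one hsn)
  have hpos : 0 < orderOf s := orderOf_pos_iff.2 (isOfFinOrder_iff_pow_eq_one.2 ⟨n, T.pos, hsn⟩)
  have ht1 : s ^ t ≠ 1 := by
    intro h
    have := Nat.le_of_dvd (Nat.pos_of_ne_zero (by rintro rfl; lia)) (orderOf_dvd_of_pow_eq_one h)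
    rw [hpt] at this
    have : 0 < t := Nat.pos_of_ne_zero (by rintro rfl; lia)
    nlinarith [hp.two_le]
  have htp : (s ^ t) ^ p = 1 := by rw [← pow_mul, mul_comm, ← hpt, pow_orderOf_eq_one]
  have e1 : s ^ t = (a ^ 2) ^ (i * t) := by rw [← hi, zpow_mul, zpow_natCast]
  have hqp : (((a ^ 2) ^ q) ^ p) = 1 := by rw [← pow_mul, mul_comm, ← hq, T.pow_eq_one]
  have hq1 : (a ^ 2) ^ q ≠ 1 := by
    intro h
    have h2 := (T.x_zpow_eq_one_iff q).1 (by rwa [zpow_natCast])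
    have hq0 : 0 < q := Nat.pos_of_ne_zero (by rintro rfl; have := T.pos; lia)
    have h3 := Nat.le_of_dvd hq0 (Int.natCast_dvd_natCast.1 h2)
    nlinarith [hp.two_le]
  -- A cyclic group has only one subgroup of order `p`, so `(a ^ 2) ^ q` is a power of `s ^ t`.
  have hqS : (a ^ 2) ^ q ∈ S := by
    obtain ⟨r, hr⟩ := exists_zpow_eq_of_pow_prime (x := a ^ 2) (i := q) (j := i * t) hp
      (by rwa [zpow_natCast]) (by rwa [← e1]) (by rwa [← e1])
    rw [zpow_natCast, ← e1] at hr
    rw [hr]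
    exact zpow_mem (pow_mem hs t) r
  refine ⟨p, q, hp, hq, fun g hg => ?_⟩
  obtain ⟨j, hj⟩ := hSx (hSn g hg _ hqS)
  simp only at hj
  obtain ⟨r, hr⟩ := exists_zpow_eq_of_pow_prime (x := a ^ 2) (i := j) (j := q) hp
    (by rw [hj, ← map_pow, hqp, map_one]) (by rwa [zpow_natCast]) (by rwa [zpow_natCast])
  exact ⟨r, by rw [← hj, hr, zpow_natCast]⟩

end TripartitePair

namespace TripartitePair

variable {G : Type*} [Group G] {a b : G} {K : Subgroup G} {n : ℕ}

theorem rconj_a_x (a : G) : rconj a (a ^ 2) = a ^ 2 := by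
  rw [rconj_eq_self_iff]; exact (Commute.refl a).pow_left 2

section Basic

variable (T : TripartitePair a b K n)
include T

variable {p q : ℕ} (hq : n = p * q)
include hq

theorem dvd_of_x_pow_zpow {i j : ℤ}
    (h : ((a ^ 2) ^ q) ^ i * (rconj b (a ^ 2) ^ q) ^ j = 1) : (p : ℤ) ∣ i ∧ (p : ℤ) ∣ j := by
  have hq0 : (q : ℤ) ≠ 0 := by
    rintro h0
    have := T.pos
    rw [hq, Int.natCast_eq_zero.1 h0] at this
    simp at this
  rw [← zpow_natCast _ q, ← zpow_natCast _ q, ← zpow_mul, ← zpow_mul] at h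
  have h2 := T.dvd_of_eq_one (q * i) (q * j) h
  rw [hq] at h2
  push_cast at h2
  rw [mul_comm (p : ℤ)] at h2
  exact ⟨Int.dvd_of_mul_dvd_mul_left hq0 h2.1, Int.dvd_of_mul_dvd_mul_left hq0 h2.2⟩

theorem x_pow_zpow_eq {i j : ℤ} (h : (p : ℤ) ∣ i - j) :
    ((a ^ 2) ^ q) ^ i = ((a ^ 2) ^ q) ^ j := by
  obtain ⟨t, ht⟩ := h
  have h1 : ((a ^ 2) ^ q) ^ p = 1 := by rw [← pow_mul, mul_comm, ← hq, T.pow_eq_one]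
  rw [show i = j + p * t by lia, zpow_add, zpow_mul _ (p : ℤ), zpow_natCast, h1, one_zpow, mul_one]

theorem y_pow_zpow_eq {i j : ℤ} (h : (p : ℤ) ∣ i - j) :
    (rconj b (a ^ 2) ^ q) ^ i = (rconj b (a ^ 2) ^ q) ^ j := by
  rw [← map_pow, ← map_zpow, T.x_pow_zpow_eq hq h, map_zpow]

end Basic

/-- If the subgroup of prime order `p` of `⟨a ^ 2⟩` is normalised by `K`, then it is centralised by
`K`, and together with its conjugates it generates an elementary abelian group of order `p ^ 2`. -/
theorem central_of_normalized (T : TripartitePair a b K n) {p q : ℕ} (hp : p.Prime)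
    (hq : n = p * q)
    (hnorm : ∀ g ∈ K, ∃ r : ℤ, rconj g ((a ^ 2) ^ q) = ((a ^ 2) ^ q) ^ r) :
    (∀ g ∈ K, Commute ((a ^ 2) ^ q) g) ∧ (∀ g ∈ K, Commute (rconj b (a ^ 2) ^ q) g) ∧
      rconj a (rconj b (a ^ 2) ^ q) = ((a ^ 2) ^ q)⁻¹ * (rconj b (a ^ 2) ^ q)⁻¹ := by
  have hp' : Prime (p : ℤ) := Nat.prime_iff_prime_int.1 hp
  have hdvd : ∀ i j : ℤ, ((a ^ 2) ^ q) ^ i * (rconj b (a ^ 2) ^ q) ^ j = 1 →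
    (p : ℤ) ∣ i ∧ (p : ℤ) ∣ j := fun i j h => T.dvd_of_x_pow_zpow hq h
  have he1 : ∀ i j : ℤ, (p : ℤ) ∣ i - j → ((a ^ 2) ^ q) ^ i = ((a ^ 2) ^ q) ^ j :=
    fun i j h => T.x_pow_zpow_eq hq h
  have he2 : ∀ i j : ℤ, (p : ℤ) ∣ i - j →
    (rconj b (a ^ 2) ^ q) ^ i = (rconj b (a ^ 2) ^ q) ^ j := fun i j h => T.y_pow_zpow_eq hq h
  have hm1 : (a ^ 2) ^ q ∈ K := pow_mem T.x_mem q
  have hm2 : rconj b (a ^ 2) ^ q ∈ K := pow_mem T.y_mem q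
  have hb1 : rconj b ((a ^ 2) ^ q) = rconj b (a ^ 2) ^ q := map_pow _ _ _
  have ha1 : rconj a ((a ^ 2) ^ q) = (a ^ 2) ^ q := by rw [map_pow, rconj_a_x]
  have hpe1 : ((a ^ 2) ^ q) ^ p = 1 := by rw [← pow_mul, mul_comm, ← hq, T.pow_eq_one]
  have he1x : Commute ((a ^ 2) ^ q) (a ^ 2) := (Commute.refl _).pow_left q
  have hy2 : ∀ i : ℤ, (p : ℤ) ∣ i → (rconj b (a ^ 2) ^ q) ^ i = 1 := fun i hi => by
    rw [he2 i 0 (by rwa [sub_zero]), zpow_zero]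
  have hx2 : ∀ i : ℤ, (p : ℤ) ∣ i → ((a ^ 2) ^ q) ^ i = 1 := fun i hi => by
    rw [he1 i 0 (by rwa [sub_zero]), zpow_zero]
  have hqx : ∀ i : ℤ, (n : ℤ) ∣ i * p → ∃ α : ℤ, i = q * α := by
    rintro i ⟨t, ht⟩
    refine ⟨t, mul_right_cancel₀ hp'.ne_zero ?_⟩
    rw [ht, hq]; push_cast; ring
  have hxz : ∀ α : ℤ, (a ^ 2) ^ (q * α : ℤ) = ((a ^ 2) ^ q) ^ α := fun α => by
    rw [zpow_mul, zpow_natCast]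
  have hyz : ∀ α : ℤ, rconj b (a ^ 2) ^ (q * α : ℤ) = (rconj b (a ^ 2) ^ q) ^ α := fun α => by
    rw [zpow_mul, zpow_natCast]
  set e₁ := (a ^ 2) ^ q with he₁
  set e₂ := rconj b (a ^ 2) ^ q with he₂
  have hb2 : rconj b e₂ = e₁ := by rw [← hb1, T.rconj_b_rconj_b]
  have hnorm2 : ∀ g ∈ K, ∃ r : ℤ, rconj g e₂ = e₂ ^ r := by
    intro g hg
    obtain ⟨r, hr⟩ := hnorm _ (T.rconj_mem hg b)
    refine ⟨r, ?_⟩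
    have := congrArg (rconj b) hr
    rw [map_zpow, hb1, rconj_apply (rconj b g)] at this
    simp only [map_mul, map_inv, T.rconj_b_rconj_b, hb1] at this
    rw [rconj_apply, this]
  -- The groups `⟨e₁⟩` and `⟨e₂⟩` normalise each other, so the commutator lies in their trivial
  -- intersection.
  have hcomm : Commute e₁ e₂ := by
    obtain ⟨r, hr⟩ := hnorm _ hm2
    obtain ⟨s, hs⟩ := hnorm2 _ hm1
    rw [rconj_apply] at hr hs
    have h1 : e₁ ^ (r - 1) * e₂ ^ (s - 1) = 1 := by
      rw [sub_eq_neg_add, zpow_add, sub_eq_neg_add s, zpow_add, ← hr, ← hs]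
      group
    have h2 := (hdvd _ _ h1).1
    rw [he1 r 1 h2, zpow_one] at hr
    rw [commute_iff_eq, ← inv_mul_eq_iff_eq_mul, ← mul_assoc] 
    exact hr
  set e₃ := rconj a e₂ with he₃
  have hm3 : e₃ ∈ K := T.rconj_mem hm2 a
  have hpe2 : e₂ ^ p = 1 := by rw [← hb1, ← map_pow, hpe1, map_one]
  have hpe3 : e₃ ^ p = 1 := by rw [he₃, ← map_pow, hpe2, map_one]
  have he2ne : e₂ ≠ 1 := by
    intro h
    have := (hdvd 0 1 (by rw [h]; simp)).2
    exact hp'.not_isUnit (isUnit_of_dvd_one this)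
  have he3ne : e₃ ≠ 1 := by
    rw [he₃, ne_eq, map_eq_one_iff _ (rconj_injective a)]; exact he2ne
  have : Fact p.Prime := ⟨hp⟩
  have hord3 : orderOf e₃ = p := orderOf_eq_prime hpe3 he3ne
  have hnorm3 : ∀ g ∈ K, ∃ r : ℤ, rconj g e₃ = e₃ ^ r := by
    intro g hg
    obtain ⟨r, hr⟩ := hnorm2 _ (T.rconj_mem hg a⁻¹)
    refine ⟨r, ?_⟩
    rw [he₃, ← map_zpow, ← hr, rconj_apply (rconj a⁻¹ g) e₂]
    simp only [map_mul, map_inv, rconj_inv_apply]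
    rw [rconj_apply]
  -- Write `e₃ = x ^ i * y ^ j`, where `x ^ i` acts on `⟨e₃⟩` as a power map with exponent `s`. If
  -- `s` is `1` modulo `p`, the two factors commute and both are killed by `p`.
  obtain ⟨α, β, hαβ⟩ : ∃ α β : ℤ, e₃ = e₁ ^ α * e₂ ^ β := by
    obtain ⟨i, j, hij⟩ := (T.mem_iff _).1 hm3
    obtain ⟨s, hs⟩ := hnorm3 _ (zpow_mem T.x_mem (-i))
    rw [rconj_apply, zpow_neg, inv_inv] at hs
    by_cases hs1 : (p : ℤ) ∣ s - 1
    · rw [← hord3, orderOf_dvd_iff_zpow_eq_one, zpow_sub_one, mul_inv_eq_one] at hs1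
      rw [hs1, mul_inv_eq_iff_eq_mul, ← commute_iff_eq] at hs
      have h1 : Commute ((a ^ 2) ^ i) (rconj b (a ^ 2) ^ j) := by
        have := (Commute.refl ((a ^ 2) ^ i)).inv_right.mul_right hs
        rwa [hij, inv_mul_cancel_left] at this
      have h2 := hpe3
      rw [hij, h1.mul_pow, ← zpow_natCast _ p, ← zpow_natCast _ p, ← zpow_mul, ← zpow_mul] at h2
      obtain ⟨h3, h4⟩ := T.dvd_of_eq_one _ _ h2
      obtain ⟨α, rfl⟩ := hqx _ h3
      obtain ⟨β, rfl⟩ := hqx _ h4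
      exact ⟨α, β, by rw [hij, hxz, hyz]⟩
    -- Otherwise `s - 1` is invertible, and a suitable power of `e₃` conjugates `x ^ (-i)` to `y ^
    -- j`. This forces `x ^ i = 1`, hence `s` is `1` modulo `p` after all.
    · exfalso
      obtain ⟨u, t, hut⟩ := (hp'.coprime_iff_not_dvd).2 hs1
      have h1 : e₃ ^ t * (a ^ 2) ^ (-i) * (e₃ ^ t)⁻¹ = rconj b (a ^ 2) ^ j := by
        have h2 : (a ^ 2) ^ i * e₃ ^ t * ((a ^ 2) ^ i)⁻¹ = e₃ ^ (s * t) := by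
          rw [← conj_zpow, hs, zpow_mul]
        have h3 : e₃ ^ (s * t) * (e₃ ^ t)⁻¹ = e₃ := by
          rw [← zpow_neg, ← zpow_add, ← mul_inv_eq_one, ← zpow_sub_one,
            ← orderOf_dvd_iff_zpow_eq_one, hord3]
          exact ⟨-u, by linear_combination hut⟩
        calc _ = (a ^ 2) ^ (-i) * ((a ^ 2) ^ i * e₃ ^ t * ((a ^ 2) ^ i)⁻¹ * (e₃ ^ t)⁻¹) := by group
          _ = _ := by rw [h2, h3, hij]; group
      have h4 := T.zpow_eq_one_of_conj (zpow_mem hm3 t) _ _ h1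
      rw [zpow_neg, inv_eq_one] at h4
      rw [h4, inv_one, mul_one, one_mul] at hs
      apply hs1
      rw [← hord3, orderOf_dvd_iff_zpow_eq_one, zpow_sub_one, ← hs, mul_inv_cancel]
  have hab1 : rconj ((a * b) ^ 3) e₁ = rconj b (rconj a (rconj b e₃)) := by
    rw [show (a * b) ^ 3 = a * b * (a * b) * (a * b) by rw [pow_succ, pow_two]]
    simp only [rconj_mul, ha1, hb1, he₃.symm]
  -- If `e₃` were a power of `e₂`, the element `(a * b) ^ 3` of `K` would carry `⟨e₁⟩` to `⟨e₂⟩`,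
  -- although `K` normalises `⟨e₁⟩`.
  have hα : ¬ (p : ℤ) ∣ α := by
    intro h
    have h1 : e₃ = e₂ ^ β := by rw [hαβ, hx2 α h, one_mul]
    obtain ⟨r, hr⟩ := hnorm _ T.cube_mem
    rw [hab1, h1, map_zpow, hb2, map_zpow, ha1, map_zpow, hb1] at hr
    have h2 := (hdvd r (-β) (by rw [← hr, zpow_neg, mul_inv_cancel])).2
    rw [dvd_neg] at h2
    exact he3ne (by rw [h1, hy2 β h2])
  have hax : rconj (a ^ 2) e₂ = e₁ ^ (α + α * β) * e₂ ^ (β * β) := by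
    have h1 : rconj (a ^ 2) e₂ = rconj a e₃ := by rw [pow_two, rconj_mul]
    rw [h1, hαβ, map_mul, map_zpow, map_zpow, ha1, ← he₃, hαβ, (hcomm.zpow_zpow α β).mul_zpow,
      ← zpow_mul, ← zpow_mul, ← mul_assoc, ← zpow_add]
  have hβ : (p : ℤ) ∣ 1 + β := by
    obtain ⟨r, hr⟩ := hnorm2 _ T.x_mem
    rw [hax] at hr
    have h1 := (hdvd (α + α * β) (β * β - r) (by
      rw [zpow_sub, ← mul_assoc, hr, mul_inv_cancel])).1
    rw [show α + α * β = α * (1 + β) by ring, hp'.dvd_mul] at h1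
    exact h1.resolve_left hα
  have hx : Commute e₂ (a ^ 2) := by
    rw [← rconj_eq_self_iff, hax, hx2 _ (by
      rw [show α + α * β = α * (1 + β) by ring]; exact hβ.mul_left _), one_mul, he2 (β * β) 1 (by
      rw [show β * β - 1 = (1 + β) * (β - 1) by ring]; exact hβ.mul_right _), zpow_one]
  have hy : Commute e₁ (rconj b (a ^ 2)) := by
    have := (hx.map (rconj b))
    rwa [hb2] at this
  have he2y : Commute e₂ (rconj b (a ^ 2)) := (Commute.refl _).pow_left q
  have hK1 : ∀ g ∈ K, Commute e₁ g := fun g hg => T.commute_of_commute_x_y he1x hy hg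
  have hK2 : ∀ g ∈ K, Commute e₂ g := fun g hg => T.commute_of_commute_x_y hx he2y hg
  refine ⟨hK1, hK2, ?_⟩
  have h3 : e₃ = e₁ ^ α * e₂⁻¹ := by
    rw [hαβ, he2 β (-1) (by rw [sub_neg_eq_add, add_comm]; exact hβ), zpow_neg_one]
  -- Now `e₁` is central in `K`, so it is fixed by `(a * b) ^ 3`; comparing exponents of `e₁` gives
  -- `α = -1` modulo `p`.
  have h4 : rconj ((a * b) ^ 3) e₁ = e₂ ^ (α * α - 1) * e₁ ^ (-α) := by
    rw [hab1, h3]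
    simp only [map_mul, map_zpow, map_inv, hb1, hb2, ha1, he₃.symm]
    rw [h3]
    simp only [map_mul, map_zpow, map_inv, hb1, hb2]
    rw [((hcomm.symm.zpow_left α).inv_right).mul_zpow, ← zpow_mul, inv_zpow', mul_assoc,
      ((hcomm.zpow_left (-α)).inv_right).eq, ← mul_assoc, ← zpow_sub_one]
  rw [(rconj_eq_self_iff _ _).2 (hK1 _ T.cube_mem)] at h4
  have h5 := (hdvd (α + 1) (-(α * α - 1)) (by
    have h6 : e₁ ^ (α + 1) = e₂ ^ (α * α - 1) := by
      rw [add_comm, zpow_one_add]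
      nth_rewrite 1 [h4]
      group
    rw [h6, zpow_neg, mul_inv_cancel])).1
  rw [h3, he1 α (-1) (by rwa [sub_neg_eq_add]), zpow_neg_one]

end TripartitePair

/-! ### Induction on `n`: the part of `K` prime to three. -/

theorem map_rconj {G G' : Type*} [Group G] [Group G'] (f : G →* G') (g u : G) :
    f (rconj g u) = rconj (f g) (f u) := by
  simp [rconj_apply]

theorem Commute.zpow_mul_zpow_mul {G : Type*} [Group G] {u v : G} (h : Commute u v)
    (i j i' j' : ℤ) : u ^ i * v ^ j * (u ^ i' * v ^ j') = u ^ (i + i') * v ^ (j + j') := by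
  rw [zpow_add, zpow_add, mul_assoc, ← mul_assoc (v ^ j), (h.zpow_zpow i' j).symm.eq]
  simp only [mul_assoc]

/-- The subgroup generated by two commuting elements. -/
def Commute.span {G : Type*} [Group G] {u v : G} (h : Commute u v) : Subgroup G where
  carrier := {g | ∃ i j : ℤ, g = u ^ i * v ^ j}
  one_mem' := ⟨0, 0, by simp⟩
  mul_mem' := by
    rintro _ _ ⟨i, j, rfl⟩ ⟨i', j', rfl⟩
    exact ⟨i + i', j + j', h.zpow_mul_zpow_mul i j i' j'⟩
  inv_mem' := by
    rintro _ ⟨i, j, rfl⟩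
    refine ⟨-i, -j, ?_⟩
    rw [mul_inv_rev, ← zpow_neg, ← zpow_neg, (h.zpow_zpow _ _).symm.eq]

theorem Commute.mem_span {G : Type*} [Group G] {u v : G} (h : Commute u v) {g : G} :
    g ∈ h.span ↔ ∃ i j : ℤ, g = u ^ i * v ^ j := Iff.rfl

/-- A finite subgroup mapped into itself by conjugation with generators is normal. -/
theorem normal_of_rconj_mem {G : Type*} [Group G] {S : Set G} (hS : Subgroup.closure S = ⊤)
    (H : Subgroup G) [Finite H] (h : ∀ s ∈ S, ∀ g ∈ H, rconj s g ∈ H) : H.Normal := by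
  rw [← Subgroup.normalizer_eq_top_iff, eq_top_iff, ← hS, Subgroup.closure_le]
  intro s hs
  have hsurj : ∀ g ∈ H, ∃ g' ∈ H, rconj s g' = g := by
    let f : H → H := fun g => ⟨rconj s g, h s hs g g.2⟩
    have hf : Function.Injective f := fun g g' hg =>
      Subtype.ext (rconj_injective s (congrArg Subtype.val hg))
    intro g hg
    obtain ⟨g', hg'⟩ := Finite.surjective_of_injective hf ⟨g, hg⟩
    exact ⟨g', g'.2, congrArg Subtype.val hg'⟩
  rw [SetLike.mem_coe, Subgroup.mem_normalizer_iff]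
  intro g
  constructor
  · intro hg
    obtain ⟨g', hg', rfl⟩ := hsurj g hg
    have : s * rconj s g' * s⁻¹ = g' := by rw [rconj_apply]; group
    rwa [this]
  · intro hg
    have := h s hs _ hg
    have e : rconj s (s * g * s⁻¹) = g := by rw [rconj_apply]; group
    rwa [e] at this

namespace TripartitePair

variable {G : Type*} [Group G] {a b : G} {K : Subgroup G} {n : ℕ}

/-- Supports the inductions on `n`: dividing by the group of all `x ^ (q * i) * y ^ (q * j)` leaves
factors of order `q`, still independent. -/
theorem map (T : TripartitePair a b K n) {G' : Type*} [Group G'] {p q : ℕ} (hq : n = p * q)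
    (f : G →* G') (hf : Function.Surjective f)
    (hker : ∀ g, f g = 1 ↔ ∃ i j : ℤ, g = ((a ^ 2) ^ q) ^ i * (rconj b (a ^ 2) ^ q) ^ j) :
    TripartitePair (f a) (f b) (K.map f) q where
  closure_eq := by
    have := congrArg (Subgroup.map f) T.closure_eq
    rw [MonoidHom.map_closure, Subgroup.map_top_of_surjective f hf, Set.image_pair] at this
    exact this
  b_mul_b := by rw [← map_mul, T.b_mul_b, map_one]
  normal := T.normal.map f hf
  mem_iff := by
    intro g
    rw [Subgroup.mem_map]
    constructor
    · rintro ⟨g, hg, rfl⟩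
      obtain ⟨i, j, rfl⟩ := (T.mem_iff g).1 hg
      exact ⟨i, j, by simp only [map_mul, map_zpow, map_rconj, map_pow]⟩
    · rintro ⟨i, j, rfl⟩
      exact ⟨_, (T.mem_iff _).2 ⟨i, j, rfl⟩, by simp only [map_mul, map_zpow, map_rconj, map_pow]⟩
  pow_eq_one := by
    rw [← map_pow, ← map_pow, hker]
    exact ⟨1, 0, by simp⟩
  dvd_of_eq_one := by
    intro i j h
    rw [← map_pow, ← map_rconj, ← map_zpow, ← map_zpow, ← map_mul, hker] at h
    obtain ⟨i', j', h⟩ := h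
    rw [← zpow_natCast _ q, ← zpow_mul, ← zpow_natCast _ q, ← zpow_mul] at h
    have hqn : (q : ℤ) ∣ n := ⟨p, by rw [hq]; push_cast; ring⟩
    obtain ⟨h1, h2⟩ := T.dvd_sub_of_eq h
    exact ⟨(dvd_sub_left (dvd_mul_right _ _)).1 (hqn.trans h1),
      (dvd_sub_left (dvd_mul_right _ _)).1 (hqn.trans h2)⟩
  cube_mem := by
    rw [← map_mul, ← map_pow]
    exact Subgroup.mem_map_of_mem f T.cube_mem
  pos := Nat.pos_of_ne_zero (by rintro rfl; have := T.pos; lia)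

/-- If `(a ^ 2) ^ q` and its `b`-conjugate commute and the group they generate is stable under
conjugation by `a`, then this group is normal. -/
theorem normal_span (T : TripartitePair a b K n) {q : ℕ}
    (hc : Commute ((a ^ 2) ^ q) (rconj b (a ^ 2) ^ q))
    (ha : rconj a (rconj b (a ^ 2) ^ q) ∈ hc.span) : hc.span.Normal := by
  have hfin : Finite hc.span := by
    have := T.finite
    have hle : hc.span ≤ K := by
      rintro _ ⟨i, j, rfl⟩
      exact mul_mem (zpow_mem (pow_mem T.x_mem _) _) (zpow_mem (pow_mem T.y_mem _) _)
    exact Finite.of_injective _ (Subgroup.inclusion_injective hle)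
  refine normal_of_rconj_mem T.closure_eq _ ?_
  rintro s (rfl | rfl) g ⟨i, j, rfl⟩
  · have e : rconj s ((s ^ 2) ^ q) = (s ^ 2) ^ q := by rw [map_pow, rconj_a_x]
    rw [map_mul, map_zpow, map_zpow, e]
    exact mul_mem ⟨i, 0, by simp⟩ (zpow_mem ha j)
  · have e : rconj s (((a ^ 2) ^ q) ^ i * (rconj s (a ^ 2) ^ q) ^ j) =
        (rconj s (a ^ 2) ^ q) ^ i * ((a ^ 2) ^ q) ^ j := by
      simp only [map_mul, map_zpow, map_pow, T.rconj_b_rconj_b]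
    rw [e]
    exact ⟨j, i, (hc.zpow_zpow j i).symm.eq⟩

end TripartitePair

/-- Collecting `(u * v) ^ 3` in class two costs three copies of the commutator `z`, and these cancel
because `z ^ 3 = 1`. -/
theorem mul_pow_three_of_commutator {G : Type*} [Group G] {u v z : G} (h : v * u = u * v * z)
    (hu : Commute z u) (hv : Commute z v) (hz : z ^ 3 = 1) : (u * v) ^ 3 = u ^ 3 * v ^ 3 := by
  calc (u * v) ^ 3 = u * (v * u) * (v * u) * v := by
        simp only [pow_succ, pow_zero, one_mul, mul_assoc]
    _ = u * u * v * u * v * v * (z * z) := by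
        rw [h]; simp only [mul_assoc, hu.left_comm, hv.eq, hv.left_comm]
    _ = u * u * (v * u) * v * v * (z * z) := by simp only [mul_assoc]
    _ = u * u * u * v * v * v * (z * z * z) := by
        rw [h]; simp only [mul_assoc, hv.eq]
    _ = _ := by
      rw [← pow_two z, ← pow_succ, hz]; simp only [pow_succ, pow_zero, one_mul, mul_assoc, mul_one]

theorem rconj_pow_eq_of_central {G : Type*} [Group G] {u v z : G} (h : rconj u v = v * z)
    (hz : Commute z u) (r : ℕ) : rconj (u ^ r) v = v * z ^ r := by
  have := conj_pow_eq_of_unipotent (u := v) (v := z) (g := u) (c := 1)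
    (by rwa [zpow_one, ← rconj_apply]) hz r
  rw [rconj_apply, this, one_mul, zpow_natCast]

namespace TripartitePair

/-- Inductive step for the commutation relations of `x = a ^ 2` and its conjugate, for the prime
three. -/
theorem relations_of_cube_mod {G : Type*} [Group G] {a b : G} {K : Subgroup G} {n : ℕ}
    (T : TripartitePair a b K n) {m : ℕ} {E : Subgroup G} (hEc : ∀ ε ∈ E, ∀ g ∈ K, Commute ε g)
    (hE3 : ∀ ε ∈ E, ε ^ 3 = 1)
    (h1 : ((a ^ 2) ^ m * rconj b (a ^ 2) ^ m)⁻¹ * (rconj b (a ^ 2) ^ m * (a ^ 2) ^ m) ∈ E)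
    (h2 : (((a ^ 2) ^ m)⁻¹ * (rconj b (a ^ 2) ^ m)⁻¹)⁻¹ * rconj a (rconj b (a ^ 2) ^ m) ∈ E) :
    Commute ((a ^ 2) ^ (m * 3)) (rconj b (a ^ 2) ^ (m * 3)) ∧
      rconj a (rconj b (a ^ 2) ^ (m * 3)) =
        ((a ^ 2) ^ (m * 3))⁻¹ * (rconj b (a ^ 2) ^ (m * 3))⁻¹ := by
  have hX : (a ^ 2) ^ m ∈ K := pow_mem T.x_mem m
  have hY : rconj b (a ^ 2) ^ m ∈ K := pow_mem T.y_mem m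
  rw [pow_mul, pow_mul]
  set X := (a ^ 2) ^ m
  set Y := rconj b (a ^ 2) ^ m
  set z := (X * Y)⁻¹ * (Y * X) with hz
  have hz3 := hE3 _ h1
  have hzX := hEc _ h1 _ hX
  have hzY := hEc _ h1 _ hY
  have hYX : Y * X = X * Y * z := by rw [hz, mul_inv_cancel_left]
  have hconj : rconj X Y = Y * z := by
    rw [rconj_apply, mul_assoc, hYX]; group
  -- Conjugation by `X` multiplies `Y` by the central element `z`; three applications multiply it by
  -- `z ^ 3 = 1`.
  have hcomm : Commute (X ^ 3) Y := by
    have := rconj_pow_eq_of_central hconj hzX 3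
    rw [hz3, mul_one, rconj_eq_self_iff] at this
    exact this.symm
  refine ⟨hcomm.pow_right 3, ?_⟩
  set ε := (X⁻¹ * Y⁻¹)⁻¹ * rconj a Y with hε
  have hεm : ε ∈ E := h2
  have e1 : rconj a Y = X⁻¹ * Y⁻¹ * ε := by rw [hε, mul_inv_cancel_left]
  -- Here `X⁻¹ * Y⁻¹` is the inverse of `Y * X`, and cubing is multiplicative on `X` and `Y`.
  have e2 : (X⁻¹ * Y⁻¹) ^ 3 = (X ^ 3)⁻¹ * (Y ^ 3)⁻¹ := by
    have := mul_pow_three_of_commutator hYX hzX hzY hz3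
    have h4 : (Y * X) ^ 3 = X ^ 3 * Y ^ 3 := by
      have h5 : Commute (X * Y) z := (hzX.mul_right hzY).symm
      rw [hYX, h5.mul_pow, hz3, mul_one, this]
    rw [← mul_inv_rev, inv_pow, h4, (hcomm.pow_right 3).eq, mul_inv_rev]
  have e3 : Commute (X⁻¹ * Y⁻¹) ε :=
    (((hEc _ hεm _ hX).inv_right).mul_right ((hEc _ hεm _ hY).inv_right)).symm
  rw [map_pow, e1, e3.mul_pow, hE3 _ hεm, mul_one, e2]

/-- Inductive step for the commutation relations of `x = a ^ 2` and its conjugate, for a prime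
other than three. -/
theorem relations_of_mod {G : Type*} [Group G] {a b : G} {K : Subgroup G} {n : ℕ}
    (T : TripartitePair a b K n) {p e k : ℕ} (hp : p.Prime) (hp3 : p ≠ 3)
    (hn : n = p * (3 ^ e * k))
    (hE1 : ∀ g ∈ K, Commute ((a ^ 2) ^ (3 ^ e * k)) g)
    (hE2 : ∀ g ∈ K, Commute (rconj b (a ^ 2) ^ (3 ^ e * k)) g)
    (hE3 : rconj a (rconj b (a ^ 2) ^ (3 ^ e * k)) =
      ((a ^ 2) ^ (3 ^ e * k))⁻¹ * (rconj b (a ^ 2) ^ (3 ^ e * k))⁻¹)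
    (h1 : ∃ i j : ℤ, ((a ^ 2) ^ 3 ^ e)⁻¹ * (rconj b (a ^ 2) ^ 3 ^ e)⁻¹ * (a ^ 2) ^ 3 ^ e *
      rconj b (a ^ 2) ^ 3 ^ e =
        ((a ^ 2) ^ (3 ^ e * k)) ^ i * (rconj b (a ^ 2) ^ (3 ^ e * k)) ^ j)
    (h2 : ∃ i j : ℤ, (((a ^ 2) ^ 3 ^ e)⁻¹ * (rconj b (a ^ 2) ^ 3 ^ e)⁻¹)⁻¹ *
      rconj a (rconj b (a ^ 2) ^ 3 ^ e) =
        ((a ^ 2) ^ (3 ^ e * k)) ^ i * (rconj b (a ^ 2) ^ (3 ^ e * k)) ^ j) :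
    Commute ((a ^ 2) ^ 3 ^ e) (rconj b (a ^ 2) ^ 3 ^ e) ∧
      rconj a (rconj b (a ^ 2) ^ 3 ^ e) =
        ((a ^ 2) ^ 3 ^ e)⁻¹ * (rconj b (a ^ 2) ^ 3 ^ e)⁻¹ := by
  have hp' : Prime (p : ℤ) := Nat.prime_iff_prime_int.1 hp
  have hp3' : ¬ (p : ℤ) ∣ 3 := by
    intro h
    exact hp3 ((Nat.prime_dvd_prime_iff_eq hp Nat.prime_three).1 (by exact_mod_cast h))
  have hdvd : ∀ i j : ℤ, ((a ^ 2) ^ (3 ^ e * k)) ^ i * (rconj b (a ^ 2) ^ (3 ^ e * k)) ^ j = 1 →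
    (p : ℤ) ∣ i ∧ (p : ℤ) ∣ j := fun i j h => T.dvd_of_x_pow_zpow hn h
  have he1 : ∀ i : ℤ, (p : ℤ) ∣ i → ((a ^ 2) ^ (3 ^ e * k)) ^ i = 1 :=
    fun i h => by rw [T.x_pow_zpow_eq (j := 0) hn (by rwa [sub_zero]), zpow_zero]
  have he2 : ∀ i : ℤ, (p : ℤ) ∣ i → (rconj b (a ^ 2) ^ (3 ^ e * k)) ^ i = 1 :=
    fun i h => by rw [T.y_pow_zpow_eq (j := 0) hn (by rwa [sub_zero]), zpow_zero]
  have hXk : (a ^ 2) ^ (3 ^ e * k) = ((a ^ 2) ^ 3 ^ e) ^ k := pow_mul _ _ _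
  have hXz : ∀ i : ℤ, ((a ^ 2) ^ 3 ^ e) ^ i = (a ^ 2) ^ ((3 ^ e : ℕ) * i : ℤ) := fun i => by
    rw [zpow_mul, zpow_natCast]
  have hYz : ∀ i : ℤ, (rconj b (a ^ 2) ^ 3 ^ e) ^ i = rconj b (a ^ 2) ^ ((3 ^ e : ℕ) * i : ℤ) :=
    fun i => by rw [zpow_mul, zpow_natCast]
  have hm1 : (a ^ 2) ^ (3 ^ e * k) ∈ K := pow_mem T.x_mem _
  have hm2 : rconj b (a ^ 2) ^ (3 ^ e * k) ∈ K := pow_mem T.y_mem _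
  have hb1 : rconj b ((a ^ 2) ^ (3 ^ e * k)) = rconj b (a ^ 2) ^ (3 ^ e * k) := map_pow _ _ _
  have ha1 : rconj a ((a ^ 2) ^ (3 ^ e * k)) = (a ^ 2) ^ (3 ^ e * k) := by
    rw [map_pow, rconj_a_x]
  have hmX : (a ^ 2) ^ 3 ^ e ∈ K := pow_mem T.x_mem _
  have hmY : rconj b (a ^ 2) ^ 3 ^ e ∈ K := pow_mem T.y_mem _
  have hbX : rconj b ((a ^ 2) ^ 3 ^ e) = rconj b (a ^ 2) ^ 3 ^ e := map_pow _ _ _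
  have haX : rconj a ((a ^ 2) ^ 3 ^ e) = (a ^ 2) ^ 3 ^ e := by rw [map_pow, rconj_a_x]
  have hpa : Commute ((a ^ 2) ^ 3 ^ e) (a ^ 2) := (Commute.refl _).pow_left _
  have hXdvd : ∀ i j : ℤ, ((a ^ 2) ^ 3 ^ e) ^ i * (rconj b (a ^ 2) ^ 3 ^ e) ^ j = 1 →
      ((a ^ 2) ^ 3 ^ e) ^ i = 1 := by
    intro i j h
    rw [hXz, hYz] at h
    rw [hXz, T.x_zpow_eq_one_iff]
    exact (T.dvd_of_eq_one _ _ h).1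
  have hcentral : ∀ i j : ℤ, ∀ g ∈ K,
      Commute (((a ^ 2) ^ (3 ^ e * k)) ^ i * (rconj b (a ^ 2) ^ (3 ^ e * k)) ^ j) g :=
    fun i j g hg => ((hE1 g hg).zpow_left i).mul_left ((hE2 g hg).zpow_left j)
  have hcomm := hE1 _ hm2
  set e₁ := (a ^ 2) ^ (3 ^ e * k)
  set e₂ := rconj b (a ^ 2) ^ (3 ^ e * k)
  set X := (a ^ 2) ^ 3 ^ e with hX
  set Y := rconj b (a ^ 2) ^ 3 ^ e with hY
  have hb2 : rconj b e₂ = e₁ := by rw [← hb1, T.rconj_b_rconj_b]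
  have hbY : rconj b Y = X := by rw [← hbX, T.rconj_b_rconj_b]
  obtain ⟨i, j, hij⟩ := h1
  obtain ⟨i', j', hij'⟩ := h2
  have haY : rconj a Y = X⁻¹ * Y⁻¹ * (e₁ ^ i' * e₂ ^ j') := by rw [← hij', mul_inv_cancel_left]
  have hc := hcentral i j
  have hc' := hcentral i' j'
  -- `X` and `Y` commute
  have hXY : Commute X Y := by
    -- Exchanging `X` and `Y` inverts their commutator, so `b` inverts `e₁ ^ i * e₂ ^ j`. Below `a`
    -- is seen to invert it too, since `Y` goes to `X⁻¹ * Y⁻¹` up to a central factor. The two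
    -- conditions combine to `3 * i = 0` modulo `p`, and `p ≠ 3`.
    have hbε : e₂ ^ i * e₁ ^ j * (e₁ ^ i * e₂ ^ j) = 1 := by
      have h3 := congrArg (rconj b) hij
      simp only [map_mul, map_inv, map_zpow, hbX, hbY, hb1, hb2] at h3
      rw [← h3, ← hij]; group
    have hji : (p : ℤ) ∣ i + j := by
      rw [(hcomm.zpow_zpow j i).symm.eq, hcomm.zpow_mul_zpow_mul] at hbε
      exact (hdvd _ _ hbε).2
    have haε : rconj a (e₁ ^ i * e₂ ^ j) * (e₁ ^ i * e₂ ^ j) = 1 := by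
      have h3 := congrArg (rconj a) hij
      simp only [map_mul, map_inv, haX, haY] at h3
      rw [map_mul (rconj a), ← h3]
      have h4 := (hc' X hmX).eq
      calc _ = X⁻¹ * (e₁ ^ i' * e₂ ^ j')⁻¹ * Y * X * X * X⁻¹ * Y⁻¹ * (e₁ ^ i' * e₂ ^ j') *
            (e₁ ^ i * e₂ ^ j) := by group
        _ = (X⁻¹ * (e₁ ^ i' * e₂ ^ j')⁻¹ * (Y * X * Y⁻¹ * (e₁ ^ i' * e₂ ^ j'))) *
            (e₁ ^ i * e₂ ^ j) := by group
        _ = (X⁻¹ * (Y * X * Y⁻¹)) * (e₁ ^ i * e₂ ^ j) := by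
          have h5 := hc' (Y * X * Y⁻¹) (mul_mem (mul_mem hmY hmX) (inv_mem hmY))
          rw [← h5.eq]; group
        _ = (X⁻¹ * Y * X) * ((e₁ ^ i * e₂ ^ j) * Y⁻¹) := by
          rw [(hc _ (inv_mem hmY)).eq]; group
        _ = 1 := by rw [← hij]; group
    rw [map_mul, map_zpow, map_zpow, ha1, hE3, (hcomm.inv_inv).mul_zpow, inv_zpow', inv_zpow',
      ← mul_assoc (e₁ ^ i) (e₁ ^ (-j)), ← zpow_add, hcomm.zpow_mul_zpow_mul] at haε
    have h5 := (hdvd _ _ haε).1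
    have h6 : (p : ℤ) ∣ 3 * i := by
      have := dvd_add h5 hji
      rwa [show i + -j + i + (i + j) = 3 * i by ring] at this
    have h7 : (p : ℤ) ∣ i := (hp'.dvd_mul.1 h6).resolve_left hp3'
    have h8 : (p : ℤ) ∣ j := (dvd_add_right h7).1 hji
    rw [he1 i h7, he2 j h8, one_mul] at hij
    rw [commute_iff_eq]
    calc X * Y = Y * X * (X⁻¹ * Y⁻¹ * X * Y) := by group
      _ = _ := by rw [hij, mul_one]
  refine ⟨hXY, ?_⟩
  -- Without the correction `e₁ ^ i' * e₂ ^ j'`, applying `a` twice would fix `Y`; the remaining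
  -- central factor measures the correction.
  have haa : rconj (a ^ 2) Y = Y * ((e₁ ^ i' * e₂ ^ j')⁻¹ * rconj a (e₁ ^ i' * e₂ ^ j')) := by
    rw [pow_two, rconj_mul, haY, map_mul, map_mul, map_inv, map_inv, haX, haY]
    have h5 := (hc' (X⁻¹ * Y⁻¹) (mul_mem (inv_mem hmX) (inv_mem hmY))).eq
    rw [← h5, hXY.inv_inv.eq]
    group
  have hη : rconj a (e₁ ^ i' * e₂ ^ j') = e₁ ^ (i' - j') * e₂ ^ (-j') := by
    rw [map_mul, map_zpow, map_zpow, ha1, hE3, (hcomm.inv_inv).mul_zpow, inv_zpow', inv_zpow',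
      ← mul_assoc, ← zpow_add, ← sub_eq_add_neg]
  have hη2 : (e₁ ^ i' * e₂ ^ j')⁻¹ * rconj a (e₁ ^ i' * e₂ ^ j') =
      e₁ ^ (-j') * e₂ ^ (-(2 * j')) := by
    rw [hη, mul_inv_rev, ← zpow_neg, ← zpow_neg, (hcomm.zpow_zpow _ _).symm.eq, mul_assoc,
      ← mul_assoc (e₂ ^ (-j')), (hcomm.zpow_zpow _ _).symm.eq, mul_assoc, ← zpow_add, ← mul_assoc,
      ← zpow_add]
    congr 2 <;> ring
  rw [hη2] at haa
  -- The power `3 ^ e` of `a ^ 2` is `X`, which fixes `Y`. So `3 ^ e * j'` vanishes modulo `p`, and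
  -- `p ≠ 3`.
  have hj' : (p : ℤ) ∣ j' := by
    have h3 := rconj_pow_eq_of_central haa (hcentral _ _ _ T.x_mem) (3 ^ e)
    rw [← hX, (rconj_eq_self_iff _ _).2 hXY.symm, left_eq_mul, (hcomm.zpow_zpow _ _).mul_pow,
      ← zpow_natCast, ← zpow_natCast, ← zpow_mul, ← zpow_mul] at h3
    have h4 := (hdvd _ _ h3).1
    rcases hp'.dvd_mul.1 h4 with h5 | h5
    · rwa [dvd_neg] at h5
    · push_cast at h5
      exact absurd (hp'.dvd_of_dvd_pow h5) hp3'
  rw [he1 _ (by rwa [dvd_neg]), he2 _ (by rw [dvd_neg]; exact hj'.mul_left 2), one_mul, mul_one,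
    rconj_eq_self_iff] at haa
  have hYx := haa
  have hXy : Commute X (rconj b (a ^ 2)) := by
    have := hYx.map (rconj b)
    rwa [hbY] at this
  have hXc := T.commute_of_commute_x_y hpa hXy T.cube_mem
  rw [he2 j' hj', mul_one] at haY
  have h3 : e₁ ^ i' = X ^ (k * i') := by rw [hXk, zpow_mul, zpow_natCast]
  have h4 : rconj a Y = X ^ (k * i' - 1) * Y⁻¹ := by
    rw [haY, h3, mul_assoc, ((hXY.zpow_left (k * i')).symm.inv_left).eq, ← mul_assoc,
      sub_eq_neg_add, zpow_add, zpow_neg_one]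
  rw [h3] at haY
  set r := k * i' - 1 with hr
  -- With `j'` gone, `X` is central in `K` and fixed by `(a * b) ^ 3`. Comparing the powers of `X`
  -- yields `X ^ (r + 1) = 1`, which is exactly the triviality of the remaining correction `e₁ ^
  -- i'`.
  have h5 : rconj ((a * b) ^ 3) X = Y ^ (r * r - 1) * X ^ (-r) := by
    rw [show (a * b) ^ 3 = a * b * (a * b) * (a * b) by rw [pow_succ, pow_two]]
    simp only [rconj_mul, haX, hbX, h4, map_mul, map_zpow, map_inv, hbY]
    rw [((hXY.symm.zpow_left r).inv_right).mul_zpow, ← zpow_mul, inv_zpow', mul_assoc,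
      ((hXY.zpow_left (-r)).inv_right).eq, ← mul_assoc, ← zpow_sub_one]
  rw [(rconj_eq_self_iff _ _).2 hXc] at h5
  have h6 : X ^ (r + 1) * Y ^ (-(r * r - 1)) = 1 := by
    have h7 : X ^ (r + 1) = Y ^ (r * r - 1) := by
      rw [add_comm, zpow_one_add]
      nth_rewrite 1 [h5]
      group
    rw [h7, zpow_neg, mul_inv_cancel]
  have h7 := hXdvd _ _ h6
  rw [hr, sub_add_cancel] at h7
  rw [haY, h7, mul_one]

end TripartitePair

namespace TripartitePair

theorem map_x_pow {G G' : Type*} [Group G] [Group G'] (f : G →* G') (a : G) (m : ℕ) :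
    f ((a ^ 2) ^ m) = (f a ^ 2) ^ m := by rw [map_pow, map_pow]

theorem map_y_pow {G G' : Type*} [Group G] [Group G'] (f : G →* G') (a b : G) (m : ℕ) :
    f (rconj b (a ^ 2) ^ m) = rconj (f b) (f a ^ 2) ^ m := by rw [map_pow, map_rconj, map_pow]

/-- The kernel of the quotient by the elementary abelian group of a normalised prime. -/
theorem exists_quotient {G : Type*} [Group G] {a b : G} {K : Subgroup G} {n : ℕ}
    (T : TripartitePair a b K n) (hn : 1 < n) :
    ∃ (p q : ℕ) (E : Subgroup G) (_ : E.Normal), p.Prime ∧ n = p * q ∧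
      (∀ g, g ∈ E ↔ ∃ i j : ℤ, g = ((a ^ 2) ^ q) ^ i * (rconj b (a ^ 2) ^ q) ^ j) ∧
      (∀ g ∈ K, Commute ((a ^ 2) ^ q) g) ∧ (∀ g ∈ K, Commute (rconj b (a ^ 2) ^ q) g) ∧
      rconj a (rconj b (a ^ 2) ^ q) = ((a ^ 2) ^ q)⁻¹ * (rconj b (a ^ 2) ^ q)⁻¹ ∧
      (∀ ε ∈ E, ε ^ p = 1) ∧
      TripartitePair (QuotientGroup.mk' E a) (QuotientGroup.mk' E b)
        (K.map (QuotientGroup.mk' E)) q := by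
  obtain ⟨p, q, hp, hq, hnorm⟩ := T.exists_prime_normalized hn
  obtain ⟨h1, h2, h3⟩ := T.central_of_normalized hp hq hnorm
  have hc : Commute ((a ^ 2) ^ q) (rconj b (a ^ 2) ^ q) := h1 _ (pow_mem T.y_mem q)
  have hE : hc.span.Normal := T.normal_span hc (by
    rw [h3]
    exact ⟨-1, -1, by rw [zpow_neg_one, zpow_neg_one]⟩)
  refine ⟨p, q, hc.span, hE, hp, hq, fun g => Iff.rfl, h1, h2, h3, ?_, ?_⟩
  · rintro _ ⟨i, j, rfl⟩
    rw [(hc.zpow_zpow i j).mul_pow, ← zpow_natCast _ p, ← zpow_natCast _ p, ← zpow_mul, ← zpow_mul,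
      T.x_pow_zpow_eq (j := 0) hq (by rw [sub_zero]; exact dvd_mul_left _ _),
      T.y_pow_zpow_eq (j := 0) hq (by rw [sub_zero]; exact dvd_mul_left _ _)]
    simp
  · refine T.map hq _ (QuotientGroup.mk'_surjective _) fun g => ?_
    rw [QuotientGroup.mk'_apply, QuotientGroup.eq_one_iff]
    exact Iff.rfl

/-- The `3`-free part of `K` is abelian and `a`, `b` act on it as on the standard representation of
the symmetric group of degree three. -/
theorem relations {G : Type*} [Group G] {a b : G} {K : Subgroup G} {n e k : ℕ}
    (T : TripartitePair a b K n) (hn : n = 3 ^ e * k) (hk : ¬ 3 ∣ k) :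
    Commute ((a ^ 2) ^ 3 ^ e) (rconj b (a ^ 2) ^ 3 ^ e) ∧
      rconj a (rconj b (a ^ 2) ^ 3 ^ e) =
        ((a ^ 2) ^ 3 ^ e)⁻¹ * (rconj b (a ^ 2) ^ 3 ^ e)⁻¹ := by
  -- Dividing by the elementary abelian group of order `p ^ 2` lowers `e` if `p = 3` and removes a
  -- factor `p` from `k` otherwise.
  induction n using Nat.strong_induction_on generalizing G a b K e k with
  | _ n ih =>
  by_cases hn1 : n ≤ 1
  · have hx : a ^ 2 = 1 := by
      have h1 := T.pow_eq_one
      have h2 : n = 1 := le_antisymm hn1 T.pos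
      rwa [h2, pow_one] at h1
    simp [hx]
  rw [not_le] at hn1
  obtain ⟨p, q, E, hE, hp, hq, hmem, h1, h2, h3, hEp, T'⟩ := T.exists_quotient hn1
  have hqn : q < n := by
    rw [hq]
    have : 0 < q := T'.pos
    nlinarith [hp.two_le]
  by_cases hp3 : p = 3
  · subst hp3
    obtain ⟨e', rfl⟩ : ∃ e', e = e' + 1 := by
      rcases e with _ | e'
      · rw [pow_zero, one_mul] at hn
        exact absurd ⟨q, by rw [← hn, hq]⟩ hk
      · exact ⟨e', rfl⟩
    have hqe : q = 3 ^ e' * k := by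
      have : 3 * q = 3 * (3 ^ e' * k) := by rw [← hq, hn]; ring
      lia
    obtain ⟨h4, h5⟩ := ih q hqn T' hqe hk
    rw [pow_succ 3]
    refine T.relations_of_cube_mod (E := E) ?_ hEp ?_ ?_
    · intro ε hε g hg
      obtain ⟨i, j, rfl⟩ := (hmem ε).1 hε
      exact ((h1 g hg).zpow_left i).mul_left ((h2 g hg).zpow_left j)
    · rw [← QuotientGroup.eq_one_iff]
      change QuotientGroup.mk' E _ = 1
      simp only [map_mul, map_inv, map_x_pow, map_y_pow]
      rw [inv_mul_eq_one]
      exact h4.eq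
    · rw [← QuotientGroup.eq_one_iff]
      change QuotientGroup.mk' E _ = 1
      simp only [map_mul, map_inv, map_x_pow (QuotientGroup.mk' E), map_y_pow (QuotientGroup.mk' E),
        map_rconj (QuotientGroup.mk' E) a]
      rw [h5, inv_mul_cancel]
  · obtain ⟨k', rfl⟩ : p ∣ k := by
      have h6 : p ∣ 3 ^ e * k := ⟨q, by rw [← hn, hq]⟩
      refine Nat.Coprime.dvd_of_dvd_mul_left (Nat.Coprime.pow_right e ?_) h6
      exact (Nat.coprime_primes hp Nat.prime_three).2 hp3
    have hqe : q = 3 ^ e * k' := by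
      have : p * q = p * (3 ^ e * k') := by rw [← hq, hn]; ring
      exact Nat.eq_of_mul_eq_mul_left hp.pos this
    obtain ⟨h4, h5⟩ := ih q hqn T' hqe (fun h => hk (h.mul_left p))
    subst hqe
    refine T.relations_of_mod hp hp3 hq h1 h2 h3 ?_ ?_
    · rw [← hmem, ← QuotientGroup.eq_one_iff]
      change QuotientGroup.mk' E _ = 1
      simp only [map_mul, map_inv, map_x_pow, map_y_pow]
      rw [mul_assoc, ← mul_inv_rev, inv_mul_eq_one]
      exact h4.symm.eq
    · rw [← hmem, ← QuotientGroup.eq_one_iff]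
      change QuotientGroup.mk' E _ = 1
      simp only [map_mul, map_inv, map_x_pow (QuotientGroup.mk' E), map_y_pow (QuotientGroup.mk' E),
        map_rconj (QuotientGroup.mk' E) a]
      rw [h5, inv_mul_cancel]

section Hall

variable {G : Type*} [Group G] {a b : G} {K : Subgroup G} {n e k : ℕ}
  (T : TripartitePair a b K n) (hn : n = 3 ^ e * k) (hk : ¬ 3 ∣ k)
include T hn hk

/-- The map fixing `X` and sending `Y` to `X⁻¹ * Y⁻¹` is an involution, so `a ^ 2` centralises `Y`.
Conjugating by `b` shows that `X` commutes with both generators of `K`. -/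
theorem commute_x_pow {g : G} (hg : g ∈ K) : Commute ((a ^ 2) ^ 3 ^ e) g := by
  obtain ⟨h1, h2⟩ := T.relations hn hk
  have hX : rconj a ((a ^ 2) ^ 3 ^ e) = (a ^ 2) ^ 3 ^ e := by rw [map_pow, rconj_a_x]
  have h3 : Commute (rconj b (a ^ 2) ^ 3 ^ e) (a ^ 2) := by
    rw [← rconj_eq_self_iff, pow_two, rconj_mul, ← pow_two, h2, map_mul, map_inv, map_inv, h2, hX,
      mul_inv_rev, inv_inv, inv_inv, ← h1.eq, inv_mul_cancel_left]
  have h4 := h3.map (rconj b)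
  rw [map_pow, T.rconj_b_rconj_b] at h4
  exact T.commute_of_commute_x_y ((Commute.refl _).pow_left _) h4 hg

theorem commute_y_pow {g : G} (hg : g ∈ K) : Commute (rconj b (a ^ 2) ^ 3 ^ e) g := by
  have h := (T.commute_x_pow hn hk (T.rconj_mem hg b)).map (rconj b)
  rwa [map_pow, T.rconj_b_rconj_b] at h

end Hall

end TripartitePair

/-! ### Divisibility by powers of three. -/

section Arithmetic

/-- Each cubing gains a factor three: `z ^ 3 + 1` is `z + 1` times `(z + 1) * (z - 2) + 3`. -/
theorem three_pow_succ_dvd_pow_add_one {q : ℤ} (hq : (3 : ℤ) ∣ q + 1) (e : ℕ) :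
    (3 : ℤ) ^ (e + 1) ∣ q ^ 3 ^ e + 1 := by
  induction e with
  | zero => simpa using hq
  | succ e ih =>
    have h1 : q ^ 3 ^ (e + 1) + 1 = (q ^ 3 ^ e + 1) * ((q ^ 3 ^ e + 1) * (q ^ 3 ^ e - 2) + 3) := by
      rw [pow_succ 3, pow_mul]; ring
    rw [h1, pow_succ]
    refine mul_dvd_mul ih (dvd_add (Dvd.dvd.mul_right ?_ _) (dvd_refl 3))
    exact (dvd_pow_self 3 e.succ_ne_zero).trans ih

theorem geom_sum_three_mul (Q : ℤ) (M : ℕ) :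
    ∑ i ∈ Finset.range (M * 3), Q ^ i =
      (∑ i ∈ Finset.range M, Q ^ i) * (1 + Q ^ M + Q ^ M * Q ^ M) := by
  rw [show M * 3 = M + M + M by ring, Finset.sum_range_add, Finset.sum_range_add]
  simp only [pow_add, ← Finset.mul_sum]
  ring

theorem three_dvd_pow_sub_one {Q : ℤ} (hQ : (3 : ℤ) ∣ Q - 1) (M : ℕ) : (3 : ℤ) ∣ Q ^ M - 1 :=
  hQ.trans (sub_one_dvd_pow_sub_one Q M)

theorem three_pow_dvd_geom_sum {Q : ℤ} (hQ : (3 : ℤ) ∣ Q - 1) (e : ℕ) :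
    (3 : ℤ) ^ e ∣ ∑ i ∈ Finset.range (3 ^ e), Q ^ i := by
  induction e with
  | zero => simp
  | succ e ih =>
    rw [pow_succ (3 : ℕ) e, geom_sum_three_mul, pow_succ (3 : ℤ)]
    refine mul_dvd_mul ih ?_
    obtain ⟨w, hw⟩ := three_dvd_pow_sub_one hQ (3 ^ e)
    rw [sub_eq_iff_eq_add] at hw
    exact ⟨1 + 3 * w + 3 * w ^ 2, by rw [hw]; ring⟩

/-- With `three_pow_dvd_geom_sum` this gives the exact 3-adic valuation `e`: tripling the length
multiplies the sum by `1 + z + z ^ 2` with `z` congruent to `1` modulo `3`, which is three times a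
number congruent to `1` modulo `3`. -/
theorem not_three_pow_succ_dvd_geom_sum {Q : ℤ} (hQ : (3 : ℤ) ∣ Q - 1) (e : ℕ) :
    ¬ (3 : ℤ) ^ (e + 1) ∣ ∑ i ∈ Finset.range (3 ^ e), Q ^ i := by
  induction e with
  | zero => simp
  | succ e ih =>
    rw [pow_succ (3 : ℕ) e, geom_sum_three_mul, pow_succ (3 : ℤ)]
    obtain ⟨w, hw⟩ := three_dvd_pow_sub_one hQ (3 ^ e)
    rw [sub_eq_iff_eq_add] at hw
    have h1 : (∑ i ∈ Finset.range (3 ^ e), Q ^ i) * (1 + Q ^ 3 ^ e + Q ^ 3 ^ e * Q ^ 3 ^ e) =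
        ((∑ i ∈ Finset.range (3 ^ e), Q ^ i) * (1 + 3 * (w + w ^ 2))) * 3 := by rw [hw]; ring
    rw [h1]
    intro h
    have h2 := Int.dvd_of_mul_dvd_mul_right (by norm_num) h
    refine ih (IsCoprime.dvd_of_dvd_mul_right ?_ h2)
    exact IsCoprime.pow_left ⟨-(w + w ^ 2), 1, by ring⟩

end Arithmetic

/-! ### Elements of 3-power order and the case `n = 3 ^ e`. -/

/-- The elements of a group generated by two involutions. -/
theorem exists_zpow_of_involutions {G : Type*} [Group G] {a b : G}
    (h : Subgroup.closure {a, b} = ⊤) (ha : a * a = 1) (hb : b * b = 1) (g : G) :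
    ∃ i : ℤ, g = (a * b) ^ i ∨ g = (a * b) ^ i * b := by
  have hb' : b⁻¹ = b := inv_eq_of_mul_eq_one_left hb
  have ha' : a⁻¹ = a := inv_eq_of_mul_eq_one_left ha
  have hinv : (a * b)⁻¹ = b * a := by rw [mul_inv_rev, hb', ha']
  have hsw : ∀ i : ℤ, b * (a * b) ^ i = (a * b) ^ (-i) * b := by
    intro i
    have h1 : b * (a * b) * b⁻¹ = (a * b)⁻¹ := by rw [hinv]; group
    have h2 : b * (a * b) ^ i * b⁻¹ = (a * b) ^ (-i) := by rw [← conj_zpow, h1, inv_zpow']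
    rw [← h2, inv_mul_cancel_right]
  have hg : g ∈ Subgroup.closure ({a, b} : Set G) := by rw [h]; trivial
  induction hg using Subgroup.closure_induction with
  | mem s hs =>
    rcases hs with rfl | rfl
    · exact ⟨1, Or.inr (by rw [zpow_one, mul_assoc, hb, mul_one])⟩
    · exact ⟨0, Or.inr (by simp)⟩
  | one => exact ⟨0, Or.inl (by simp)⟩
  | mul u v _ _ hu hv =>
    obtain ⟨i, rfl | rfl⟩ := hu <;> obtain ⟨j, rfl | rfl⟩ := hv
    · exact ⟨i + j, Or.inl (zpow_add _ _ _).symm⟩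
    · exact ⟨i + j, Or.inr (by rw [zpow_add, mul_assoc])⟩
    · exact ⟨i - j, Or.inr (by rw [mul_assoc, hsw, ← mul_assoc, ← zpow_add, sub_eq_add_neg])⟩
    · refine ⟨i - j, Or.inl ?_⟩
      rw [mul_assoc, ← mul_assoc b, hsw, mul_assoc, hb, mul_one, ← zpow_add, sub_eq_add_neg]
  | inv u _ hu =>
    obtain ⟨i, rfl | rfl⟩ := hu
    · exact ⟨-i, Or.inl (zpow_neg _ _).symm⟩
    · exact ⟨i, Or.inr (by rw [mul_inv_rev, ← zpow_neg, hb', hsw, neg_neg])⟩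

theorem mem_of_sq_mem_of_pow_eq_one {G : Type*} [Group G] {K : Subgroup G} {g : G}
    (h2 : g ^ 2 ∈ K) {i : ℕ} (h3 : g ^ 3 ^ i = 1) : g ∈ K := by
  have hodd : Odd (3 ^ i) := Odd.pow (by decide)
  obtain ⟨l, hl⟩ := hodd
  have h : g = g ^ 3 ^ i * ((g ^ 2) ^ l)⁻¹ := by rw [hl, ← pow_mul, pow_succ']; group
  rw [h, h3, one_mul]
  exact inv_mem (pow_mem h2 l)

theorem Commute.finite_span {G : Type*} [Group G] {u v : G} (h : Commute u v)
    (hu : IsOfFinOrder u) (hv : IsOfFinOrder v) : Finite h.span := by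
  refine ((hu.finite_zpowers.mul hv.finite_zpowers).subset ?_).to_subtype
  rintro _ ⟨i, j, rfl⟩
  exact Set.mul_mem_mul ⟨i, rfl⟩ ⟨j, rfl⟩

namespace TripartitePair

section ThreeElements

variable {G : Type*} [Group G] {a b : G} {K : Subgroup G} {n : ℕ} (T : TripartitePair a b K n)
include T

/-- The quotient by `K` is generated by two elements squaring to one whose product is killed by
three. Powers of that product are killed by cubing, all other elements by squaring. -/
theorem sq_mem_or_cube_mem (g : G) : g ^ 2 ∈ K ∨ g ^ 3 ∈ K := by
  have := T.normal
  have hcl : Subgroup.closure {QuotientGroup.mk' K a, QuotientGroup.mk' K b} = ⊤ := by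
    have := congrArg (Subgroup.map (QuotientGroup.mk' K)) T.closure_eq
    rwa [MonoidHom.map_closure, Subgroup.map_top_of_surjective _ (QuotientGroup.mk'_surjective K),
      Set.image_pair] at this
  have h1 : QuotientGroup.mk' K a * QuotientGroup.mk' K a = 1 := by
    rw [← map_mul, ← pow_two]
    exact (QuotientGroup.eq_one_iff _).2 T.x_mem
  have h2 : QuotientGroup.mk' K b * QuotientGroup.mk' K b = 1 := by
    rw [← map_mul, T.b_mul_b, map_one]
  have h3 : (QuotientGroup.mk' K a * QuotientGroup.mk' K b) ^ 3 = 1 := by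
    rw [← map_mul, ← map_pow]
    exact (QuotientGroup.eq_one_iff _).2 T.cube_mem
  obtain ⟨i, hi | hi⟩ := exists_zpow_of_involutions hcl h1 h2 (QuotientGroup.mk' K g)
  · right
    rw [← QuotientGroup.eq_one_iff]
    change QuotientGroup.mk' K (g ^ 3) = 1
    rw [map_pow, hi, ← zpow_natCast, ← zpow_mul, mul_comm, zpow_mul, zpow_natCast, h3, one_zpow]
  · left
    rw [← QuotientGroup.eq_one_iff]
    change QuotientGroup.mk' K (g ^ 2) = 1
    have hb' := inv_eq_of_mul_eq_one_left h2
    have ha' := inv_eq_of_mul_eq_one_left h1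
    set r := QuotientGroup.mk' K a * QuotientGroup.mk' K b with hr
    have h4 : QuotientGroup.mk' K b * r * (QuotientGroup.mk' K b)⁻¹ = r⁻¹ := by
      rw [hr, mul_inv_rev, ha', hb']
      simp only [mul_assoc]
      rw [h2, mul_one]
    have h5 : QuotientGroup.mk' K b * r ^ i * (QuotientGroup.mk' K b)⁻¹ = (r ^ i)⁻¹ := by
      rw [← conj_zpow, h4, inv_zpow]
    rw [hb'] at h5
    rw [map_pow, hi, pow_two, mul_assoc, ← mul_assoc _ (r ^ i), h5, mul_inv_cancel]

/-- Elements of `3`-power order have their cube in `K`. -/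
theorem cube_mem_of_pow_eq_one {g : G} {i : ℕ} (h : g ^ 3 ^ i = 1) : g ^ 3 ∈ K := by
  rcases T.sq_mem_or_cube_mem g with h2 | h2
  · exact pow_mem (mem_of_sq_mem_of_pow_eq_one h2 h) 3
  · exact h2

theorem odd_pow_mul_cube_mem {N : ℕ} (hN : Odd N) : (a ^ N * b) ^ 3 ∈ K := by
  have := T.normal
  obtain ⟨l, rfl⟩ := hN
  rw [← QuotientGroup.eq_one_iff]
  change QuotientGroup.mk' K ((a ^ (2 * l + 1) * b) ^ 3) = 1
  have h1 : QuotientGroup.mk' K (a ^ (2 * l + 1)) = QuotientGroup.mk' K a := by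
    rw [pow_succ, pow_mul, map_mul, map_pow]
    have : QuotientGroup.mk' K (a ^ 2) = 1 := (QuotientGroup.eq_one_iff _).2 T.x_mem
    rw [this, one_pow, one_mul]
  rw [map_pow, map_mul, h1, ← map_mul, ← map_pow]
  exact (QuotientGroup.eq_one_iff _).2 T.cube_mem

end ThreeElements

/-- Each division by an elementary abelian group of exponent three costs one factor of three in the
exponent. -/
theorem pow_eq_one_of_cube_mem {e : ℕ} {G : Type*} [Group G] {a b : G} {K : Subgroup G}
    (T : TripartitePair a b K (3 ^ e)) {g : G} (hg : g ^ 3 ∈ K) : g ^ 3 ^ (e + 1) = 1 := by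
  induction e generalizing G a b K with
  | zero =>
    have hx : a ^ 2 = 1 := by simpa using T.pow_eq_one
    obtain ⟨i, j, h⟩ := (T.mem_iff _).1 hg
    simpa [hx] using h
  | succ e ih =>
    obtain ⟨p, q, E, hE, hp, hq, hmem, -, -, -, hEp, T'⟩ :=
      T.exists_quotient (Nat.one_lt_pow e.succ_ne_zero (by norm_num))
    obtain rfl : p = 3 := (Nat.prime_dvd_prime_iff_eq hp Nat.prime_three).1
      (hp.dvd_of_dvd_pow ⟨q, hq⟩)
    obtain rfl : q = 3 ^ e := by rw [pow_succ] at hq; lia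
    have h1 := ih T' (g := QuotientGroup.mk' E g) (by
      rw [← map_pow]; exact Subgroup.mem_map_of_mem _ hg)
    rw [← map_pow] at h1
    have h2 := hEp _ ((QuotientGroup.eq_one_iff _).1 h1)
    rw [← pow_mul, ← pow_succ] at h2
    exact h2

end TripartitePair

section SplitExponent

variable {G : Type*} [Group G] {c δ h : G} {Q R : ℤ}

/-- Moving all copies of `h` to the left produces a geometric sum in the exponent of `c`. The
exponent `B` of `δ` matters only modulo three; stating the congruence for `2 * B` avoids halving `M
* (M - 1)`. -/
theorem mul_pow_eq_of_rconj (hc : Commute c δ) (h1 : rconj h c = c ^ Q * δ ^ R)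
    (h2 : rconj h δ = δ) (hQ : (3 : ℤ) ∣ Q - 1) (s t : ℤ) (M : ℕ) :
    ∃ B : ℤ, (3 : ℤ) ∣ 2 * B - (2 * t * M + R * s * (M * (M - 1))) ∧
      (h * (c ^ s * δ ^ t)) ^ M =
        h ^ M * (c ^ (s * ∑ i ∈ Finset.range M, Q ^ i) * δ ^ B) := by
  induction M with
  | zero => exact ⟨0, by simp, by simp⟩
  | succ M ih =>
    obtain ⟨B, hB, hM⟩ := ih
    set A := ∑ i ∈ Finset.range M, Q ^ i with hA
    have hAM : (3 : ℤ) ∣ A - M := by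
      have : A - M = ∑ i ∈ Finset.range M, (Q ^ i - 1) := by
        rw [Finset.sum_sub_distrib]; simp [hA]
      rw [this]
      exact Finset.dvd_sum fun i _ => three_dvd_pow_sub_one hQ i
    have hconj : rconj h (c ^ (s * A) * δ ^ B) = c ^ (Q * (s * A)) * δ ^ (R * (s * A) + B) := by
      rw [map_mul, map_zpow, map_zpow, h1, h2, (hc.zpow_zpow Q R).mul_zpow, ← zpow_mul, ← zpow_mul,
        mul_assoc, ← zpow_add]
    have hQs : ∑ i ∈ Finset.range (M + 1), Q ^ i = Q * A + 1 := by
      rw [Finset.sum_range_succ', pow_zero, hA, Finset.mul_sum]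
      simp only [pow_succ']
    refine ⟨R * (s * A) + B + t, ?_, ?_⟩
    · obtain ⟨v, hv⟩ := hAM
      obtain ⟨w, hw⟩ := hB
      refine ⟨w + 2 * R * s * v, ?_⟩
      push_cast
      linear_combination hw + 2 * R * s * hv
    · have e1 : c ^ (s * A) * δ ^ B * h = h * rconj h (c ^ (s * A) * δ ^ B) := by
        rw [rconj_apply]; group
      rw [pow_succ, hM, mul_assoc, ← mul_assoc _ h, e1, hconj, mul_assoc h, hc.zpow_mul_zpow_mul,
        ← mul_assoc, ← pow_succ, hQs]
      congr 3
      ring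

/-- An element whose powers act unipotently on an abelian group of exponent `3 ^ (e + 1)` generates,
with this group, a group of exponent `3 ^ (e + 1)`. -/
theorem mul_pow_three_pow_eq_one (hc : Commute c δ) (h1 : rconj h c = c ^ Q * δ ^ R)
    (h2 : rconj h δ = δ) (hQ : (3 : ℤ) ∣ Q - 1) {e : ℕ} (hce : c ^ 3 ^ (e + 1) = 1)
    (hδ : δ ^ 3 = 1) (hh : h ^ 3 ^ (e + 1) = 1) (s t : ℤ) :
    (h * (c ^ s * δ ^ t)) ^ 3 ^ (e + 1) = 1 := by
  obtain ⟨B, hB, hM⟩ := mul_pow_eq_of_rconj hc h1 h2 hQ s t (3 ^ (e + 1))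
  obtain ⟨w, hw⟩ := three_pow_dvd_geom_sum hQ (e + 1)
  have hB3 : (3 : ℤ) ∣ B := by
    have h3 : (3 : ℤ) ∣ ((3 ^ (e + 1) : ℕ) : ℤ) := by
      push_cast; exact dvd_pow_self 3 e.succ_ne_zero
    have h4 : (3 : ℤ) ∣ 2 * B := by
      have h5 : (3 : ℤ) ∣ 2 * t * (3 ^ (e + 1) : ℕ) +
          R * s * ((3 ^ (e + 1) : ℕ) * ((3 ^ (e + 1) : ℕ) - 1)) :=
        dvd_add (h3.mul_left _) ((h3.mul_right _).mul_left _)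
      exact (dvd_sub_left h5).1 hB
    lia
  obtain ⟨v, rfl⟩ := hB3
  have e1 : c ^ (s * ∑ i ∈ Finset.range (3 ^ (e + 1)), Q ^ i) = 1 := by
    rw [hw, show s * (3 ^ (e + 1) * w) = ((3 ^ (e + 1) : ℕ) : ℤ) * (s * w) by push_cast; ring,
      zpow_mul, zpow_natCast, hce, one_zpow]
  have e2 : δ ^ (3 * v) = 1 := by
    rw [zpow_mul, show (3 : ℤ) = ((3 : ℕ) : ℤ) by rfl, zpow_natCast, hδ, one_zpow]
  rw [hM, hh, e1, e2, mul_one, mul_one]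

end SplitExponent

theorem rconj_odd_pow {G : Type*} [Group G] {a u : G} {N : ℕ} (hu : Commute u (a ^ 2))
    (hN : Odd N) : rconj (a ^ N) u = rconj a u := by
  obtain ⟨l, rfl⟩ := hN
  rw [pow_succ, pow_mul, rconj_mul, (rconj_eq_self_iff _ _).2 (hu.pow_right l)]

namespace TripartitePair

section Rotation

variable {G : Type*} [Group G] {a b : G} {K : Subgroup G} {n N : ℕ}
  (T : TripartitePair a b K n)
include T

/-- Here `a ^ N` squares to one, so it behaves with `b` as in a dihedral group, and each of the two
inverts the product `a ^ N * b`. -/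
theorem rconj_b_odd_pow_mul (hN : (a ^ 2) ^ N = 1) :
    rconj b (a ^ N * b) = (a ^ N * b)⁻¹ := by
  have h : (a ^ N)⁻¹ = a ^ N := inv_eq_of_mul_eq_one_left (by
    rw [← pow_add, ← two_mul, pow_mul, hN])
  rw [mul_inv_rev, h, T.b_inv, rconj_apply, T.b_inv]
  simp only [mul_assoc]
  rw [T.b_mul_b, mul_one]

theorem rconj_a_pow_odd_pow_mul (hN : (a ^ 2) ^ N = 1) :
    rconj (a ^ N) (a ^ N * b) = (a ^ N * b)⁻¹ := by
  have h : (a ^ N)⁻¹ = a ^ N := inv_eq_of_mul_eq_one_left (by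
    rw [← pow_add, ← two_mul, pow_mul, hN])
  rw [mul_inv_rev, h, T.b_inv, rconj_apply, inv_mul_cancel_left]

end Rotation

/-- Inductive step: if `c = a ^ 3 ^ (e + 1) * b` generates a normal subgroup modulo the elementary
abelian group generated by `e₁ = (a ^ 2) ^ 3 ^ e` and its conjugate `e₂`, then `a` maps `c` to the
product of a power of `c` and a power of `e₁ * e₂⁻¹`. -/
theorem exists_rconj_eq_of_mod {G : Type*} [Group G] {a b : G} {K : Subgroup G} {e : ℕ}
    (T : TripartitePair a b K (3 ^ (e + 1))) {q i j r s : ℤ}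
    (h1 : ∀ g ∈ K, Commute ((a ^ 2) ^ 3 ^ e) g)
    (h2 : ∀ g ∈ K, Commute (rconj b (a ^ 2) ^ 3 ^ e) g)
    (h3 : rconj a (rconj b (a ^ 2) ^ 3 ^ e) =
      ((a ^ 2) ^ 3 ^ e)⁻¹ * (rconj b (a ^ 2) ^ 3 ^ e)⁻¹)
    (hq : (3 : ℤ) ∣ q + 1)
    (hc : rconj a (a ^ 3 ^ (e + 1) * b) = (a ^ 3 ^ (e + 1) * b) ^ q *
      (((a ^ 2) ^ 3 ^ e) ^ i * (rconj b (a ^ 2) ^ 3 ^ e) ^ j))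
    (hcr : (a ^ 3 ^ (e + 1) * b) ^ 3 ^ (e + 1) =
      ((a ^ 2) ^ 3 ^ e) ^ r * (rconj b (a ^ 2) ^ 3 ^ e) ^ s) :
    rconj a (a ^ 3 ^ (e + 1) * b) = (a ^ 3 ^ (e + 1) * b) ^ q *
      ((a ^ 2) ^ 3 ^ e * (rconj b (a ^ 2) ^ 3 ^ e)⁻¹) ^ i ∧
    (a ^ 3 ^ (e + 1) * b) ^ 3 ^ (e + 1) = ((a ^ 2) ^ 3 ^ e * (rconj b (a ^ 2) ^ 3 ^ e)⁻¹) ^ r ∧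
    rconj a ((a ^ 2) ^ 3 ^ e * (rconj b (a ^ 2) ^ 3 ^ e)⁻¹) =
      ((a ^ 2) ^ 3 ^ e * (rconj b (a ^ 2) ^ 3 ^ e)⁻¹)⁻¹ ∧
    rconj b ((a ^ 2) ^ 3 ^ e * (rconj b (a ^ 2) ^ 3 ^ e)⁻¹) =
      ((a ^ 2) ^ 3 ^ e * (rconj b (a ^ 2) ^ 3 ^ e)⁻¹)⁻¹ ∧
    Commute (a ^ 3 ^ (e + 1) * b) ((a ^ 2) ^ 3 ^ e * (rconj b (a ^ 2) ^ 3 ^ e)⁻¹) ∧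
    ((a ^ 2) ^ 3 ^ e * (rconj b (a ^ 2) ^ 3 ^ e)⁻¹) ^ 3 = 1 ∧
    (a ^ 2) ^ 3 ^ e * (rconj b (a ^ 2) ^ 3 ^ e)⁻¹ ≠ 1 := by
  have hn : 3 ^ (e + 1) = 3 * 3 ^ e := pow_succ' 3 e
  have hdvd : ∀ i j : ℤ, ((a ^ 2) ^ 3 ^ e) ^ i * (rconj b (a ^ 2) ^ 3 ^ e) ^ j = 1 →
    (3 : ℤ) ∣ i ∧ (3 : ℤ) ∣ j := fun i j h => T.dvd_of_x_pow_zpow hn h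
  have he1 : ∀ i j : ℤ, (3 : ℤ) ∣ i - j → ((a ^ 2) ^ 3 ^ e) ^ i = ((a ^ 2) ^ 3 ^ e) ^ j :=
    fun i j h => T.x_pow_zpow_eq hn h
  have he2 : ∀ i j : ℤ, (3 : ℤ) ∣ i - j →
    (rconj b (a ^ 2) ^ 3 ^ e) ^ i = (rconj b (a ^ 2) ^ 3 ^ e) ^ j := fun i j h =>
      T.y_pow_zpow_eq hn h
  have hN : (a ^ 2) ^ 3 ^ (e + 1) = 1 := T.pow_eq_one
  have hodd : Odd (3 ^ (e + 1)) := Odd.pow (by decide)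
  have hcb := T.rconj_b_odd_pow_mul hN
  have hca := T.rconj_a_pow_odd_pow_mul hN
  have hab : ∀ u : G, Commute u (a ^ 2) →
      rconj (a ^ 3 ^ (e + 1) * b) u = rconj b (rconj a u) := fun u hu => by
    rw [rconj_mul, rconj_odd_pow hu hodd]
  have hb1 : rconj b ((a ^ 2) ^ 3 ^ e) = rconj b (a ^ 2) ^ 3 ^ e := map_pow _ _ _
  have ha1 : rconj a ((a ^ 2) ^ 3 ^ e) = (a ^ 2) ^ 3 ^ e := by rw [map_pow, rconj_a_x]
  have hcomm := h1 _ (pow_mem T.y_mem (3 ^ e))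
  have hx1 := h1 _ T.x_mem
  have hx2 := h2 _ T.x_mem
  set e₁ := (a ^ 2) ^ 3 ^ e
  set e₂ := rconj b (a ^ 2) ^ 3 ^ e
  set c := a ^ 3 ^ (e + 1) * b
  have hb2 : rconj b e₂ = e₁ := by rw [← hb1, T.rconj_b_rconj_b]
  -- On `⟨e₁, e₂⟩`, a plane over the field with three elements, `c` acts unipotently and its fixed
  -- line is spanned by `e₁ * e₂⁻¹`.
  have hc1 : rconj c e₁ = e₂ := by rw [hab _ hx1, ha1, hb1]
  have hc2 : rconj c e₂ = e₂⁻¹ * e₁⁻¹ := by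
    rw [hab _ hx2, h3, map_mul, map_inv, map_inv, hb1, hb2]
  have hcd : rconj c (e₁ * e₂⁻¹) = e₁ * e₂⁻¹ := by
    rw [map_mul, map_inv, hc1, hc2, mul_inv_rev, inv_inv, inv_inv, ← mul_assoc, hcomm.symm.eq,
      mul_assoc, ← pow_two, ← zpow_natCast, he2 _ (-1) (by norm_num), zpow_neg_one]
  have had : rconj a (e₁ * e₂⁻¹) = (e₁ * e₂⁻¹)⁻¹ := by
    rw [map_mul, map_inv, ha1, h3, mul_inv_rev, inv_inv, inv_inv, mul_inv_rev, inv_inv,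
      hcomm.symm.eq, ← mul_assoc, ← pow_two, ← zpow_natCast, he1 _ (-1) (by norm_num),
      zpow_neg_one, (hcomm.inv_left).eq]
  have hbd : rconj b (e₁ * e₂⁻¹) = (e₁ * e₂⁻¹)⁻¹ := by
    rw [map_mul, map_inv, hb1, hb2, mul_inv_rev, inv_inv]
  have hd3 : (e₁ * e₂⁻¹) ^ 3 = 1 := by
    rw [hcomm.inv_right.mul_pow, inv_pow, ← zpow_natCast, ← zpow_natCast, he1 _ 0 (by norm_num),
      he2 _ 0 (by norm_num)]
    simp
  have hdz : ∀ t : ℤ, (e₁ * e₂⁻¹) ^ t = e₁ ^ t * e₂ ^ (-t) := fun t => by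
    rw [hcomm.inv_right.mul_zpow, inv_zpow']
  have hd1 : e₁ * e₂⁻¹ ≠ 1 := by
    intro h
    have := (hdvd 1 (-1) (by rw [zpow_one, zpow_neg_one, h])).1
    norm_num at this
  -- This power of `c` lies in the plane and is fixed by `c`, so it lies on the fixed line.
  have hcr' : c ^ 3 ^ (e + 1) = (e₁ * e₂⁻¹) ^ r := by
    have h4 : rconj c (c ^ 3 ^ (e + 1)) = c ^ 3 ^ (e + 1) := by
      rw [rconj_eq_self_iff]; exact (Commute.refl c).pow_left _
    rw [hcr, map_mul, map_zpow, map_zpow, hc1, hc2, hcomm.symm.inv_inv.mul_zpow, inv_zpow',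
      inv_zpow', ← mul_assoc, ← zpow_add, (hcomm.zpow_zpow _ _).symm.eq] at h4
    have h5 : e₁ ^ (-s - r) * e₂ ^ (r + -s - s) = 1 := by
      rw [sub_eq_add_neg, sub_eq_add_neg (r + -s), ← hcomm.zpow_mul_zpow_mul, h4,
        hcomm.zpow_mul_zpow_mul]
      simp
    have h6 := (hdvd _ _ h5).1
    rw [hcr, hdz, he2 s (-r) (by lia)]
  refine ⟨?_, hcr', had, hbd, ((rconj_eq_self_iff _ _).1 hcd).symm, hd3, hd1⟩
  have hfin : IsOfFinOrder (e₁ * e₂⁻¹) :=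
    isOfFinOrder_iff_pow_eq_one.2 ⟨3, by norm_num, hd3⟩
  have hnorm : (Subgroup.zpowers (e₁ * e₂⁻¹)).Normal := by
    have : Finite (Subgroup.zpowers (e₁ * e₂⁻¹)) := hfin.finite_zpowers.to_subtype
    refine normal_of_rconj_mem T.closure_eq _ ?_
    rintro g (rfl | rfl) _ ⟨t, rfl⟩
    · exact ⟨-t, by simp only [map_zpow]; rw [had, inv_zpow']⟩
    · exact ⟨-t, by simp only [map_zpow]; rw [hbd, inv_zpow']⟩
  -- Modulo the fixed line, the correction to `c ^ q` becomes the power `i + j` of the single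
  -- element `f e₁`; it has to be shown trivial.
  let f := QuotientGroup.mk' (Subgroup.zpowers (e₁ * e₂⁻¹))
  have hfd : ∀ t : ℤ, f ((e₁ * e₂⁻¹) ^ t) = 1 := fun t =>
    (QuotientGroup.eq_one_iff _).2 ⟨t, rfl⟩
  have hf12 : f e₂ = f e₁ := by
    have := hfd 1
    rw [zpow_one, map_mul, map_inv, mul_inv_eq_one] at this
    exact this.symm
  have hηa : rconj (f a) (f e₁) = f e₁ := by rw [← map_rconj, ha1]
  have hηc : Commute (f c) (f e₁) := by
    have := congrArg f hc1
    rw [map_rconj, hf12, rconj_eq_self_iff] at this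
    exact this.symm
  have hη3 : ∀ t : ℤ, (3 : ℤ) ∣ t → (f e₁) ^ t = 1 := fun t ht => by
    rw [← map_zpow, he1 t 0 (by rwa [sub_zero]), zpow_zero, map_one]
  have hfa : rconj (f a) (f c) = f c ^ q * f e₁ ^ (i + j) := by
    rw [← map_rconj, hc, map_mul f (c ^ q), map_zpow f c, map_mul f (e₁ ^ i), map_zpow f e₁,
      map_zpow f e₂, hf12, zpow_add]
  have hfx : rconj (f a ^ 2) (f c) = f c ^ (q * q) := by
    rw [pow_two, rconj_mul, hfa, map_mul, map_zpow, map_zpow, hηa, hfa,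
      (hηc.zpow_zpow _ _).mul_zpow, ← zpow_mul, ← zpow_mul, mul_assoc, ← zpow_add,
      hη3 ((i + j) * q + (i + j)) (by
        rw [show (i + j) * q + (i + j) = (i + j) * (q + 1) by ring]; exact hq.mul_left _), mul_one]
  have hfxl : ∀ l : ℕ, rconj ((f a ^ 2) ^ l) (f c) = f c ^ ((q * q) ^ l) := by
    intro l
    induction l with
    | zero => simp [rconj_apply]
    | succ l ih =>
      rw [pow_succ, rconj_mul, ih, map_zpow, hfx, ← zpow_mul, pow_succ, mul_comm]
  obtain ⟨l, hl⟩ := hodd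
  have hfN : (f c)⁻¹ = f c ^ (q ^ 3 ^ (e + 1)) * f e₁ ^ (i + j) := by
    have h4 := congrArg f hca
    rw [map_rconj, map_inv, map_pow, hl, pow_succ', pow_mul, rconj_mul, hfa, map_mul, map_zpow,
      map_zpow, hfxl] at h4
    have h5 : rconj ((f a ^ 2) ^ l) (f e₁) = f e₁ := by
      rw [rconj_eq_self_iff, ← map_pow, ← map_pow]
      exact (hx1.pow_right l).map f
    rw [h5, ← zpow_mul] at h4
    rw [← h4]
    congr 2
    rw [hl, pow_succ, pow_mul, pow_two]
  -- The odd power `a ^ 3 ^ (e + 1)` inverts `c`. By iteration it also maps `f c` to its power `q ^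
  -- 3 ^ (e + 1)` times the correction, and that power is already the inverse of `f c`. So the
  -- correction vanishes.
  have hfc : f c ^ (q ^ 3 ^ (e + 1) + 1) = 1 := by
    obtain ⟨w, hw⟩ := (pow_dvd_pow (3 : ℤ) (e + 1).le_succ).trans
      (three_pow_succ_dvd_pow_add_one hq (e + 1))
    rw [hw, zpow_mul, show ((3 : ℤ) ^ (e + 1)) = ((3 ^ (e + 1) : ℕ) : ℤ) by push_cast; rfl,
      zpow_natCast, ← map_pow, hcr', hfd, one_zpow]
  have hη : f e₁ ^ (i + j) = 1 := by
    rw [zpow_add_one] at hfc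
    have h4 := eq_inv_of_mul_eq_one_left hfc
    rw [h4] at hfN
    exact (left_eq_mul.1 hfN)
  rw [← map_zpow] at hη
  obtain ⟨t, ht⟩ := (QuotientGroup.eq_one_iff _).1 hη
  simp only [hdz] at ht
  have h4 := hdvd (t - (i + j)) (-t) (by
    rw [sub_eq_neg_add, zpow_add, mul_assoc, ht, zpow_neg, inv_mul_cancel])
  rw [hc, hdz, he2 j (-i) (by lia)]

end TripartitePair

namespace TripartitePair

/-- Excludes `c ^ 3 ^ e = 1`. The group is `⟨a⟩` times the normal abelian subgroup `⟨c, δ⟩`. If the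
exponent of `a` in `g` is even, `a` enters through a power of `a ^ 2`, whose action is unipotent
modulo three, and `mul_pow_three_pow_eq_one` gives `g ^ 3 ^ e = 1`. If it is odd, `g` inverts `δ`,
impossible for an element of odd order unless `δ = δ⁻¹`. For `e = 0` the element `c` is trivial and
`a = b`. -/
theorem false_of_rconj_eq {G : Type*} [Group G] {a b g c δ : G} {K : Subgroup G} {e i : ℕ}
    {q r : ℤ} (T : TripartitePair a b K (3 ^ e)) (hcb : c = a ^ 3 ^ e * b)
    (hg : g ^ 3 ^ i = 1) (hge : g ^ 3 ^ e ≠ 1) (hq : (3 : ℤ) ∣ q + 1)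
    (hac : rconj a c = c ^ q * δ ^ r) (hce : c ^ 3 ^ e = 1) (haδ : rconj a δ = δ⁻¹)
    (hbδ : rconj b δ = δ⁻¹) (hcδ : Commute c δ) (hδ3 : δ ^ 3 = 1) (hδ : δ ≠ 1) : False := by
  have hN : (a ^ 2) ^ 3 ^ e = 1 := T.pow_eq_one
  have he0 : e ≠ 0 := by
    rintro rfl
    have hc1 : c = 1 := by simpa using hce
    have ha : a = b := by
      rw [hcb, pow_zero, pow_one] at hc1
      rw [← T.b_inv]; exact eq_inv_of_mul_eq_one_left hc1
    have hx : a ^ 2 = 1 := by simpa using hN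
    obtain ⟨l, hl⟩ := exists_zpow_of_involutions T.closure_eq (by rw [← pow_two, hx]) T.b_mul_b g
    rw [ha, T.b_mul_b, one_zpow, one_mul] at hl
    rcases hl with hl | hl
    · exact hge (by rw [hl, one_pow])
    · obtain ⟨s, hs⟩ : Odd (3 ^ i) := Odd.pow (by decide)
      rw [hl, hs, pow_succ, pow_mul, pow_two, T.b_mul_b, one_pow, one_mul] at hg
      exact hge (by rw [hl, hg, one_pow])
  obtain ⟨e, rfl⟩ := Nat.exists_eq_succ_of_ne_zero he0
  have hS : hcδ.span.Normal := by
    have : Finite hcδ.span := hcδ.finite_span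
      (isOfFinOrder_iff_pow_eq_one.2 ⟨_, by positivity, hce⟩)
      (isOfFinOrder_iff_pow_eq_one.2 ⟨_, by positivity, hδ3⟩)
    have hcm : c ∈ hcδ.span := ⟨1, 0, by simp⟩
    have hδm : δ ∈ hcδ.span := ⟨0, 1, by simp⟩
    refine normal_of_rconj_mem T.closure_eq _ ?_
    rintro s (rfl | rfl) _ ⟨i, j, rfl⟩
    · rw [map_mul, map_zpow, map_zpow, hac, haδ]
      exact mul_mem (zpow_mem (mul_mem (zpow_mem hcm _) (zpow_mem hδm _)) _)
        (zpow_mem (inv_mem hδm) _)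
    · have hbc : rconj s c = c⁻¹ := by rw [hcb, T.rconj_b_odd_pow_mul hN]
      rw [map_mul, map_zpow, map_zpow, hbδ, hbc]
      exact mul_mem (zpow_mem (inv_mem hcm) _) (zpow_mem (inv_mem hδm) _)
  have htop : Subgroup.zpowers a ⊔ hcδ.span = ⊤ := by
    have ham : a ∈ Subgroup.zpowers a ⊔ hcδ.span :=
      Subgroup.mem_sup_left (Subgroup.mem_zpowers a)
    rw [eq_top_iff, ← T.closure_eq, Subgroup.closure_le]
    rintro s (rfl | rfl)
    · exact ham
    · have : s = (a ^ 3 ^ (e + 1))⁻¹ * c := by rw [hcb, inv_mul_cancel_left]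
      rw [this]
      exact mul_mem (inv_mem (pow_mem ham _)) (Subgroup.mem_sup_right ⟨1, 0, by simp⟩)
  have hgm : g ∈ Subgroup.zpowers a ⊔ hcδ.span := htop ▸ Subgroup.mem_top g
  obtain ⟨_, ⟨l, rfl⟩, _, ⟨s, t, rfl⟩, rfl⟩ := Subgroup.mem_sup_of_normal_right.1 hgm
  simp only at hg hge
  have hxδ : rconj (a ^ 2) δ = δ := by rw [pow_two, rconj_mul, haδ, map_inv, haδ, inv_inv]
  have hxδ' : ∀ m : ℤ, rconj ((a ^ 2) ^ m) δ = δ := fun m => by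
    rw [rconj_eq_self_iff] at hxδ ⊢
    exact hxδ.zpow_right m
  rcases Int.even_or_odd' l with ⟨m, rfl | rfl⟩
  · obtain ⟨m', hm'⟩ : ∃ m' : ℕ, (a ^ 2) ^ m = (a ^ 2) ^ m' := by
      have := (isOfFinOrder_iff_pow_eq_one.2 ⟨_, by positivity, hN⟩ :
        IsOfFinOrder (a ^ 2)).mem_powers_iff_mem_zpowers.2 ⟨m, rfl⟩
      obtain ⟨m', h⟩ := this
      exact ⟨m', h.symm⟩
    have hl : a ^ (2 * m) = (a ^ 2) ^ m' := by rw [← hm', zpow_mul, zpow_ofNat]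
    have hQ : ∃ Q R : ℤ, (3 : ℤ) ∣ Q - 1 ∧ rconj ((a ^ 2) ^ m') c = c ^ Q * δ ^ R := by
      have hx : rconj (a ^ 2) c = c ^ (q * q) * δ ^ (r * q + -r) := by
        rw [pow_two, rconj_mul, hac, map_mul, map_zpow, map_zpow, hac, haδ,
          (hcδ.zpow_zpow _ _).mul_zpow, ← zpow_mul, ← zpow_mul, mul_assoc, inv_zpow', ← zpow_add]
      have hqq : (3 : ℤ) ∣ q * q - 1 := by
        rw [show q * q - 1 = (q + 1) * (q - 1) by ring]; exact hq.mul_right _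
      clear hm' hl
      induction m' with
      | zero => exact ⟨1, 0, by simp, by simp [rconj_apply]⟩
      | succ m' ih =>
        obtain ⟨Q, R, hQ, h⟩ := ih
        refine ⟨q * q * Q, (r * q + -r) * Q + R, ?_, ?_⟩
        · rw [show q * q * Q - 1 = (q * q - 1) * Q + (Q - 1) by ring]
          exact dvd_add (hqq.mul_right _) hQ
        · rw [pow_succ, rconj_mul, h, map_mul, map_zpow, map_zpow, hxδ, hx,
            (hcδ.zpow_zpow _ _).mul_zpow, ← zpow_mul, ← zpow_mul, mul_assoc, ← zpow_add]
    obtain ⟨Q, R, hQ, h⟩ := hQ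
    refine hge ?_
    rw [hl]
    refine mul_pow_three_pow_eq_one hcδ h ?_ hQ hce hδ3 ?_ s t
    · have := hxδ' m'
      rwa [zpow_natCast] at this
    · rw [pow_right_comm, hN, one_pow]
  · have h1 : rconj (a ^ (2 * m + 1) * (c ^ s * δ ^ t)) δ = δ⁻¹ := by
      have h2 : a ^ (2 * m + 1) = (a ^ 2) ^ m * a := by rw [zpow_add_one, zpow_mul, zpow_ofNat]
      rw [h2, rconj_mul, rconj_mul ((a ^ 2) ^ m), hxδ', haδ, rconj_eq_self_iff]
      exact ((hcδ.symm.zpow_right s).mul_right ((Commute.refl δ).zpow_right t)).inv_left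
    have h2 : Commute δ ((a ^ (2 * m + 1) * (c ^ s * δ ^ t)) ^ 2) := by
      rw [← rconj_eq_self_iff, pow_two, rconj_mul, h1, map_inv, h1, inv_inv]
    have h3 := rconj_odd_pow h2 (N := 3 ^ i) (Odd.pow (by decide))
    rw [hg, h1] at h3
    have h4 : δ = δ⁻¹ := by rw [← h3]; simp [rconj_apply]
    apply hδ
    calc δ = δ ^ 3 * (δ * δ)⁻¹ := by group
      _ = 1 := by
        rw [hδ3]; nth_rewrite 2 [h4]; simp

/-- If some element of `3`-power order has order at least `3 ^ (e + 1)`, then the element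
`c = a ^ 3 ^ e * b` has order `3 ^ (e + 1)` and generates a normal subgroup. -/
theorem exists_rconj_eq_zpow {G : Type*} [Group G] {a b g : G} {K : Subgroup G} {e i : ℕ}
    (T : TripartitePair a b K (3 ^ e)) (hg : g ^ 3 ^ i = 1) (hge : g ^ 3 ^ e ≠ 1) :
    (a ^ 3 ^ e * b) ^ 3 ^ e ≠ 1 ∧
      ∃ q : ℤ, (3 : ℤ) ∣ q + 1 ∧ rconj a (a ^ 3 ^ e * b) = (a ^ 3 ^ e * b) ^ q := by
  induction e generalizing G a b g K with
  | zero =>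
    have hx : a ^ 2 = 1 := by simpa using T.pow_eq_one
    have ha : a * a = 1 := by rw [← pow_two, hx]
    have ha' : a⁻¹ = a := inv_eq_of_mul_eq_one_left ha
    simp only [pow_zero, pow_one] at hge ⊢
    refine ⟨fun h => ?_, -1, by norm_num, ?_⟩
    · obtain ⟨l, hl⟩ := exists_zpow_of_involutions T.closure_eq ha T.b_mul_b g
      rw [h, one_zpow, one_mul] at hl
      rcases hl with hl | hl
      · exact hge hl
      · obtain ⟨s, hs⟩ : Odd (3 ^ i) := Odd.pow (by decide)
        rw [hl, hs, pow_succ, pow_mul, pow_two, T.b_mul_b, one_pow, one_mul] at hg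
        exact hge (by rw [hl, hg])
    · rw [rconj_apply, zpow_neg_one, mul_inv_rev, T.b_inv, ha', ← mul_assoc, ha, one_mul]
  | succ e ih =>
    obtain ⟨p, m, E, hE, hp, hpm, hmem, h1, h2, h3, hEp, T'⟩ :=
      T.exists_quotient (Nat.one_lt_pow e.succ_ne_zero (by norm_num))
    obtain rfl : p = 3 := (Nat.prime_dvd_prime_iff_eq hp Nat.prime_three).1
      (hp.dvd_of_dvd_pow (Dvd.intro m hpm.symm))
    obtain rfl : m = 3 ^ e := by
      rw [pow_succ'] at hpm
      exact (Nat.eq_of_mul_eq_mul_left (by norm_num) hpm).symm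
    have hfx : (QuotientGroup.mk' E a ^ 2) ^ 3 ^ e = 1 := T'.pow_eq_one
    -- The kernel has exponent three, so the order of the image of `g` drops by at most one factor
    -- of three, as the induction requires.
    obtain ⟨-, q, hq, hcq⟩ := ih T' (g := QuotientGroup.mk' E g) (by rw [← map_pow, hg, map_one])
      (fun h => hge (by
        rw [← map_pow] at h
        rw [pow_succ, pow_mul]
        exact hEp _ ((QuotientGroup.eq_one_iff _).1 h)))
    have hfc : QuotientGroup.mk' E (a ^ 3 ^ (e + 1) * b) =
        QuotientGroup.mk' E a ^ 3 ^ e * QuotientGroup.mk' E b := by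
      rw [map_mul, map_pow, show 3 ^ (e + 1) = 2 * 3 ^ e + 3 ^ e by ring, pow_add, pow_mul, hfx,
        one_mul]
    obtain ⟨i', j', hij⟩ := (hmem (((a ^ 3 ^ (e + 1) * b) ^ q)⁻¹ * rconj a (a ^ 3 ^ (e + 1) * b))).1
      (by
        rw [← QuotientGroup.eq]
        change QuotientGroup.mk' E _ = QuotientGroup.mk' E _
        rw [map_zpow, map_rconj, hfc, hcq])
    obtain ⟨r, s, hrs⟩ := (hmem ((a ^ 3 ^ (e + 1) * b) ^ 3 ^ (e + 1))).1 (by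
      rw [← QuotientGroup.eq_one_iff]
      change QuotientGroup.mk' E _ = 1
      rw [map_pow, hfc]
      exact T'.pow_eq_one_of_cube_mem (T'.odd_pow_mul_cube_mem (Odd.pow (by decide))))
    obtain ⟨hac, hcr, haδ, hbδ, hcδ, hδ3, hδ⟩ := T.exists_rconj_eq_of_mod h1 h2 h3 hq
      (inv_mul_eq_iff_eq_mul.1 hij) hrs
    by_cases hc1 : (a ^ 3 ^ (e + 1) * b) ^ 3 ^ (e + 1) = 1
    · exact (T.false_of_rconj_eq rfl hg hge hq hac hc1 haδ hbδ hcδ hδ3 hδ).elim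
    -- Now `c ^ 3 ^ (e + 1)` is `δ ^ r` with `r` prime to three, so `δ` is a power of `c`. As `r * r
    -- = 1` modulo three, `δ ^ i'` is the power `3 ^ (e + 1) * (r * i')` of `c`.
    · refine ⟨hc1, q + 3 ^ (e + 1) * (r * i'), ?_, ?_⟩
      · rw [show q + 3 ^ (e + 1) * (r * i') + 1 = (q + 1) + 3 * (3 ^ e * (r * i')) by ring]
        exact dvd_add hq (dvd_mul_right _ _)
      · have hδz : ∀ t : ℤ, (3 : ℤ) ∣ t →
            ((a ^ 2) ^ 3 ^ e * (rconj b (a ^ 2) ^ 3 ^ e)⁻¹) ^ t = 1 := by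
          rintro _ ⟨t, rfl⟩
          rw [zpow_mul, show (3 : ℤ) = ((3 : ℕ) : ℤ) by rfl, zpow_natCast, hδ3, one_zpow]
        have hr : ¬ (3 : ℤ) ∣ r := fun h => hc1 (by rw [hcr, hδz r h])
        have hrr : (3 : ℤ) ∣ r * r * i' - i' := by
          have h4 : (3 : ℤ) ∣ r * r - 1 := by
            have : r % 3 = 1 ∨ r % 3 = 2 := by lia
            rcases this with h | h
            · obtain ⟨w, rfl⟩ : ∃ w, r = 3 * w + 1 := ⟨r / 3, by lia⟩
              exact ⟨3 * w * w + 2 * w, by ring⟩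
            · obtain ⟨w, rfl⟩ : ∃ w, r = 3 * w + 2 := ⟨r / 3, by lia⟩
              exact ⟨3 * w * w + 4 * w + 1, by ring⟩
          rw [show r * r * i' - i' = (r * r - 1) * i' by ring]
          exact h4.mul_right _
        have h5 := hδz _ hrr
        rw [zpow_sub, mul_inv_eq_one] at h5
        rw [hac, zpow_add, zpow_mul (a ^ 3 ^ (e + 1) * b) (3 ^ (e + 1))]
        congr 1
        rw [show ((3 : ℤ) ^ (e + 1)) = ((3 ^ (e + 1) : ℕ) : ℤ) by push_cast; rfl, zpow_natCast, hcr,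
          ← zpow_mul, ← h5, mul_assoc]

end TripartitePair

/-! ### Primitive roots modulo powers of three. -/

/-- An integer generating the units modulo `9` generates the units modulo every power of `3`. -/
theorem orderOf_intCast_zmod_three_pow {q : ℤ} (hq : (3 : ℤ) ∣ q + 1) (hq9 : ¬ (9 : ℤ) ∣ q ^ 2 - 1)
    (e : ℕ) : orderOf (q : ZMod (3 ^ (e + 1))) = 2 * 3 ^ e := by
  have hcast : ∀ z : ℤ, (z : ZMod (3 ^ (e + 1))) = 0 ↔ (3 : ℤ) ^ (e + 1) ∣ z := fun z => by
    rw [ZMod.intCast_zmod_eq_zero_iff_dvd]; push_cast; rfl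
  have h2 : (q : ZMod (3 ^ (e + 1))) ^ 3 ^ e = -1 := by
    rw [← add_eq_zero_iff_eq_neg]
    have := (hcast (q ^ 3 ^ e + 1)).2 (three_pow_succ_dvd_pow_add_one hq e)
    push_cast at this
    exact this
  refine orderOf_eq_of_pow_and_pow_div_prime (by positivity) ?_ ?_
  · rw [mul_comm, pow_mul, h2]; norm_num
  · intro p hp hpd
    rcases (Nat.Prime.dvd_mul hp).1 hpd with h | h
    · rw [(Nat.prime_dvd_prime_iff_eq hp Nat.prime_two).1 h,
        Nat.mul_div_cancel_left _ (by norm_num),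
        h2]
      have : Fact (2 < 3 ^ (e + 1)) := ⟨by
        rw [pow_succ]; have : 0 < 3 ^ e := by positivity
        lia⟩
      exact ZMod.neg_one_ne_one
    · obtain rfl := (Nat.prime_dvd_prime_iff_eq hp Nat.prime_three).1 (hp.dvd_of_dvd_pow h)
      obtain ⟨e, rfl⟩ := Nat.exists_eq_succ_of_ne_zero (n := e) (by rintro rfl; simp at h)
      intro h4
      rw [show 2 * 3 ^ (e + 1) / 3 = 2 * 3 ^ e by
        rw [pow_succ, ← mul_assoc, Nat.mul_div_cancel _ (by norm_num)], pow_mul] at h4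
      have h5 : (3 : ℤ) ^ (e + 1 + 1) ∣ (q ^ 2) ^ 3 ^ e - 1 := by
        rw [← hcast]; push_cast; rw [h4, sub_self]
      have h6 : (3 : ℤ) ∣ q ^ 2 - 1 := by
        rw [show q ^ 2 - 1 = (q + 1) * (q - 1) by ring]; exact hq.mul_right _
      -- The geometric sum contributes exactly `3 ^ e` and `q ^ 2 - 1` exactly one factor of three,
      -- one short of the required `3 ^ (e + 2)`.
      rw [← geom_sum_mul, pow_succ] at h5
      obtain ⟨v, hv⟩ := h6
      obtain ⟨w, hw⟩ := three_pow_dvd_geom_sum ⟨v, hv⟩ e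
      have h7 := not_three_pow_succ_dvd_geom_sum ⟨v, hv⟩ e
      rw [hw, pow_succ, mul_dvd_mul_iff_left (by positivity)] at h7
      rw [hv, hw, pow_succ, show (3 : ℤ) ^ e * w * (3 * v) = 3 ^ e * 3 * (w * v) by ring,
        mul_dvd_mul_iff_left (by positivity)] at h5
      rcases Int.prime_three.dvd_or_dvd h5 with h8 | h8
      · exact h7 h8
      · exact hq9 (by rw [hv]; exact mul_dvd_mul_left 3 h8)

/-- Both `q` and `2` generate the cyclic group of units modulo `3 ^ (e + 1)`, so `2` is a power of
`q` whose exponent is prime to the group order. -/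
theorem exists_coprime_pow_sub_two_dvd {q : ℤ} (hq : (3 : ℤ) ∣ q + 1)
    (hq9 : ¬ (9 : ℤ) ∣ q ^ 2 - 1) (e : ℕ) :
    ∃ j : ℕ, j.Coprime (2 * 3 ^ e) ∧ (3 : ℤ) ^ (e + 1) ∣ q ^ j - 2 := by
  have h1 := orderOf_intCast_zmod_three_pow hq hq9 e
  have h2 : orderOf ((2 : ℤ) : ZMod (3 ^ (e + 1))) = 2 * 3 ^ e :=
    orderOf_intCast_zmod_three_pow (by norm_num) (by norm_num) e
  have hunit : ∀ z : ZMod (3 ^ (e + 1)), orderOf z = 2 * 3 ^ e → IsUnit z := fun z hz =>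
    (orderOf_pos_iff.1 (by rw [hz]; positivity)).isUnit
  have htop : Subgroup.zpowers (hunit _ h1).unit = ⊤ := by
    apply Subgroup.eq_top_of_card_eq
    rw [Nat.card_zpowers, Nat.card_eq_fintype_card, ZMod.card_units_eq_totient,
      Nat.totient_prime_pow_succ Nat.prime_three, ← orderOf_units, IsUnit.unit_spec, h1]
    ring
  have hmem : (hunit _ h2).unit ∈ Subgroup.zpowers (hunit _ h1).unit := htop ▸ Subgroup.mem_top _
  rw [← mem_powers_iff_mem_zpowers] at hmem
  obtain ⟨j, hj⟩ := hmem
  have hj' : ((q : ZMod (3 ^ (e + 1)))) ^ j = ((2 : ℤ) : ZMod (3 ^ (e + 1))) := by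
    have := congrArg Units.val hj
    simpa using this
  refine ⟨j, ?_, ?_⟩
  · have h3 := orderOf_pow (n := j) (x := (hunit _ h1).unit)
    simp only at hj
    rw [hj, ← orderOf_units, ← orderOf_units, IsUnit.unit_spec, IsUnit.unit_spec, h1, h2] at h3
    have h4 := Nat.gcd_dvd_left (2 * 3 ^ e) j
    have h5 : (2 * 3 ^ e).gcd j = 1 := by
      have hpos : 0 < 2 * 3 ^ e := by positivity
      by_contra h
      have h6 : 1 < (2 * 3 ^ e).gcd j := by
        have := Nat.gcd_pos_of_pos_left j hpos
        lia
      have := Nat.div_lt_self hpos h6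
      lia
    rwa [Nat.gcd_comm] at h5
  · have h6 : ((q ^ j - 2 : ℤ) : ZMod (3 ^ (e + 1))) = 0 := by
      push_cast; rw [hj']; simp
    rw [ZMod.intCast_zmod_eq_zero_iff_dvd] at h6
    exact_mod_cast h6

namespace TripartitePair

/-- Conjugating `x = a ^ 2` by `c` gives `y = x * c ^ (1 - q ^ 2)`. If nine divided `q ^ 2 - 1`, the
power `3 ^ (e - 1)` would kill the factor from `⟨c⟩`, making equal powers of `x` and `y` coincide
although `⟨x⟩` and `⟨y⟩` meet trivially. -/
theorem not_nine_dvd {G : Type*} [Group G] {a b : G} {K : Subgroup G} {e : ℕ}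
    (T : TripartitePair a b K (3 ^ e)) (he : 1 ≤ e) {q : ℤ}
    (hc : rconj a (a ^ 3 ^ e * b) = (a ^ 3 ^ e * b) ^ q) : ¬ (9 : ℤ) ∣ q ^ 2 - 1 := by
  rintro ⟨w, hw⟩
  obtain ⟨e, rfl⟩ := Nat.exists_eq_add_of_le' he
  have hce : (a ^ 3 ^ (e + 1) * b) ^ 3 ^ (e + 1 + 1) = 1 :=
    T.pow_eq_one_of_cube_mem (T.odd_pow_mul_cube_mem (Odd.pow (by decide)))
  set c := a ^ 3 ^ (e + 1) * b with hcdef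
  have hx : rconj (a ^ 2) c = c ^ (q ^ 2) := by
    rw [pow_two, rconj_mul, hc, map_zpow, hc, ← zpow_mul, pow_two]
  have hy : rconj b (a ^ 2) = a ^ 2 * c ^ (1 - q ^ 2) := by
    have h1 : rconj c (a ^ 2) = rconj b (a ^ 2) := by
      rw [hcdef, rconj_mul, rconj_odd_pow (Commute.refl _) (Odd.pow (by decide)), rconj_a_x]
    rw [← h1, zpow_sub, zpow_one, ← hx, rconj_apply, rconj_apply]
    have h2 : a ^ 2 * c = c * rconj c (a ^ 2) := by rw [rconj_apply]; group
    have h3 : Commute c (c ^ (q ^ 2)) := (Commute.refl c).zpow_right _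
    rw [← hx, rconj_apply] at h3
    have h4 := h3.inv_right.eq
    rw [h4]
    group
  have h3 : (3 : ℤ) ∣ q ^ 2 - 1 := by rw [hw]; exact Dvd.intro (3 * w) (by ring)
  obtain ⟨B, -, hB⟩ := mul_pow_eq_of_rconj (Q := q ^ 2) (R := 0) (Commute.one_right c)
    (by rw [hx]; simp) (map_one _) h3 (1 - q ^ 2) 0 (3 ^ e) (h := a ^ 2)
  obtain ⟨v, hv⟩ := three_pow_dvd_geom_sum h3 e
  rw [one_zpow, one_zpow, mul_one, mul_one, ← hy, hv,
    show (1 - q ^ 2) * (3 ^ e * v) = ((3 ^ (e + 1 + 1) : ℕ) : ℤ) * (-(w * v)) by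
      push_cast; linear_combination (-(3 ^ e * v)) * hw, zpow_mul, zpow_natCast, hce, one_zpow,
    mul_one] at hB
  have h4 := (T.dvd_of_eq_one (3 ^ e : ℕ) (-(3 ^ e : ℕ)) (by
    rw [zpow_neg, zpow_natCast, zpow_natCast, hB, mul_inv_cancel])).1
  have h5 := Nat.le_of_dvd (by positivity) (Int.natCast_dvd_natCast.1 h4)
  exact absurd h5 (not_le.2 (Nat.pow_lt_pow_right (by norm_num) e.lt_succ_self))

/-- After replacing `a` by a suitable power, `a` squares the element `c`. -/
theorem exists_coprime_rconj_eq_sq {G : Type*} [Group G] {a b g : G} {K : Subgroup G} {e i : ℕ}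
    (T : TripartitePair a b K (3 ^ e)) (he : 1 ≤ e) (hg : g ^ 3 ^ i = 1) (hge : g ^ 3 ^ e ≠ 1) :
    ∃ j : ℕ, j.Coprime (2 * 3 ^ e) ∧ rconj (a ^ j) (a ^ 3 ^ e * b) = (a ^ 3 ^ e * b) ^ 2 := by
  obtain ⟨-, q, hq, hc⟩ := T.exists_rconj_eq_zpow hg hge
  obtain ⟨j, hj, w, hw⟩ := exists_coprime_pow_sub_two_dvd hq (T.not_nine_dvd he hc) e
  have hce : (a ^ 3 ^ e * b) ^ 3 ^ (e + 1) = 1 :=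
    T.pow_eq_one_of_cube_mem (T.odd_pow_mul_cube_mem (Odd.pow (by decide)))
  have h : ∀ j : ℕ, rconj (a ^ j) (a ^ 3 ^ e * b) = (a ^ 3 ^ e * b) ^ (q ^ j) := by
    intro j
    induction j with
    | zero => simp [rconj_apply]
    | succ j ih => rw [pow_succ, rconj_mul, ih, map_zpow, hc, ← zpow_mul, pow_succ, mul_comm]
  refine ⟨j, hj, ?_⟩
  rw [h, show q ^ j = ((3 ^ (e + 1) : ℕ) : ℤ) * w + (2 : ℕ) by push_cast; lia, zpow_add, zpow_mul,
    zpow_natCast, zpow_natCast, hce, one_zpow, one_mul]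

end TripartitePair

/-! ### Lifting from the quotient by the part prime to three. -/

theorem pow_three_pow_eq_one_of_mem {G : Type*} [Group G] {k : ℕ} (hk : ¬ 3 ∣ k) {g : G} {i : ℕ}
    (hg : g ^ 3 ^ i = 1) {W : Subgroup G}
    (hW : ∀ w ∈ W, w ^ k = 1) {l : ℕ} (h : g ^ 3 ^ l ∈ W) : g ^ 3 ^ l = 1 := by
  have h1 : orderOf (g ^ 3 ^ l) ∣ k := orderOf_dvd_of_pow_eq_one (hW _ h)
  have h2 : orderOf (g ^ 3 ^ l) ∣ 3 ^ i := orderOf_dvd_of_pow_eq_one (by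
    rw [pow_right_comm, hg, one_pow])
  have h3 : Nat.Coprime (3 ^ i) k := Nat.Coprime.pow_left _
    ((Nat.Prime.coprime_iff_not_dvd Nat.prime_three).2 hk)
  rw [← orderOf_eq_one_iff]
  exact Nat.eq_one_of_dvd_coprimes h3 h2 h1

namespace TripartitePair

section Power

variable {G : Type*} [Group G] {a b : G} {K : Subgroup G} {n : ℕ}

theorem a_pow_eq_one (T : TripartitePair a b K n) : a ^ (2 * n) = 1 := by
  rw [pow_mul, T.pow_eq_one]

theorem pow_pair (T : TripartitePair a b K n) {j : ℕ} (hj : j.Coprime (2 * n)) :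
    TripartitePair (a ^ j) b K n := by
  obtain ⟨i, hi⟩ := exists_pow_eq_self_of_coprime
    (hj.coprime_dvd_right (orderOf_dvd_of_pow_eq_one T.a_pow_eq_one))
  have hodd : Odd j := Nat.Coprime.odd_of_right (hj.coprime_dvd_right (dvd_mul_right 2 n))
  have hjn : IsCoprime (n : ℤ) (j : ℤ) :=
    (Nat.isCoprime_iff_coprime.2 (hj.coprime_dvd_right (dvd_mul_left n 2))).symm
  have hx : ∀ t : ℤ, ((a ^ j) ^ 2) ^ t = (a ^ 2) ^ (j * t) := fun t => by
    rw [pow_right_comm, ← zpow_natCast (a ^ 2) j, ← zpow_mul]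
  have hx' : ∀ t : ℤ, (a ^ 2) ^ t = ((a ^ j) ^ 2) ^ (i * t) := fun t => by
    rw [zpow_mul, zpow_natCast, pow_right_comm, hi]
  have hy : ∀ t : ℤ, rconj b ((a ^ j) ^ 2) ^ t = rconj b (a ^ 2) ^ (j * t) := fun t => by
    rw [← map_zpow, hx, map_zpow]
  have hy' : ∀ t : ℤ, rconj b (a ^ 2) ^ t = rconj b ((a ^ j) ^ 2) ^ (i * t) := fun t => by
    rw [← map_zpow, hx', map_zpow]
  exact
    { closure_eq := by
        rw [eq_top_iff, ← T.closure_eq, Subgroup.closure_le]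
        rintro s (rfl | rfl)
        · have := Subgroup.pow_mem _ (Subgroup.subset_closure (Set.mem_insert (s ^ j) {b})) i
          rwa [hi] at this
        · exact Subgroup.subset_closure (Set.mem_insert_of_mem _ rfl)
      b_mul_b := T.b_mul_b
      normal := T.normal
      mem_iff := fun g => by
        rw [T.mem_iff]
        constructor
        · rintro ⟨s, t, rfl⟩
          exact ⟨i * s, i * t, by rw [hx', hy']⟩
        · rintro ⟨s, t, rfl⟩
          exact ⟨j * s, j * t, by rw [hx, hy]⟩
      pow_eq_one := by rw [pow_right_comm _ j, pow_right_comm, T.pow_eq_one, one_pow]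
      dvd_of_eq_one := fun s t h => by
        rw [hx, hy] at h
        obtain ⟨h1, h2⟩ := T.dvd_of_eq_one _ _ h
        exact ⟨hjn.dvd_of_dvd_mul_left h1, hjn.dvd_of_dvd_mul_left h2⟩
      cube_mem := T.odd_pow_mul_cube_mem hodd
      pos := T.pos }

end Power

section Hall

variable {G : Type*} [Group G] {a b : G} {K : Subgroup G} {n e k : ℕ}
  (T : TripartitePair a b K n) (hn : n = 3 ^ e * k) (hk : ¬ 3 ∣ k)
include T hn hk

/-- Statements about elements of 3-power order are proved in this quotient and pulled back, since
the kernel has exponent dividing `k`, prime to three. -/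
theorem exists_hall_quotient : ∃ (W : Subgroup G) (_ : W.Normal),
    (∀ g, g ∈ W ↔ ∃ i j : ℤ, g = ((a ^ 2) ^ 3 ^ e) ^ i * (rconj b (a ^ 2) ^ 3 ^ e) ^ j) ∧
    (∀ w ∈ W, w ^ k = 1) ∧
    TripartitePair (QuotientGroup.mk' W a) (QuotientGroup.mk' W b)
      (K.map (QuotientGroup.mk' W)) (3 ^ e) := by
  obtain ⟨h1, h2⟩ := T.relations hn hk
  have hW : h1.span.Normal := T.normal_span h1
    (by rw [h2]; exact ⟨-1, -1, by rw [zpow_neg_one, zpow_neg_one]⟩)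
  refine ⟨h1.span, hW, fun g => h1.mem_span, ?_, T.map (by rw [hn, mul_comm]) _
    (QuotientGroup.mk'_surjective _) fun g => ?_⟩
  · rintro _ ⟨i, j, rfl⟩
    have hx : ((a ^ 2) ^ 3 ^ e) ^ k = 1 := by rw [← pow_mul, ← hn, T.pow_eq_one]
    have hy : (rconj b (a ^ 2) ^ 3 ^ e) ^ k = 1 := by rw [← map_pow, ← map_pow, hx, map_one]
    have hz : ∀ (w : G) (t : ℤ), w ^ k = 1 → (w ^ t) ^ k = 1 := fun w t hw => by
      rw [← zpow_natCast, ← zpow_mul, mul_comm, zpow_mul, zpow_natCast, hw, one_zpow]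
    rw [(h1.zpow_zpow i j).mul_pow, hz _ _ hx, hz _ _ hy, one_mul]
  · rw [← h1.mem_span, ← QuotientGroup.eq_one_iff]; rfl

/-- The Sylow `3`-subgroups have exponent dividing `3 ^ (e + 1)`. -/
theorem pow_three_pow_succ_eq_one {g : G} {i : ℕ} (hg : g ^ 3 ^ i = 1) :
    g ^ 3 ^ (e + 1) = 1 := by
  obtain ⟨W, hW, -, hWk, T'⟩ := T.exists_hall_quotient hn hk
  refine pow_three_pow_eq_one_of_mem hk hg hWk ?_
  rw [← QuotientGroup.eq_one_iff]
  change QuotientGroup.mk' W _ = 1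
  rw [map_pow]
  exact T'.pow_eq_one_of_cube_mem
    (T'.cube_mem_of_pow_eq_one (i := i) (by rw [← map_pow, hg, map_one]))

/-- In the quotient by `W` the element `a` has order dividing `2 * 3 ^ e`, so whether `a ^ j`
squares `c` modulo `W` depends only on `j` modulo `2 * 3 ^ e`. The same `j` serves to find good
generators and to construct automorphisms of `G₃`. -/
theorem exists_rconj_pow_eq {j j₀ : ℕ} (hj : j.Coprime (2 * n)) (hjj : j ≡ j₀ [MOD 2 * 3 ^ e])
    (h : ∃ p q : ℤ, rconj (a ^ j₀) (a ^ 3 ^ e * b) = (a ^ 3 ^ e * b) ^ 2 *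
      (((a ^ 2) ^ 3 ^ e) ^ p * (rconj b (a ^ 2) ^ 3 ^ e) ^ q)) :
    ∃ p q : ℤ, rconj (a ^ j) ((a ^ j) ^ 3 ^ e * b) = ((a ^ j) ^ 3 ^ e * b) ^ 2 *
        ((((a ^ j) ^ 2) ^ 3 ^ e) ^ p * (rconj b ((a ^ j) ^ 2) ^ 3 ^ e) ^ q) := by
  obtain ⟨W, hW, hmem, hWk, T'⟩ := T.exists_hall_quotient hn hk
  have hjc : rconj (QuotientGroup.mk' W a ^ j₀)
      (QuotientGroup.mk' W a ^ 3 ^ e * QuotientGroup.mk' W b) =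
      (QuotientGroup.mk' W a ^ 3 ^ e * QuotientGroup.mk' W b) ^ 2 := by
    obtain ⟨p, q, h⟩ := h
    have h1 := congrArg (QuotientGroup.mk' W) h
    have h2 : QuotientGroup.mk' W (((a ^ 2) ^ 3 ^ e) ^ p * (rconj b (a ^ 2) ^ 3 ^ e) ^ q) = 1 :=
      (QuotientGroup.eq_one_iff _).2 ((hmem _).2 ⟨p, q, rfl⟩)
    rwa [map_mul _ (_ ^ 2), h2, mul_one, map_rconj, map_pow, map_pow, map_mul, map_pow] at h1
  have hfa : QuotientGroup.mk' W a ^ (2 * 3 ^ e) = 1 := T'.a_pow_eq_one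
  have h1 : QuotientGroup.mk' W (a ^ j) = QuotientGroup.mk' W a ^ j₀ := by
    rw [map_pow]
    exact pow_eq_pow_iff_modEq.2 (hjj.of_dvd (orderOf_dvd_of_pow_eq_one hfa))
  have h2 : QuotientGroup.mk' W ((a ^ j) ^ 3 ^ e * b) =
      QuotientGroup.mk' W a ^ 3 ^ e * QuotientGroup.mk' W b := by
    obtain ⟨l, hl⟩ : Odd j := Nat.Coprime.odd_of_right (hj.coprime_dvd_right (dvd_mul_right 2 n))
    rw [map_mul, map_pow, map_pow, ← pow_mul, hl,
      show (2 * l + 1) * 3 ^ e = 2 * 3 ^ e * l + 3 ^ e by ring, pow_add, pow_mul, hfa, one_pow,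
      one_mul]
  have h3 : (((a ^ j) ^ 3 ^ e * b) ^ 2)⁻¹ * rconj (a ^ j) ((a ^ j) ^ 3 ^ e * b) ∈ W := by
    rw [← QuotientGroup.eq]
    change QuotientGroup.mk' W _ = QuotientGroup.mk' W _
    rw [map_pow, map_rconj, h2, h1, hjc]
  obtain ⟨s, t, hst⟩ := (hmem _).1 h3
  obtain ⟨i, hi⟩ := exists_pow_eq_self_of_coprime
    (hj.coprime_dvd_right (orderOf_dvd_of_pow_eq_one T.a_pow_eq_one))
  refine ⟨i * s, i * t, ?_⟩
  rw [inv_mul_eq_iff_eq_mul.1 hst]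
  have hx : (((a ^ j) ^ 2) ^ 3 ^ e) ^ i = (a ^ 2) ^ 3 ^ e := by
    rw [pow_right_comm _ (3 ^ e), pow_right_comm _ 2, hi]
  congr 2
  · rw [zpow_mul, zpow_natCast, hx]
  · rw [← map_pow, ← map_pow, ← map_zpow, ← map_zpow, zpow_mul, zpow_natCast, hx]

theorem exists_coprime_rconj_eq (he : 1 ≤ e) {g : G} {i : ℕ} (hg : g ^ 3 ^ i = 1)
    (hge : g ^ 3 ^ e ≠ 1) :
    ∃ j : ℕ, j.Coprime (2 * n) ∧ ∃ p q : ℤ, rconj (a ^ j) ((a ^ j) ^ 3 ^ e * b) =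
      ((a ^ j) ^ 3 ^ e * b) ^ 2 *
        ((((a ^ j) ^ 2) ^ 3 ^ e) ^ p * (rconj b ((a ^ j) ^ 2) ^ 3 ^ e) ^ q) := by
  obtain ⟨W, hW, hmem, hWk, T'⟩ := T.exists_hall_quotient hn hk
  obtain ⟨j₀, hj₀, hjc⟩ := T'.exists_coprime_rconj_eq_sq he (g := QuotientGroup.mk' W g) (i := i)
    (by rw [← map_pow, hg, map_one]) (fun h => hge (by
      rw [← map_pow] at h
      exact pow_three_pow_eq_one_of_mem hk hg hWk ((QuotientGroup.eq_one_iff _).1 h)))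
  -- The exponent found in the quotient is a unit modulo `2 * 3 ^ e`; it lifts to a unit modulo `2 *
  -- n`, so that `a ^ j` still generates `⟨a⟩`.
  obtain ⟨j, hj, hjj⟩ : ∃ j : ℕ, j.Coprime (2 * n) ∧ j ≡ j₀ [MOD 2 * 3 ^ e] := by
    have hd : 2 * 3 ^ e ∣ 2 * n := mul_dvd_mul_left 2 (Dvd.intro k hn.symm)
    have : NeZero (2 * n) := ⟨by have := T.pos; lia⟩
    obtain ⟨j, hj⟩ := ZMod.unitsMap_surjective hd (ZMod.unitOfCoprime j₀ hj₀)
    refine ⟨(j : ZMod (2 * n)).val, ZMod.val_coe_unit_coprime j, ?_⟩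
    rw [← ZMod.natCast_eq_natCast_iff]
    have h := congrArg Units.val hj
    rw [ZMod.unitsMap_val, ZMod.coe_unitOfCoprime] at h
    rw [← h, ZMod.natCast_val]
  refine ⟨j, hj, T.exists_rconj_pow_eq hn hk hj hjj ?_⟩
  have h1 : ((a ^ 3 ^ e * b) ^ 2)⁻¹ * rconj (a ^ j₀) (a ^ 3 ^ e * b) ∈ W := by
    rw [← QuotientGroup.eq]
    change QuotientGroup.mk' W _ = QuotientGroup.mk' W _
    rw [map_pow, map_rconj, map_mul, map_pow, map_pow, hjc]
  obtain ⟨p, q, hpq⟩ := (hmem _).1 h1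
  exact ⟨p, q, inv_mul_eq_iff_eq_mul.1 hpq⟩

end Hall

end TripartitePair

/-- An element killed by `1 + g + g ^ 2` drops out of the cube of `g * w`, so only exponents modulo
three matter. -/
theorem mul_pow_of_sum_eq_one {G : Type*} [Group G] {g w : G}
    (h : rconj g (rconj g w) * rconj g w * w = 1) (t : ℕ) :
    (g * w) ^ (3 * t + 1) = g ^ (3 * t + 1) * w := by
  have h3 : (g * w) ^ 3 = g ^ 3 := by
    have : (g * w) ^ 3 = g ^ 3 * (rconj g (rconj g w) * rconj g w * w) := by
      simp only [rconj_apply, pow_succ, pow_zero]; group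
    rw [this, h, mul_one]
  rw [pow_succ, pow_mul, h3, pow_succ g (3 * t), pow_mul, mul_assoc]

namespace TripartitePair

section Relators

variable {G : Type*} [Group G] {a b : G} {K : Subgroup G} {n e k : ℕ}
  (T : TripartitePair a b K n) (hn : n = 3 ^ e * k) (hk : ¬ 3 ∣ k)
include T hn hk

theorem rconj_c_x_pow {N : ℕ} (hN : Odd N) :
    rconj (a ^ N * b) ((a ^ 2) ^ 3 ^ e) = rconj b (a ^ 2) ^ 3 ^ e := by
  rw [rconj_mul, rconj_odd_pow (T.commute_x_pow hn hk T.x_mem) hN, map_pow,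
    rconj_a_x, map_pow]

theorem rconj_c_y_pow {N : ℕ} (hN : Odd N) : rconj (a ^ N * b) (rconj b (a ^ 2) ^ 3 ^ e) =
    (rconj b (a ^ 2) ^ 3 ^ e)⁻¹ * ((a ^ 2) ^ 3 ^ e)⁻¹ := by
  rw [rconj_mul, rconj_odd_pow (T.commute_y_pow hn hk T.x_mem) hN,
    (T.relations hn hk).2, map_mul, map_inv, map_inv, map_pow _ (a ^ 2),
    map_pow _ (rconj b (a ^ 2)), T.rconj_b_rconj_b]

theorem rconj_c_zpow_mul_zpow {N : ℕ} (hN : Odd N) (i j : ℤ) :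
    rconj (a ^ N * b) (((a ^ 2) ^ 3 ^ e) ^ i * (rconj b (a ^ 2) ^ 3 ^ e) ^ j) =
      ((a ^ 2) ^ 3 ^ e) ^ (-j) * (rconj b (a ^ 2) ^ 3 ^ e) ^ (i - j) := by
  have hc := (T.relations hn hk).1
  rw [map_mul, map_zpow, map_zpow, T.rconj_c_x_pow hn hk hN, T.rconj_c_y_pow hn hk hN,
    hc.symm.inv_inv.mul_zpow, inv_zpow', inv_zpow', ← mul_assoc, ← zpow_add,
    (hc.zpow_zpow _ _).eq, sub_eq_add_neg]

theorem rconj_a_zpow_mul_zpow (i j : ℤ) :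
    rconj a (((a ^ 2) ^ 3 ^ e) ^ i * (rconj b (a ^ 2) ^ 3 ^ e) ^ j) =
      ((a ^ 2) ^ 3 ^ e) ^ (i - j) * (rconj b (a ^ 2) ^ 3 ^ e) ^ (-j) := by
  obtain ⟨hc, h⟩ := T.relations hn hk
  rw [map_mul, map_zpow, map_zpow, h, map_pow, rconj_a_x, hc.inv_inv.mul_zpow, inv_zpow',
    inv_zpow', ← mul_assoc, ← zpow_add, sub_eq_add_neg]

/-- The power lies in `W` and is fixed by `a ^ N * b`, which acts there without nontrivial fixed
points: a fixed vector satisfies `r + s = 0` and `3 * s = 0` modulo `k`, and `k` is prime to three.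
-/
theorem odd_pow_mul_pow_eq_one {N : ℕ} (hN : Odd N) : (a ^ N * b) ^ 3 ^ (e + 1) = 1 := by
  obtain ⟨W, hW, hmem, hWk, T'⟩ := T.exists_hall_quotient hn hk
  have h1 : (a ^ N * b) ^ 3 ^ (e + 1) ∈ W := by
    rw [← QuotientGroup.eq_one_iff]
    change QuotientGroup.mk' W _ = 1
    rw [map_pow, map_mul, map_pow]
    exact T'.pow_eq_one_of_cube_mem (T'.odd_pow_mul_cube_mem hN)
  obtain ⟨r, s, hrs⟩ := (hmem _).1 h1
  have h2 := T.rconj_c_zpow_mul_zpow hn hk hN r s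
  rw [← hrs, (rconj_eq_self_iff _ _).2 ((Commute.refl _).pow_left _), hrs] at h2
  have hn' : n = k * 3 ^ e := by rw [hn, mul_comm]
  have hc := (T.relations hn hk).1
  have h3 : ((a ^ 2) ^ 3 ^ e) ^ (r + s) * (rconj b (a ^ 2) ^ 3 ^ e) ^ (s - (r - s)) = 1 := by
    rw [show r + s = r + -(-s) by ring, sub_eq_add_neg s, ← hc.zpow_mul_zpow_mul, h2,
      hc.zpow_mul_zpow_mul]
    simp
  obtain ⟨h4, h5⟩ := T.dvd_of_x_pow_zpow hn' h3
  have hk3 : IsCoprime (k : ℤ) 3 := by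
    have := Nat.isCoprime_iff_coprime.2 ((Nat.Prime.coprime_iff_not_dvd Nat.prime_three).2 hk)
    exact_mod_cast this.symm
  have h6 : (k : ℤ) ∣ s := hk3.dvd_of_dvd_mul_left (by
    rw [show 3 * s = (r + s) + (s - (r - s)) by ring]; exact dvd_add h4 h5)
  have h7 : (k : ℤ) ∣ r := (dvd_add_left h6).1 h4
  rw [hrs, T.x_pow_zpow_eq hn' (j := 0) (by rwa [sub_zero]),
    T.y_pow_zpow_eq hn' (j := 0) (by rwa [sub_zero])]
  simp

/-- Conjugation of `c` by `a ^ 3 ^ e` is computed twice: directly it gives `c⁻¹ * X`, and iterating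
the assumed formula gives `c⁻¹` times powers of `X` and `Y` depending on `p` and `q`. Comparing
exponents determines `p` and `q` modulo `k`. -/
theorem exponents_of_rconj_eq {p q : ℤ}
    (h : rconj a (a ^ 3 ^ e * b) = (a ^ 3 ^ e * b) ^ 2 *
      (((a ^ 2) ^ 3 ^ e) ^ p * (rconj b (a ^ 2) ^ 3 ^ e) ^ q)) {l : ℕ} (hl : 3 ^ e = 2 * l + 1) :
    (k : ℤ) ∣ 3 ^ e * p - 1 ∧ (k : ℤ) ∣ q + l * p := by
  have hc := (T.relations hn hk).1
  have hce := T.odd_pow_mul_pow_eq_one hn hk (N := 3 ^ e) (Odd.pow (by decide))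
  have hrc := T.rconj_c_zpow_mul_zpow hn hk (N := 3 ^ e) (Odd.pow (by decide))
  have hra := T.rconj_a_zpow_mul_zpow hn hk
  have hn' : n = k * 3 ^ e := by rw [hn, mul_comm]
  have hdvd : ∀ i j : ℤ, ((a ^ 2) ^ 3 ^ e) ^ i * (rconj b (a ^ 2) ^ 3 ^ e) ^ j = 1 →
    (k : ℤ) ∣ i ∧ (k : ℤ) ∣ j := fun i j h => T.dvd_of_x_pow_zpow hn' h
  have hfin : rconj (a ^ 3 ^ e) (a ^ 3 ^ e * b) = (a ^ 3 ^ e * b)⁻¹ * (a ^ 2) ^ 3 ^ e := by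
    rw [rconj_apply, inv_mul_cancel_left, mul_inv_rev, T.b_inv, pow_two, (Commute.refl a).mul_pow]
    simp only [mul_assoc, inv_mul_cancel_left]
  set c := a ^ 3 ^ e * b with hcdef
  set X := (a ^ 2) ^ 3 ^ e with hX
  set Y := rconj b (a ^ 2) ^ 3 ^ e with hY
  have hmul := hc.zpow_mul_zpow_mul
  have hsq : ∀ i j : ℤ, rconj (c ^ 2) (X ^ i * Y ^ j) = X ^ (j - i) * Y ^ (-i) := fun i j => by
    rw [pow_two, rconj_mul, hrc, hrc]
    congr 2 <;> ring
  have h4 : ∀ i j : ℤ, rconj (c ^ 4) (X ^ i * Y ^ j) = X ^ (-j) * Y ^ (i - j) := fun i j => by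
    rw [show 4 = 2 + 2 by norm_num, pow_add, rconj_mul, hsq, hsq]
    congr 2 <;> ring
  have hx : rconj (a ^ 2) c = c ^ 4 * (X ^ p * Y ^ (-p)) := by
    have h5 : X ^ p * Y ^ q * c ^ 2 = c ^ 2 * rconj (c ^ 2) (X ^ p * Y ^ q) := by
      rw [rconj_apply]; group
    rw [pow_two, rconj_mul, h, map_mul, map_pow, h, hra, pow_two (c ^ 2 * _), mul_assoc (c ^ 2),
      ← mul_assoc _ (c ^ 2), h5, hsq, mul_assoc (c ^ 2) _ (X ^ p * Y ^ q), hmul,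
      ← mul_assoc (c ^ 2) (c ^ 2),
      ← pow_add, mul_assoc, hmul]
    congr 3 <;> ring
  -- Powers of four are `1` modulo three, and the factor in `W` is killed by `1 + c ^ 4 + c ^ 8`. So
  -- it is not multiplied when the formula is raised to the power `4 ^ i`.
  have hxv : ∀ i : ℕ, rconj ((a ^ 2) ^ i) c = c ^ 4 ^ i * (X ^ (p * i) * Y ^ (-p * i)) := by
    intro i
    induction i with
    | zero => simp [rconj_apply]
    | succ i ih =>
      obtain ⟨t, ht⟩ : ∃ t, 4 ^ i = 3 * t + 1 := by
        have : 4 ^ i % 3 = 1 := by rw [Nat.pow_mod]; simp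
        exact ⟨4 ^ i / 3, by lia⟩
      rw [pow_succ (a ^ 2), rconj_mul, ih, map_mul, map_pow, hx, ht, mul_pow_of_sum_eq_one]
      · rw [pow_two, rconj_mul, hra, hra, ← ht, ← pow_mul, mul_assoc, hmul, pow_succ']
        congr 3 <;> push_cast <;> ring
      · rw [h4, h4, hmul, hmul]
        simp only [neg_neg]
        ring_nf
        simp
  obtain ⟨t, ht⟩ : ∃ t, 4 ^ l = 3 * t + 1 := by
    have : 4 ^ l % 3 = 1 := by rw [Nat.pow_mod]; simp
    exact ⟨4 ^ l / 3, by lia⟩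
  -- The exponent is `2 ^ 3 ^ e`, which is `-1` modulo `3 ^ (e + 1)`.
  have hc2 : c ^ (2 * 4 ^ l) = c⁻¹ := by
    obtain ⟨w, hw⟩ := three_pow_succ_dvd_pow_add_one (q := 2) (by norm_num) e
    rw [eq_inv_iff_mul_eq_one, ← pow_succ]
    have h5 : 2 * 4 ^ l = 2 ^ 3 ^ e := by
      rw [hl, pow_succ, pow_mul]; norm_num [mul_comm]
    rw [h5, ← zpow_natCast]
    push_cast
    rw [hw, show ((3 : ℤ) ^ (e + 1)) = ((3 ^ (e + 1) : ℕ) : ℤ) by push_cast; rfl, zpow_mul,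
      zpow_natCast, hce, one_zpow]
  have hm : rconj (a ^ 3 ^ e) c = c⁻¹ * (X ^ (p + 2 * (p * l)) * Y ^ (q + p * l)) := by
    rw [hl, pow_succ, pow_mul, rconj_mul, hxv, map_mul, map_pow, h, ht, mul_pow_of_sum_eq_one]
    · rw [hra, ← ht, ← pow_mul, hc2, mul_assoc, hmul]
      congr 3 <;> ring
    · rw [hsq, hsq, hmul, hmul]
      ring_nf
      simp
  rw [hfin] at hm
  have h5 : X ^ (p + 2 * (p * l) - 1) * Y ^ (q + p * l) = 1 := by
    have h6 := mul_left_cancel hm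
    rw [sub_eq_neg_add, zpow_add, mul_assoc, ← h6]
    simp
  obtain ⟨h6, h7⟩ := hdvd _ _ h5
  refine ⟨?_, by rwa [mul_comm (l : ℤ)]⟩
  have h8 : (3 : ℤ) ^ e = 2 * l + 1 := by exact_mod_cast hl
  rw [h8]
  convert h6 using 1
  ring

theorem rconj_a_c_eq {p q : ℤ}
    (h : rconj a (a ^ 3 ^ e * b) = (a ^ 3 ^ e * b) ^ 2 *
      (((a ^ 2) ^ 3 ^ e) ^ p * (rconj b (a ^ 2) ^ 3 ^ e) ^ q)) {u : ℤ}
    (hu : u * 3 ^ e ≡ 1 [ZMOD k]) :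
    rconj a (a ^ 3 ^ e * b) = (a ^ 3 ^ e * b) ^ 2 * ((a ^ 2) ^ 3 ^ e) ^ u *
      (rconj b (a ^ 2) ^ 3 ^ e) ^ ((1 - 3 ^ e) / 2 * u) := by
  obtain ⟨l, hl⟩ : Odd (3 ^ e) := Odd.pow (by decide)
  have hn' : n = k * 3 ^ e := by rw [hn, mul_comm]
  obtain ⟨h1, h2⟩ := T.exponents_of_rconj_eq hn hk h hl
  have hl' : (3 : ℤ) ^ e = 2 * l + 1 := by exact_mod_cast hl
  have hd : (1 - (3 : ℤ) ^ e) / 2 = -l := by rw [hl']; lia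
  have hu' : (k : ℤ) ∣ u * 3 ^ e - 1 := hu.symm.dvd
  have h3 : (k : ℤ) ∣ p - u := by
    rw [show p - u = u * (3 ^ e * p - 1) - p * (u * 3 ^ e - 1) by ring]
    exact dvd_sub (h1.mul_left _) (hu'.mul_left _)
  rw [h, hd, mul_assoc, T.x_pow_zpow_eq hn' h3, T.y_pow_zpow_eq hn' (j := -l * u)]
  rw [show q - -l * u = (q + l * p) - l * (p - u) by ring]
  exact dvd_sub h2 (h3.mul_left _)

end Relators

end TripartitePair

/-! ### Orders: recognising tripartite pairs, and an upper bound for `G₃`. -/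

namespace TripartitePair

/-- A group of order at most `6 * n ^ 2` with suitable generators is given by a tripartite pair. -/
theorem of_card_le {G S : Type*} [Group G] [Group S] [Finite G] {a b : G} {n : ℕ} (τ : G →* S)
    (hcl : Subgroup.closure {a, b} = ⊤) (hb : b * b = 1) (hn : 0 < n) (hx : (a ^ 2) ^ n = 1)
    (hdvd : ∀ i j : ℤ, (a ^ 2) ^ i * rconj b (a ^ 2) ^ j = 1 → (n : ℤ) ∣ i ∧ (n : ℤ) ∣ j)
    (ha : τ a ^ 2 = 1) (hb1 : τ b ≠ 1) (hab3 : τ (a * b) ^ 3 = 1) (hab : τ (a * b) ≠ 1)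
    (hcard : Nat.card G ≤ 6 * n ^ 2) :
    TripartitePair a b τ.ker n ∧ Nat.card G = 6 * n ^ 2 := by
  have : NeZero n := ⟨hn.ne'⟩
  have hxm : a ^ 2 ∈ τ.ker := by rw [MonoidHom.mem_ker, map_pow, ha]
  have hym : rconj b (a ^ 2) ∈ τ.ker := by
    rw [MonoidHom.mem_ker, map_rconj, MonoidHom.mem_ker.1 hxm, map_one]
  let F : ZMod n × ZMod n → τ.ker := fun z =>
    ⟨(a ^ 2) ^ (z.1.val : ℤ) * rconj b (a ^ 2) ^ (z.2.val : ℤ),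
      mul_mem (zpow_mem hxm _) (zpow_mem hym _)⟩
  have hF : Function.Injective F := by
    rintro ⟨i, j⟩ ⟨i', j'⟩ h
    have h1 : (a ^ 2) ^ (i.val : ℤ) * rconj b (a ^ 2) ^ (j.val : ℤ) =
      (a ^ 2) ^ (i'.val : ℤ) * rconj b (a ^ 2) ^ (j'.val : ℤ) := congrArg Subtype.val h
    have h2 : (a ^ 2) ^ ((i.val : ℤ) - i'.val) * rconj b (a ^ 2) ^ ((j.val : ℤ) - j'.val) = 1 := by
      rw [sub_eq_neg_add, zpow_add, sub_eq_add_neg, zpow_add, mul_assoc,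
        ← mul_assoc ((a ^ 2) ^ (i.val : ℤ)), h1]
      group
    obtain ⟨h3, h4⟩ := hdvd _ _ h2
    have hz : ∀ s t : ZMod n, (n : ℤ) ∣ (s.val : ℤ) - t.val → s = t := fun s t h => by
      rw [← ZMod.intCast_zmod_eq_zero_iff_dvd] at h
      simpa [sub_eq_zero] using h
    rw [hz _ _ h3, hz _ _ h4]
  have hle : n ^ 2 ≤ Nat.card τ.ker := by
    have := Nat.card_le_card_of_injective F hF
    rwa [Nat.card_prod, Nat.card_zmod, ← pow_two] at this
  have hprod : Nat.card τ.ker * Nat.card τ.range = Nat.card G := by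
    rw [← Subgroup.index_ker, Subgroup.card_mul_index]
  -- The image contains elements of orders two and three, and the kernel contains `n ^ 2` distinct
  -- products, so the upper bound on the order makes both counts exact.
  have hsix : 6 ≤ Nat.card τ.range := by
    have : Finite τ.range := Finite.of_surjective _ τ.rangeRestrict_surjective
    have h2 : orderOf (τ.rangeRestrict b) = 2 := by
      rw [← Subgroup.orderOf_coe, MonoidHom.coe_rangeRestrict]
      exact orderOf_eq_prime (by rw [pow_two, ← map_mul, hb, map_one]) hb1
    have h3 : orderOf (τ.rangeRestrict (a * b)) = 3 := by
      rw [← Subgroup.orderOf_coe, MonoidHom.coe_rangeRestrict]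
      exact orderOf_eq_prime hab3 hab
    have h4 : 2 * 3 ∣ Nat.card τ.range :=
      Nat.Coprime.mul_dvd_of_dvd_of_dvd (by norm_num) (h2 ▸ orderOf_dvd_natCard _)
        (h3 ▸ orderOf_dvd_natCard _)
    exact Nat.le_of_dvd Nat.card_pos h4
  have hK : Nat.card τ.ker ≤ n ^ 2 := by
    have := Nat.mul_le_mul_left (Nat.card τ.ker) hsix
    lia
  have hG : Nat.card G = 6 * n ^ 2 := le_antisymm hcard (by
    rw [← hprod, mul_comm]; exact Nat.mul_le_mul hle hsix)
  have hFs : Function.Surjective F := by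
    refine ((Nat.bijective_iff_injective_and_card F).2 ⟨hF, ?_⟩).2
    rw [Nat.card_prod, Nat.card_zmod, ← pow_two]
    exact le_antisymm hle hK
  refine ⟨⟨hcl, hb, inferInstance, fun g => ⟨fun hg => ?_, ?_⟩, hx, hdvd, ?_, hn⟩, hG⟩
  · obtain ⟨⟨i, j⟩, h⟩ := hFs ⟨g, hg⟩
    exact ⟨i.val, j.val, (congrArg Subtype.val h).symm⟩
  · rintro ⟨i, j, rfl⟩
    exact mul_mem (zpow_mem hxm _) (zpow_mem hym _)
  · rw [MonoidHom.mem_ker, map_pow, hab3]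

end TripartitePair

namespace G₃

theorem lift_eq_one {k e : ℕ} {u : ℤ} {G : Type*} [Group G] {a b : G}
    (h1 : a ^ (2 * 3 ^ e * k) = 1) (h2 : b * b = 1)
    (h3 : Commute (a ^ (2 * 3 ^ e)) (rconj b (a ^ (2 * 3 ^ e))))
    (h4 : (a ^ 3 ^ e * b) ^ 3 ^ (e + 1) = 1)
    (h5 : rconj a (rconj b (a ^ (2 * 3 ^ e))) =
      (a ^ (2 * 3 ^ e))⁻¹ * (rconj b (a ^ (2 * 3 ^ e)))⁻¹)
    (h6 : rconj a (a ^ 3 ^ e * b) = (a ^ 3 ^ e * b) ^ 2 * (a ^ (2 * 3 ^ e)) ^ u *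
      (rconj b (a ^ (2 * 3 ^ e))) ^ ((1 - 3 ^ e) / 2 * u)) :
    ∀ r ∈ relators₃ k e u, FreeGroup.lift ![a, b] r = 1 := by
  simp only [rconj_apply] at h3 h5 h6
  intro r hr
  simp only [relators₃, Set.mem_insert_iff, Set.mem_singleton_iff] at hr
  rcases hr with rfl | rfl | rfl | rfl | rfl | rfl <;>
    simp only [map_mul, map_inv, map_pow, map_zpow, FreeGroup.lift_apply_of, Matrix.cons_val_zero,
      Matrix.cons_val_one]
  · exact h1
  · rw [pow_two, h2]
  · rw [mul_assoc, ← h3.eq.symm]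
    group
  · exact h4
  · rw [h5, mul_inv_cancel]
  · rw [h6, mul_inv_cancel]

section Relations

variable (k e : ℕ) (u : ℤ)

theorem b_inv : (b k e u)⁻¹ = b k e u := inv_eq_of_mul_eq_one_left (b_mul_b k e u)

theorem closure_a_b : Subgroup.closure {a k e u, b k e u} = ⊤ := by
  rw [eq_top_iff, ← PresentedGroup.closure_range_of, Subgroup.closure_le]
  rintro _ ⟨i, rfl⟩
  fin_cases i
  · exact Subgroup.subset_closure (Set.mem_insert _ _)
  · exact Subgroup.subset_closure (Set.mem_insert_of_mem _ rfl)

theorem mk_of_zero : PresentedGroup.mk (relators₃ k e u) (FreeGroup.of 0) = a k e u := rfl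

theorem mk_of_one : PresentedGroup.mk (relators₃ k e u) (FreeGroup.of 1) = b k e u := rfl

theorem commute_x_y :
    Commute (a k e u ^ (2 * 3 ^ e)) (rconj (b k e u) (a k e u ^ (2 * 3 ^ e))) := by
  have h : PresentedGroup.mk (relators₃ k e u) _ = 1 :=
    PresentedGroup.one_of_mem (Set.mem_insert_of_mem _ (Set.mem_insert_of_mem _
      (Set.mem_insert _ _)))
  simp only [map_mul, map_inv, map_pow, mk_of_zero, mk_of_one] at h
  rw [rconj_apply]
  generalize (b k e u)⁻¹ * a k e u ^ (2 * 3 ^ e) * b k e u = y at h ⊢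
  rw [← mul_inv_rev, mul_assoc, inv_mul_eq_one] at h
  exact h.symm

theorem c_pow : (a k e u ^ 3 ^ e * b k e u) ^ 3 ^ (e + 1) = 1 := by
  have h : PresentedGroup.mk (relators₃ k e u) _ = 1 :=
    PresentedGroup.one_of_mem (Set.mem_insert_of_mem _ (Set.mem_insert_of_mem _
      (Set.mem_insert_of_mem _ (Set.mem_insert _ _))))
  simpa only [map_mul, map_inv, map_pow, mk_of_zero, mk_of_one] using h

theorem rconj_a_y : rconj (a k e u) (rconj (b k e u) (a k e u ^ (2 * 3 ^ e))) =
    (a k e u ^ (2 * 3 ^ e))⁻¹ * (rconj (b k e u) (a k e u ^ (2 * 3 ^ e)))⁻¹ := by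
  have h : PresentedGroup.mk (relators₃ k e u) _ = 1 :=
    PresentedGroup.one_of_mem (Set.mem_insert_of_mem _ (Set.mem_insert_of_mem _
      (Set.mem_insert_of_mem _ (Set.mem_insert_of_mem _ (Set.mem_insert _ _)))))
  simp only [map_mul, map_inv, map_pow, mk_of_zero, mk_of_one] at h
  rw [rconj_apply, rconj_apply]
  exact mul_inv_eq_one.1 h

theorem rconj_a_c : rconj (a k e u) (a k e u ^ 3 ^ e * b k e u) =
    (a k e u ^ 3 ^ e * b k e u) ^ 2 * (a k e u ^ (2 * 3 ^ e)) ^ u *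
      (rconj (b k e u) (a k e u ^ (2 * 3 ^ e))) ^ ((1 - 3 ^ e) / 2 * u) := by
  have h : PresentedGroup.mk (relators₃ k e u) _ = 1 :=
    PresentedGroup.one_of_mem (Set.mem_insert_of_mem _ (Set.mem_insert_of_mem _
      (Set.mem_insert_of_mem _ (Set.mem_insert_of_mem _ (Set.mem_insert_of_mem _
        (Set.mem_singleton _))))))
  simp only [map_mul, map_inv, map_pow, map_zpow, mk_of_zero, mk_of_one] at h
  rw [mul_inv_eq_one] at h
  rw [rconj_apply, rconj_apply]
  exact h

end Relations

end G₃

namespace TripartitePair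

theorem lift_relators_eq_one {G : Type*} [Group G] {a b : G} {K : Subgroup G} {n e k : ℕ}
    (T : TripartitePair a b K n) (hn : n = 3 ^ e * k) (hk : ¬ 3 ∣ k) {p q : ℤ}
    (h : rconj a (a ^ 3 ^ e * b) = (a ^ 3 ^ e * b) ^ 2 *
      (((a ^ 2) ^ 3 ^ e) ^ p * (rconj b (a ^ 2) ^ 3 ^ e) ^ q)) {u : ℤ}
    (hu : u * 3 ^ e ≡ 1 [ZMOD k]) : ∀ r ∈ relators₃ k e u, FreeGroup.lift ![a, b] r = 1 := by
  obtain ⟨h1, h2⟩ := T.relations hn hk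
  have h3 := T.rconj_a_c_eq hn hk h hu
  have h4 := T.a_pow_eq_one
  rw [hn, ← mul_assoc] at h4
  rw [← map_pow, ← pow_mul] at h1 h2 h3
  exact G₃.lift_eq_one h4 T.b_mul_b h1 (T.odd_pow_mul_pow_eq_one hn hk (Odd.pow (by decide))) h2 h3

end TripartitePair

namespace G₃

section Finiteness

open scoped Pointwise

variable (k e : ℕ) (u : ℤ)

/-- `⟨X, Y⟩` is normal, so is its product with `⟨c⟩`, and multiplying by `⟨a⟩` gives everything.
Since `a ^ (2 * 3 ^ e) = X`, only `2 * 3 ^ e` powers of `a` are needed, for a total of `k * k * 3 ^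
(e + 1) * (2 * 3 ^ e)`. -/
theorem finite_and_card_le (hk : 0 < k) :
    Finite (G₃ k e u) ∧ Nat.card (G₃ k e u) ≤ 6 * (3 ^ e * k) ^ 2 := by
  have hc := commute_x_y k e u
  have hay := rconj_a_y k e u
  have hac := rconj_a_c k e u
  have hce := c_pow k e u
  have hcl := closure_a_b k e u
  have hxk : (a k e u ^ (2 * 3 ^ e)) ^ k = 1 := by rw [← pow_mul, a_pow]
  have hbc : rconj (b k e u) (a k e u ^ 3 ^ e * b k e u) =
      (a k e u ^ 3 ^ e * b k e u)⁻¹ * a k e u ^ (2 * 3 ^ e) := by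
    rw [rconj_apply, mul_inv_rev, b_inv, two_mul, pow_add]
    simp only [mul_assoc, b_mul_b, mul_one, inv_mul_cancel_left]
  have hbb : ∀ g, rconj (b k e u) (rconj (b k e u) g) = g := fun g => by
    rw [← rconj_mul, b_mul_b]; simp [rconj_apply]
  have hax : rconj (a k e u) (a k e u ^ (2 * 3 ^ e)) = a k e u ^ (2 * 3 ^ e) := by
    rw [rconj_eq_self_iff]; exact (Commute.refl _).pow_left _
  have hyk : rconj (b k e u) (a k e u ^ (2 * 3 ^ e)) ^ k = 1 := by rw [← map_pow, hxk, map_one]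
  have hsplit : ∀ l : ℕ, a k e u ^ l = (a k e u ^ (2 * 3 ^ e)) ^ (l / (2 * 3 ^ e)) *
      a k e u ^ (l % (2 * 3 ^ e)) := fun l => by rw [← pow_mul, ← pow_add, Nat.div_add_mod]
  have hapos : IsOfFinOrder (a k e u) :=
    isOfFinOrder_iff_pow_eq_one.2 ⟨_, by positivity, a_pow k e u⟩
  set X := a k e u ^ (2 * 3 ^ e)
  set Y := rconj (b k e u) X with hY
  set c := a k e u ^ 3 ^ e * b k e u with hcdef
  have hXf : IsOfFinOrder X := isOfFinOrder_iff_pow_eq_one.2 ⟨k, hk, hxk⟩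
  have hYf : IsOfFinOrder Y := isOfFinOrder_iff_pow_eq_one.2 ⟨k, hk, hyk⟩
  have hcf : IsOfFinOrder c := isOfFinOrder_iff_pow_eq_one.2 ⟨_, by positivity, hce⟩
  have hXm : X ∈ hc.span := ⟨1, 0, by simp⟩
  have hYm : Y ∈ hc.span := ⟨0, 1, by simp⟩
  have hWfin : Finite hc.span := hc.finite_span hXf hYf
  have hW : hc.span.Normal := by
    refine normal_of_rconj_mem hcl _ ?_
    rintro s (rfl | rfl) _ ⟨i, j, rfl⟩
    · rw [map_mul, map_zpow, map_zpow, hax, hay]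
      exact mul_mem (zpow_mem hXm _) (zpow_mem (mul_mem (inv_mem hXm) (inv_mem hYm)) _)
    · rw [map_mul, map_zpow, map_zpow, hbb, ← hY]
      exact mul_mem (zpow_mem hYm _) (zpow_mem hXm _)
  have hNcoe : ((hc.span ⊔ Subgroup.zpowers c : Subgroup (G₃ k e u)) : Set (G₃ k e u)) =
      (hc.span : Set (G₃ k e u)) * (Subgroup.zpowers c : Set (G₃ k e u)) :=
    Subgroup.normal_mul _ _
  have hcm : c ∈ hc.span ⊔ Subgroup.zpowers c := Subgroup.mem_sup_right (Subgroup.mem_zpowers c)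
  have hXm' : X ∈ hc.span ⊔ Subgroup.zpowers c := Subgroup.mem_sup_left hXm
  have hYm' : Y ∈ hc.span ⊔ Subgroup.zpowers c := Subgroup.mem_sup_left hYm
  have hNfin : Finite ↥(hc.span ⊔ Subgroup.zpowers c) := by
    have : ((hc.span ⊔ Subgroup.zpowers c : Subgroup (G₃ k e u)) : Set (G₃ k e u)).Finite := by
      rw [hNcoe]
      exact Set.Finite.mul (Set.toFinite _) hcf.finite_zpowers
    exact this.to_subtype
  have hN : (hc.span ⊔ Subgroup.zpowers c).Normal := by
    refine normal_of_rconj_mem hcl _ ?_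
    intro s hs g hg
    obtain ⟨w, hw, _, ⟨t, rfl⟩, rfl⟩ := Subgroup.mem_sup_of_normal_left.1 hg
    have h1 : rconj s w ∈ hc.span := by
      have := hW.conj_mem w hw s⁻¹
      rwa [inv_inv, ← rconj_apply] at this
    simp only [map_mul, map_zpow]
    refine mul_mem (Subgroup.mem_sup_left h1) (zpow_mem ?_ _)
    rcases hs with rfl | rfl
    · rw [hac]
      exact mul_mem (mul_mem (pow_mem hcm _) (zpow_mem hXm' _)) (zpow_mem hYm' _)
    · rw [hbc]
      exact mul_mem (inv_mem hcm) hXm'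
  have htop : (hc.span ⊔ Subgroup.zpowers c) ⊔ Subgroup.zpowers (a k e u) = ⊤ := by
    have ham : a k e u ∈ (hc.span ⊔ Subgroup.zpowers c) ⊔ Subgroup.zpowers (a k e u) :=
      Subgroup.mem_sup_right (Subgroup.mem_zpowers _)
    rw [eq_top_iff, ← hcl, Subgroup.closure_le]
    rintro s (rfl | rfl)
    · exact ham
    · have : b k e u = (a k e u ^ 3 ^ e)⁻¹ * c := by rw [hcdef, inv_mul_cancel_left]
      rw [this]
      exact mul_mem (inv_mem (pow_mem ham _)) (Subgroup.mem_sup_left hcm)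
  let A : Set (G₃ k e u) := (fun l => a k e u ^ l) '' (Finset.range (2 * 3 ^ e) : Set ℕ)
  have huniv : (Subgroup.zpowers X : Set (G₃ k e u)) * (Subgroup.zpowers Y : Set (G₃ k e u)) *
      (Subgroup.zpowers c : Set (G₃ k e u)) * A =
      Set.univ := by
    refine Set.eq_univ_of_forall fun g => ?_
    have hg : g ∈ (hc.span ⊔ Subgroup.zpowers c) ⊔ Subgroup.zpowers (a k e u) :=
      htop ▸ Subgroup.mem_top g
    obtain ⟨s, hs, t, ht, rfl⟩ := Subgroup.mem_sup_of_normal_left.1 hg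
    rw [← hapos.mem_powers_iff_mem_zpowers] at ht
    obtain ⟨l, rfl⟩ := ht
    simp only
    rw [hsplit l, ← mul_assoc]
    refine Set.mul_mem_mul ?_ ⟨l % (2 * 3 ^ e), by simpa using Nat.mod_lt _ (by positivity), rfl⟩
    obtain ⟨_, ⟨i, j, rfl⟩, z, hz, h⟩ :=
      Subgroup.mem_sup_of_normal_left.1 (mul_mem hs (pow_mem hXm' (l / (2 * 3 ^ e))))
    rw [← h]
    exact Set.mul_mem_mul (Set.mul_mem_mul ⟨i, rfl⟩ ⟨j, rfl⟩) hz
  have hfin : (Set.univ : Set (G₃ k e u)).Finite := by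
    rw [← huniv]
    exact ((hXf.finite_zpowers.mul hYf.finite_zpowers).mul hcf.finite_zpowers).mul
      ((Finset.finite_toSet _).image _)
  refine ⟨Set.finite_univ_iff.1 hfin, ?_⟩
  rw [← Nat.card_univ, ← huniv]
  have hz : ∀ (g : G₃ k e u) (m : ℕ), 0 < m → g ^ m = 1 →
      Nat.card (Subgroup.zpowers g : Set (G₃ k e u)) ≤ m := fun g m hm h => by
    have := Nat.card_zpowers g
    exact this.trans_le (orderOf_le_of_pow_eq_one hm h)
  have hA : Nat.card A ≤ 2 * 3 ^ e := by
    refine (Nat.card_image_le (Finset.finite_toSet _)).trans ?_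
    simp
  calc _ ≤ _ * Nat.card A := Set.natCard_mul_le
    _ ≤ _ * _ * Nat.card A := Nat.mul_le_mul_right _ Set.natCard_mul_le
    _ ≤ _ * _ * _ * Nat.card A :=
        Nat.mul_le_mul_right _ (Nat.mul_le_mul_right _ Set.natCard_mul_le)
    _ ≤ k * k * 3 ^ (e + 1) * (2 * 3 ^ e) :=
        Nat.mul_le_mul (Nat.mul_le_mul (Nat.mul_le_mul (hz _ _ hk hxk) (hz _ _ hk hyk))
          (hz _ _ (by positivity) hce)) hA
    _ = 6 * (3 ^ e * k) ^ 2 := by ring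

end Finiteness

end G₃

/-! ### Two permutation representations of `G₃`. -/

namespace G₃

section Affine

variable {R : Type*} [CommRing R] (t : Rˣ)

theorem mulLeft_inv_zpow_apply (l : ℤ) (s : R) :
    (Units.mulLeft t⁻¹ ^ l) s = ((t ^ l)⁻¹ : Rˣ) * s := by
  have h : Units.mulLeft t⁻¹ = MulAction.toPermHom Rˣ R t⁻¹ := by
    ext s; simp [Units.smul_def]
  rw [h, ← map_zpow, inv_zpow]
  simp [Units.smul_def]

theorem mulLeft_inv_pow_apply (l : ℕ) (s : R) :
    (Units.mulLeft t⁻¹ ^ l) s = ((t ^ l)⁻¹ : Rˣ) * s := by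
  simpa using mulLeft_inv_zpow_apply t l s

variable {e : ℕ} (h1 : t ^ 3 ^ e = -1)
include h1

/-- As `a ^ 3 ^ e` acts as `-1` and `b` as `s ↦ -1 - s`, their product is a translation. Letting `a`
act by `t⁻¹` makes `rconj a` multiply translations by `t = 2`, matching the relation that squares
`c`. -/
theorem affine_c : Units.mulLeft t⁻¹ ^ 3 ^ e * Equiv.subLeft (-1 : R) = Equiv.addRight 1 := by
  ext s
  rw [Equiv.Perm.mul_apply, mulLeft_inv_pow_apply, h1]
  simp

theorem affine_x : Units.mulLeft t⁻¹ ^ (2 * 3 ^ e) = (1 : Equiv.Perm R) := by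
  ext s
  rw [mulLeft_inv_pow_apply, mul_comm 2, pow_mul, h1]
  simp

theorem affine_lift (k : ℕ) (u : ℤ) (h2 : (t : R) = 2) (h3 : (3 : R) ^ (e + 1) = 0) :
    ∀ r ∈ relators₃ k e u,
      FreeGroup.lift ![Units.mulLeft t⁻¹, Equiv.subLeft (-1 : R)] r = 1 := by
  have hx := affine_x t h1
  refine lift_eq_one ?_ ?_ ?_ ?_ ?_ ?_
  · rw [pow_mul, hx, one_pow]
  · ext s; simp
  · rw [hx]; exact Commute.one_left _
  · rw [affine_c t h1, Equiv.nsmul_addRight]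
    ext s; simp [h3]
  · rw [hx]; simp
  · rw [hx, affine_c t h1, Equiv.nsmul_addRight, rconj_apply, map_one, one_zpow, one_zpow, mul_one,
      mul_one, mul_assoc, inv_mul_eq_iff_eq_mul]
    ext s
    simp only [Equiv.Perm.mul_apply, Units.mulLeft_apply, Equiv.coe_addRight]
    have h4 : ((t⁻¹ : Rˣ) : R) * 2 = 1 := by rw [← h2, Units.inv_mul]
    simp [mul_add, h4]

/-- The action of `G₃` on a ring by affine maps, in which `c` is the translation by `1`. -/
noncomputable def affineHom (k : ℕ) (u : ℤ) (h2 : (t : R) = 2) (h3 : (3 : R) ^ (e + 1) = 0) :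
    G₃ k e u →* Equiv.Perm R := PresentedGroup.toGroup (affine_lift t h1 k u h2 h3)

variable {k : ℕ} {u : ℤ} (h2 : (t : R) = 2) (h3 : (3 : R) ^ (e + 1) = 0)

theorem affineHom_a : affineHom t h1 k u h2 h3 (a k e u) = Units.mulLeft t⁻¹ :=
  PresentedGroup.toGroup.of _

theorem affineHom_b : affineHom t h1 k u h2 h3 (b k e u) = Equiv.subLeft (-1) :=
  PresentedGroup.toGroup.of _

end Affine

section Torus

variable (k : ℕ)

/-- A permutation of the torus whose square is the translation by `(1, 0)`. -/
def torusA : Equiv.Perm (ZMod k × ZMod k) where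
  toFun z := (z.1 - z.2 + 1, 1 - z.2)
  invFun z := (z.1 - z.2, 1 - z.2)
  left_inv z := by ext <;> simp; ring
  right_inv z := by ext <;> simp

theorem torusA_sq : torusA k ^ 2 = Equiv.addRight (1, 0) := by
  ext z <;> simp [torusA, pow_two]; ring

theorem torusA_pow (l : ℕ) : torusA k ^ (2 * l) = Equiv.addRight ((l : ZMod k), 0) := by
  rw [pow_mul, torusA_sq, Equiv.nsmul_addRight]; simp

theorem torusA_conj (i : ZMod k) :
    rconj (Equiv.prodComm (ZMod k) (ZMod k) : Equiv.Perm (ZMod k × ZMod k))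
      (Equiv.addRight (i, 0)) = Equiv.addRight (0, i) := by
  rw [rconj_apply, mul_assoc, inv_mul_eq_iff_eq_mul]
  ext z <;> simp

theorem torus_lift {e : ℕ} {u : ℤ} (hu : u * 3 ^ e ≡ 1 [ZMOD k]) :
    ∀ r ∈ relators₃ k e u, FreeGroup.lift
      ![torusA k, (Equiv.prodComm (ZMod k) (ZMod k) : Equiv.Perm (ZMod k × ZMod k))] r = 1 := by
  obtain ⟨l, hl⟩ : Odd (3 ^ e) := Odd.pow (by decide)
  have hl' : (3 : ℤ) ^ e = 2 * l + 1 := by exact_mod_cast hl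
  have hd : (1 - (3 : ℤ) ^ e) / 2 = -l := by rw [hl']; lia
  have hu' : (u : ZMod k) * (3 : ZMod k) ^ e = 1 := by
    have := (ZMod.intCast_eq_intCast_iff _ _ _).2 hu
    simpa using this
  have hl2 : (3 : ZMod k) ^ e = 2 * l + 1 := by
    have := congrArg (fun x : ℕ => (x : ZMod k)) hl
    simpa using this
  have hc : torusA k ^ 3 ^ e *
      (Equiv.prodComm (ZMod k) (ZMod k) : Equiv.Perm (ZMod k × ZMod k)) =
      { toFun := fun z => (z.2 - z.1 + 1 + l, 1 - z.1)
        invFun := fun z => (1 - z.2, z.1 - z.2 - l)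
        left_inv := fun z => by ext <;> simp; ring
        right_inv := fun z => by ext <;> simp; ring } := by
    rw [hl, pow_succ, torusA_pow]
    ext z <;> simp [torusA]
  refine lift_eq_one ?_ ?_ ?_ ?_ ?_ ?_
  · rw [mul_assoc, torusA_pow]; ext z <;> simp
  · ext z <;> simp
  · rw [torusA_pow, torusA_conj]
    ext z <;> simp
  · rw [pow_succ', pow_mul]
    -- The linear part of `c` satisfies `1 + L + L ^ 2 = 0`, so `c ^ 3 = 1` whatever its translation
    -- part.
    convert one_pow (M := Equiv.Perm (ZMod k × ZMod k)) (3 ^ e)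
    rw [hc]
    ext z <;> simp [pow_succ] <;> ring
  · rw [torusA_pow, torusA_conj, rconj_apply, mul_assoc, inv_mul_eq_iff_eq_mul]
    ext z <;> simp [torusA]; ring
  · rw [torusA_pow, torusA_conj, rconj_apply, mul_assoc, inv_mul_eq_iff_eq_mul, hc,
      Equiv.zsmul_addRight, Equiv.zsmul_addRight, hd]
    ext z
    · simp [torusA, pow_two, hu', mul_assoc]; ring
    · simp [torusA, pow_two, hu', mul_assoc]; ring

/-- The action of `G₃` on the torus, in which `a ^ 2` and its conjugate under `b` are
translations. -/
def torusHom (e : ℕ) {u : ℤ} (hu : u * 3 ^ e ≡ 1 [ZMOD k]) :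
    G₃ k e u →* Equiv.Perm (ZMod k × ZMod k) := PresentedGroup.toGroup (torus_lift k hu)

variable {e : ℕ} {u : ℤ} (hu : u * 3 ^ e ≡ 1 [ZMOD k])

theorem torusHom_a : torusHom k e hu (a k e u) = torusA k :=
  PresentedGroup.toGroup.of _

theorem torusHom_b : torusHom k e hu (b k e u) = Equiv.prodComm (ZMod k) (ZMod k) :=
  PresentedGroup.toGroup.of _

end Torus

end G₃

namespace G₃

/-- The unit `2` modulo a power of `3`. -/
def two (f : ℕ) : (ZMod (3 ^ (f + 1)))ˣ :=
  ZMod.unitOfCoprime 2 (Nat.Coprime.pow_right _ (by norm_num))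

theorem val_two (f : ℕ) : ((two f : (ZMod (3 ^ (f + 1)))ˣ) : ZMod (3 ^ (f + 1))) = 2 :=
  ZMod.coe_unitOfCoprime 2 _

theorem two_pow {f e : ℕ} (hf : f ≤ e) : two f ^ 3 ^ e = -1 := by
  apply Units.ext
  rw [Units.val_pow_eq_pow_val, val_two, Units.val_neg, Units.val_one, ← add_eq_zero_iff_eq_neg]
  have h1 : (3 : ℤ) ^ (f + 1) ∣ 2 ^ 3 ^ e + 1 :=
    (pow_dvd_pow 3 (Nat.succ_le_succ hf)).trans (three_pow_succ_dvd_pow_add_one (by norm_num) e)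
  have h2 := (ZMod.intCast_zmod_eq_zero_iff_dvd (2 ^ 3 ^ e + 1) (3 ^ (f + 1))).2
    (by exact_mod_cast h1)
  simpa using h2

theorem three_pow_eq_zero {f e : ℕ} (hf : f ≤ e) : (3 : ZMod (3 ^ (f + 1))) ^ (e + 1) = 0 := by
  have := (ZMod.natCast_eq_zero_iff (3 ^ (e + 1)) (3 ^ (f + 1))).2
    (pow_dvd_pow 3 (Nat.succ_le_succ hf))
  simpa using this

theorem orderOf_two (e : ℕ) : orderOf (two e) = 2 * 3 ^ e := by
  rw [← orderOf_units, val_two]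
  exact_mod_cast orderOf_intCast_zmod_three_pow (q := 2) (by norm_num) (by norm_num) e

/-- The action of `G₃ k e u` on the integers modulo `3 ^ (f + 1)` by affine maps, for `f ≤ e`. -/
noncomputable def modHom (k : ℕ) {e : ℕ} (u : ℤ) {f : ℕ} (hf : f ≤ e) :
    G₃ k e u →* Equiv.Perm (ZMod (3 ^ (f + 1))) :=
  affineHom (two f) (two_pow hf) k u (val_two f) (three_pow_eq_zero hf)

variable {k e : ℕ} {u : ℤ}

theorem modHom_a {f : ℕ} (hf : f ≤ e) : modHom k u hf (a k e u) = Units.mulLeft (two f)⁻¹ :=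
  affineHom_a _ _ _ _

theorem modHom_b {f : ℕ} (hf : f ≤ e) : modHom k u hf (b k e u) = Equiv.subLeft (-1) :=
  affineHom_b _ _ _ _

theorem three_pow_dvd_of_fixed {i : ℤ} (h : (Units.mulLeft (two e)⁻¹ ^ 2) ^ i = 1) :
    ((3 ^ e : ℕ) : ℤ) ∣ i := by
  have h1 := congrArg (fun g : Equiv.Perm (ZMod (3 ^ (e + 1))) => g 1) h
  simp only [← zpow_natCast, ← zpow_mul, mulLeft_inv_zpow_apply] at h1
  rw [mul_one, Equiv.Perm.one_apply, Units.val_eq_one, inv_eq_one,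
    ← orderOf_dvd_iff_zpow_eq_one, orderOf_two] at h1
  push_cast at h1 ⊢
  exact Int.dvd_of_mul_dvd_mul_left (by norm_num) h1

/-- Divisibility by `k` is read off the translations of the torus and divisibility by `3 ^ e` off
the affine action modulo `3 ^ (e + 1)`; the two moduli are coprime. -/
theorem dvd_of_eq_one (hk : ¬ 3 ∣ k) (hu : u * 3 ^ e ≡ 1 [ZMOD k]) (i j : ℤ)
    (h : (a k e u ^ 2) ^ i * rconj (b k e u) (a k e u ^ 2) ^ j = 1) :
    ((3 ^ e * k : ℕ) : ℤ) ∣ i ∧ ((3 ^ e * k : ℕ) : ℤ) ∣ j := by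
  have h1 : (k : ℤ) ∣ i ∧ (k : ℤ) ∣ j := by
    have h2 := congrArg (torusHom k e hu) h
    rw [map_mul, map_zpow, map_zpow, map_rconj, map_pow (torusHom k e hu), torusHom_a, torusHom_b,
      torusA_sq, torusA_conj, Equiv.zsmul_addRight, Equiv.zsmul_addRight, map_one] at h2
    have h3 := congrArg (fun g : Equiv.Perm (ZMod k × ZMod k) => g (0, 0)) h2
    simpa [ZMod.intCast_zmod_eq_zero_iff_dvd, Prod.ext_iff] using h3
  have h2 := congrArg (modHom k u le_rfl) h
  rw [map_mul, map_zpow, map_zpow, map_rconj, map_pow (modHom k u le_rfl), modHom_a, modHom_b,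
    map_one] at h2
  have hi : ((3 ^ e : ℕ) : ℤ) ∣ i := by
    apply three_pow_dvd_of_fixed
    -- `x` fixes `0`, and `b` exchanges `0` and `-1`, so `y` fixes `-1`. Evaluating the relation at
    -- the unit `-1` isolates the power of `x`.
    have h3 : (rconj (Equiv.subLeft (-1)) (Units.mulLeft (two e)⁻¹ ^ 2) ^ j) (-1) = -1 := by
      apply Equiv.Perm.zpow_apply_eq_self_of_apply_eq_self
      rw [rconj_apply]
      simp [pow_two]
    have h4 := congrArg (fun g : Equiv.Perm (ZMod (3 ^ (e + 1))) => g (-1)) h2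
    simp only [Equiv.Perm.mul_apply, h3, Equiv.Perm.one_apply] at h4
    rw [← zpow_natCast, ← zpow_mul, mulLeft_inv_zpow_apply] at h4
    ext s
    rw [← zpow_natCast, ← zpow_mul, mulLeft_inv_zpow_apply]
    simp only [mul_neg, mul_one, neg_inj] at h4
    rw [h4, one_mul, Equiv.Perm.one_apply]
  have hj : ((3 ^ e : ℕ) : ℤ) ∣ j := by
    apply three_pow_dvd_of_fixed
    obtain ⟨t, rfl⟩ := hi
    rw [zpow_mul, zpow_natCast, ← pow_mul, affine_x _ (two_pow le_rfl), one_zpow, one_mul,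
      ← map_zpow] at h2
    exact (map_eq_one_iff _ (rconj_injective _)).1 h2
  have hc : IsCoprime ((3 ^ e : ℕ) : ℤ) (k : ℤ) := Nat.isCoprime_iff_coprime.2
    (Nat.Coprime.pow_left _ ((Nat.Prime.coprime_iff_not_dvd Nat.prime_three).2 hk))
  push_cast at hi hj hc ⊢
  exact ⟨hc.mul_dvd hi h1.1, hc.mul_dvd hj h1.2⟩

theorem tripartitePair (hk : ¬ 3 ∣ k) (hu : u * 3 ^ e ≡ 1 [ZMOD k]) :
    TripartitePair (a k e u) (b k e u) (modHom k u e.zero_le).ker (3 ^ e * k) ∧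
      Nat.card (G₃ k e u) = 6 * (3 ^ e * k) ^ 2 := by
  have hk0 : 0 < k := Nat.pos_of_ne_zero (by rintro rfl; simp at hk)
  obtain ⟨hfin, hcard⟩ := finite_and_card_le k e u hk0
  have h1 : (1 : ZMod (3 ^ (0 + 1))) ≠ 0 := by decide
  have h2 : modHom k u e.zero_le (a k e u * b k e u) = Equiv.addRight 1 := by
    rw [map_mul, modHom_a, modHom_b]
    simpa using affine_c _ (two_pow (le_refl 0))
  refine TripartitePair.of_card_le _ (closure_a_b k e u) (b_mul_b k e u) (by positivity)
    ?_ (dvd_of_eq_one hk hu) ?_ ?_ ?_ ?_ hcard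
  · rw [← pow_mul, ← mul_assoc, a_pow]
  · rw [modHom_a]
    simpa using affine_x _ (two_pow (le_refl 0))
  · rw [modHom_b]
    intro h
    have := congrArg (fun g : Equiv.Perm (ZMod (3 ^ (0 + 1))) => g 0) h
    simp at this
  · rw [h2, Equiv.nsmul_addRight]
    ext s
    simpa using three_pow_eq_zero (le_refl 0)
  · rw [h2]
    intro h
    have := congrArg (fun g : Equiv.Perm (ZMod (3 ^ (0 + 1))) => g 0) h
    simp at this

end G₃

/-! ### Isomorphisms between the maps `M₃`. -/

/-- An isomorphism commutes with left multiplication by the generators; after right multiplication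
by `(F 1)⁻¹` it fixes the identity and becomes a homomorphism. -/
theorem OrientedMap.exists_hom_of_isIso {G G' : Type*} [Group G] [Group G'] {a b : G} {a' b' : G'}
    {hb hb1 hgen hb' hb1' hgen'}
    (h : (OrientedMap.algebraic a b hb hb1 hgen).IsIso
      (OrientedMap.algebraic a' b' hb' hb1' hgen')) :
    ∃ f : G →* G', f a = a' ∧ f b = b' := by
  obtain ⟨F, h1, h2⟩ := h
  have ha : ∀ g, F (a * g) = a' * F g := h1
  have hb : ∀ g, F (b * g) = b' * F g := h2
  have key : ∀ h g, F (h * g) = F h * (F 1)⁻¹ * F g := by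
    intro h
    have hh : h ∈ Subgroup.closure {a, b} := by rw [hgen]; trivial
    induction hh using Subgroup.closure_induction with
    | mem x hx =>
      intro g
      rcases hx with rfl | rfl
      · have := ha 1
        rw [mul_one] at this
        rw [ha, this, mul_inv_cancel_right]
      · have := hb 1
        rw [mul_one] at this
        rw [hb, this, mul_inv_cancel_right]
    | one => intro g; simp
    | mul x y _ _ hx hy =>
      intro g
      rw [mul_assoc, hx, hy, hx y]
      group
    | inv x _ hx =>
      intro g
      have h3 := hx (x⁻¹ * g)
      have h4 := hx x⁻¹
      rw [mul_inv_cancel_left] at h3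
      rw [mul_inv_cancel] at h4
      have h5 : F x * (F 1)⁻¹ = F 1 * (F x⁻¹)⁻¹ := by rw [eq_mul_inv_iff_mul_eq]; exact h4.symm
      rw [h5] at h3
      rw [h3]
      group
  refine ⟨MonoidHom.mk' (fun g => F g * (F 1)⁻¹) fun g h => ?_, ?_, ?_⟩
  · simp only [key g h, mul_assoc]
  · have := ha 1
    rw [mul_one] at this
    simp [this]
  · have := hb 1
    rw [mul_one] at this
    simp [this]

theorem OrientedMap.isIso_of_bijective {G G' : Type*} [Group G] [Group G'] {a b : G} {a' b' : G'}
    {hb hb1 hgen hb' hb1' hgen'} (f : G →* G') (hf : Function.Bijective f) (ha : f a = a')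
    (hfb : f b = b') :
    (OrientedMap.algebraic a b hb hb1 hgen).IsIso
      (OrientedMap.algebraic a' b' hb' hb1' hgen') := by
  refine ⟨Equiv.ofBijective f hf, fun g => ?_, fun g => ?_⟩
  · change f (a * g) = a' * f g
    rw [map_mul, ha]
  · change f (b * g) = b' * f g
    rw [map_mul, hfb]

/-- A tripartite pair of the right order in which `a` conjugates `c` to `c ^ 2` modulo
`⟨x₁, y₁⟩` yields an isomorphism with `G₃`. -/
theorem TripartitePair.exists_bijective_hom {G : Type*} [Group G] {a b : G} {K : Subgroup G}
    {n e k : ℕ} (T : TripartitePair a b K n) (hn : n = 3 ^ e * k) (hk : ¬ 3 ∣ k)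
    (hcard : Nat.card G = 6 * n ^ 2)
    (h : ∃ p q : ℤ, rconj a (a ^ 3 ^ e * b) = (a ^ 3 ^ e * b) ^ 2 *
      (((a ^ 2) ^ 3 ^ e) ^ p * (rconj b (a ^ 2) ^ 3 ^ e) ^ q)) {u : ℤ}
    (hu : u * 3 ^ e ≡ 1 [ZMOD k]) :
    ∃ f : G₃ k e u →* G, Function.Bijective f ∧ f (G₃.a k e u) = a ∧ f (G₃.b k e u) = b := by
  obtain ⟨p, q, h⟩ := h
  have hfa : PresentedGroup.toGroup (T.lift_relators_eq_one hn hk h hu) (G₃.a k e u) = a :=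
    PresentedGroup.toGroup.of _
  have hfb : PresentedGroup.toGroup (T.lift_relators_eq_one hn hk h hu) (G₃.b k e u) = b :=
    PresentedGroup.toGroup.of _
  have hk0 : 0 < k := Nat.pos_of_ne_zero (by rintro rfl; simp at hk)
  have := (G₃.finite_and_card_le k e u hk0).1
  refine ⟨_, (Nat.bijective_iff_surjective_and_card _).2 ⟨?_, ?_⟩, hfa, hfb⟩
  · rw [← MonoidHom.range_eq_top, eq_top_iff, ← T.closure_eq, Subgroup.closure_le]
    rintro s (rfl | rfl)
    · exact ⟨_, hfa⟩
    · exact ⟨_, hfb⟩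
  · rw [hcard, (G₃.tripartitePair hk hu).2, hn]

namespace G₃

variable {k e : ℕ} {u : ℤ}

theorem rconj_a_c' : rconj (a k e u ^ 1) (a k e u ^ 3 ^ e * b k e u) =
    (a k e u ^ 3 ^ e * b k e u) ^ 2 * (((a k e u ^ 2) ^ 3 ^ e) ^ u *
      (rconj (b k e u) (a k e u ^ 2) ^ 3 ^ e) ^ ((1 - 3 ^ e) / 2 * u)) := by
  rw [pow_one, rconj_a_c, ← map_pow, ← pow_mul, mul_assoc]

/-- For such `j` the element `a ^ j` still squares its own `c` modulo `W`; the remaining relations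
follow as for any tripartite pair. -/
theorem exists_automorphism (hk : ¬ 3 ∣ k) (hu : u * 3 ^ e ≡ 1 [ZMOD k]) {j : ℕ}
    (hj : j.Coprime (2 * (3 ^ e * k))) (hj1 : j ≡ 1 [MOD 2 * 3 ^ e]) :
    ∃ f : G₃ k e u →* G₃ k e u, Function.Bijective f ∧ f (a k e u) = a k e u ^ j ∧
      f (b k e u) = b k e u := by
  obtain ⟨T, hcard⟩ := tripartitePair (e := e) hk hu
  exact (T.pow_pair hj).exists_bijective_hom rfl hk hcard
    (T.exists_rconj_pow_eq rfl hk hj hj1 ⟨_, _, rconj_a_c'⟩) hu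

theorem coprime_val (j : (ZMod (2 * 3 ^ e * k))ˣ) :
    (j : ZMod (2 * 3 ^ e * k)).val.Coprime (2 * (3 ^ e * k)) := by
  rw [← mul_assoc]
  exact ZMod.val_coe_unit_coprime j

theorem odd_val (j : (ZMod (2 * 3 ^ e * k))ˣ) : Odd (j : ZMod (2 * 3 ^ e * k)).val :=
  Nat.Coprime.odd_of_right ((coprime_val j).coprime_dvd_right (dvd_mul_right 2 _))

theorem a_pow_val_mul (i j : (ZMod (2 * 3 ^ e * k))ˣ) :
    a k e u ^ ((i * j : (ZMod (2 * 3 ^ e * k))ˣ) : ZMod (2 * 3 ^ e * k)).val =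
      (a k e u ^ (i : ZMod (2 * 3 ^ e * k)).val) ^ (j : ZMod (2 * 3 ^ e * k)).val := by
  rw [← pow_mul]
  refine pow_eq_pow_iff_modEq.2
    (Nat.ModEq.of_dvd (orderOf_dvd_of_pow_eq_one (a_pow k e u)) ?_)
  rw [Units.val_mul, ZMod.val_mul]
  exact Nat.mod_modEq _ _

theorem isIso_of_modEq (hk : ¬ 3 ∣ k) (hu : u * 3 ^ e ≡ 1 [ZMOD k])
    {j₁ j₂ : (ZMod (2 * 3 ^ e * k))ˣ}
    (h : (j₁ : ZMod (2 * 3 ^ e * k)).val ≡ (j₂ : ZMod (2 * 3 ^ e * k)).val [MOD 2 * 3 ^ e]) :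
    (M₃ k e u j₁).IsIso (M₃ k e u j₂) := by
  have hd : 2 * 3 ^ e ∣ 2 * 3 ^ e * k := dvd_mul_right _ _
  have hk0 : 0 < k := Nat.pos_of_ne_zero (by rintro rfl; simp at hk)
  have : NeZero (2 * 3 ^ e * k) := ⟨by positivity⟩
  have hj : ((j₁⁻¹ * j₂ : (ZMod (2 * 3 ^ e * k))ˣ) : ZMod (2 * 3 ^ e * k)).val ≡
      1 [MOD 2 * 3 ^ e] := by
    rw [← ZMod.natCast_eq_natCast_iff, ZMod.natCast_val, ZMod.natCast_val] at h
    have h1 : ZMod.unitsMap hd j₁ = ZMod.unitsMap hd j₂ := Units.ext (by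
      rwa [ZMod.unitsMap_val, ZMod.unitsMap_val])
    have h2 : ZMod.unitsMap hd (j₁⁻¹ * j₂) = 1 := by rw [map_mul, map_inv, h1, inv_mul_cancel]
    have h3 := congrArg Units.val h2
    rw [ZMod.unitsMap_val] at h3
    rw [← ZMod.natCast_eq_natCast_iff, ZMod.natCast_val, h3]
    simp
  obtain ⟨f, hf, hfa, hfb⟩ := exists_automorphism hk hu (coprime_val (j₁⁻¹ * j₂)) hj
  refine OrientedMap.isIso_of_bijective f hf ?_ hfb
  rw [map_pow, hfa, ← a_pow_val_mul, inv_mul_cancel_comm]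

end G₃

namespace G₃

variable {k e : ℕ} {u : ℤ}

theorem mulLeft_inv_pow {R : Type*} [CommRing R] (t : Rˣ) (j : ℕ) :
    Units.mulLeft t⁻¹ ^ j = Units.mulLeft (t ^ j)⁻¹ := by
  ext s
  rw [mulLeft_inv_pow_apply, Units.mulLeft_apply]

theorem modHom_a_pow {f : ℕ} (hf : f ≤ e) (j : ℕ) :
    modHom k u hf (a k e u ^ j) = Units.mulLeft (two f ^ j)⁻¹ := by
  rw [map_pow, modHom_a, mulLeft_inv_pow]

theorem modHom_c {f : ℕ} (hf : f ≤ e) {j : ℕ} (hj : Odd j) :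
    modHom k u hf ((a k e u ^ j) ^ 3 ^ e * b k e u) = Equiv.addRight 1 := by
  rw [map_mul, map_pow, modHom_a_pow, modHom_b]
  exact affine_c _ (by rw [pow_right_comm, two_pow hf, hj.neg_one_pow])

theorem modHom_rconj_c {f : ℕ} (hf : f ≤ e) {j : ℕ} (hj : Odd j) :
    modHom k u hf (rconj (a k e u ^ j) ((a k e u ^ j) ^ 3 ^ e * b k e u)) =
      Equiv.addRight (2 ^ j) := by
  rw [map_rconj, modHom_c hf hj, modHom_a_pow, rconj_apply, mul_assoc, inv_mul_eq_iff_eq_mul]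
  ext s
  have h : ((two f ^ j)⁻¹ : (ZMod (3 ^ (f + 1)))ˣ) * (2 : ZMod (3 ^ (f + 1))) ^ j = 1 := by
    rw [← val_two, ← Units.val_pow_eq_pow_val, Units.inv_mul]
  simp only [Equiv.Perm.mul_apply, Units.mulLeft_apply, Equiv.coe_addRight]
  rw [mul_add, h]

/-- Modulo `W` the element `a ^ j` raises `c` to the power `2 ^ j`, and `W` has exponent dividing
`k`. The resulting equation involves only `a ^ j` and `b`, so a homomorphism matching the generators
transports it. -/
theorem rconj_c_mul_pow_eq_one (hk : ¬ 3 ∣ k) (hu : u * 3 ^ e ≡ 1 [ZMOD k]) {j : ℕ} (hj : Odd j) :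
    (rconj (a k e u ^ j) ((a k e u ^ j) ^ 3 ^ e * b k e u) *
      (((a k e u ^ j) ^ 3 ^ e * b k e u) ^ 2 ^ j)⁻¹) ^ k = 1 := by
  obtain ⟨T, -⟩ := tripartitePair (e := e) hk hu
  obtain ⟨W, hW, hmem, hWk, T'⟩ := T.exists_hall_quotient rfl hk
  refine hWk _ ?_
  have hc : rconj (QuotientGroup.mk' W (a k e u))
      (QuotientGroup.mk' W (a k e u) ^ 3 ^ e * QuotientGroup.mk' W (b k e u)) =
      (QuotientGroup.mk' W (a k e u) ^ 3 ^ e * QuotientGroup.mk' W (b k e u)) ^ 2 := by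
    have h1 := congrArg (QuotientGroup.mk' W) (rconj_a_c' (k := k) (e := e) (u := u))
    have h2 : QuotientGroup.mk' W (((a k e u ^ 2) ^ 3 ^ e) ^ u *
      (rconj (b k e u) (a k e u ^ 2) ^ 3 ^ e) ^ ((1 - 3 ^ e) / 2 * u)) = 1 :=
      (QuotientGroup.eq_one_iff _).2 ((hmem _).2 ⟨_, _, rfl⟩)
    rwa [map_mul _ (_ ^ 2), h2, mul_one, map_rconj, map_pow, map_pow, map_mul, map_pow,
      pow_one] at h1
  have hcj : ∀ j : ℕ, rconj (QuotientGroup.mk' W (a k e u) ^ j)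
      (QuotientGroup.mk' W (a k e u) ^ 3 ^ e * QuotientGroup.mk' W (b k e u)) =
      (QuotientGroup.mk' W (a k e u) ^ 3 ^ e * QuotientGroup.mk' W (b k e u)) ^ 2 ^ j := fun j => by
    induction j with
    | zero => simp [rconj_apply]
    | succ j ih => rw [pow_succ, rconj_mul, ih, map_pow, hc, ← pow_mul, ← pow_succ']
  have hfa : QuotientGroup.mk' W (a k e u) ^ (2 * 3 ^ e) = 1 := T'.a_pow_eq_one
  have h2 : QuotientGroup.mk' W ((a k e u ^ j) ^ 3 ^ e * b k e u) =
      QuotientGroup.mk' W (a k e u) ^ 3 ^ e * QuotientGroup.mk' W (b k e u) := by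
    obtain ⟨l, rfl⟩ := hj
    rw [map_mul, map_pow, map_pow, ← pow_mul,
      show (2 * l + 1) * 3 ^ e = 2 * 3 ^ e * l + 3 ^ e by ring, pow_add, pow_mul, hfa, one_pow,
      one_mul]
  rw [← QuotientGroup.eq_one_iff]
  change QuotientGroup.mk' W _ = 1
  rw [map_mul, map_inv, map_rconj, map_pow _ _ (2 ^ j), h2, map_pow, hcj, mul_inv_cancel]

/-- The transported equation says, in the affine action modulo `3 ^ (e + 1)`, that `k * (2 ^ j₂ - 2
^ j₁) = 0`. Here `k` is a unit and `2` has order `2 * 3 ^ e`. -/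
theorem modEq_of_hom (hk : ¬ 3 ∣ k) (hu : u * 3 ^ e ≡ 1 [ZMOD k]) {j₁ j₂ : ℕ} (hj₁ : Odd j₁)
    (hj₂ : Odd j₂) (f : G₃ k e u →* G₃ k e u) (hfa : f (a k e u ^ j₁) = a k e u ^ j₂)
    (hfb : f (b k e u) = b k e u) : j₁ ≡ j₂ [MOD 2 * 3 ^ e] := by
  have h1 := congrArg f (rconj_c_mul_pow_eq_one hk hu hj₁)
  have hfc : f ((a k e u ^ j₁) ^ 3 ^ e * b k e u) = (a k e u ^ j₂) ^ 3 ^ e * b k e u := by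
    rw [map_mul, map_pow, hfa, hfb]
  rw [map_one, map_pow _ _ k, map_mul, map_inv, map_rconj, map_pow _ _ (2 ^ j₁), hfc, hfa] at h1
  have h2 := congrArg (modHom k u le_rfl) h1
  rw [map_one, map_pow _ _ k, map_mul, map_inv, modHom_rconj_c _ hj₂, map_pow _ _ (2 ^ j₁),
    modHom_c _ hj₂, Equiv.nsmul_addRight, Equiv.neg_addRight, ← Equiv.addRight_add,
    Equiv.nsmul_addRight] at h2
  have h3 := congrArg (fun g : Equiv.Perm (ZMod (3 ^ (e + 1))) => g 0) h2
  have hku : IsUnit (k : ZMod (3 ^ (e + 1))) := by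
    rw [ZMod.isUnit_iff_coprime]
    exact (Nat.Coprime.pow_left _ ((Nat.Prime.coprime_iff_not_dvd Nat.prime_three).2 hk)).symm
  have h4 : (2 : ZMod (3 ^ (e + 1))) ^ j₂ = 2 ^ j₁ := by
    simp only [Equiv.coe_addRight, zero_add, Equiv.Perm.one_apply, nsmul_eq_mul, mul_one] at h3
    have h5 := (hku.mul_right_eq_zero).1 h3
    push_cast at h5
    rw [neg_add_eq_zero] at h5
    exact h5.symm
  have h5 : two e ^ j₁ = two e ^ j₂ := Units.ext (by
    rw [Units.val_pow_eq_pow_val, Units.val_pow_eq_pow_val, val_two, h4])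
  have h6 := pow_eq_pow_iff_modEq.1 h5
  rwa [orderOf_two] at h6

theorem isIso_iff_modEq (hk : ¬ 3 ∣ k) (hu : u * 3 ^ e ≡ 1 [ZMOD k])
    (j₁ j₂ : (ZMod (2 * 3 ^ e * k))ˣ) :
    (M₃ k e u j₁).IsIso (M₃ k e u j₂) ↔
    (j₁ : ZMod (2 * 3 ^ e * k)).val ≡ (j₂ : ZMod (2 * 3 ^ e * k)).val [MOD 2 * 3 ^ e] := by
  refine ⟨fun h => ?_, isIso_of_modEq hk hu⟩
  obtain ⟨f, hfa, hfb⟩ := OrientedMap.exists_hom_of_isIso h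
  exact modEq_of_hom hk hu (odd_val j₁) (odd_val j₂) f hfa hfb

theorem ncard_range (hk : ¬ 3 ∣ k) (he : 1 ≤ e) (hu : u * 3 ^ e ≡ 1 [ZMOD k]) :
    (Set.range fun j : (ZMod (2 * 3 ^ e * k))ˣ =>
      Quotient.mk (OrientedMap.isoSetoid (G₃ k e u)) (M₃ k e u j)).ncard = 2 * 3 ^ (e - 1) := by
  have hd : 2 * 3 ^ e ∣ 2 * 3 ^ e * k := dvd_mul_right _ _
  have hk0 : 0 < k := Nat.pos_of_ne_zero (by rintro rfl; simp at hk)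
  have : NeZero (2 * 3 ^ e * k) := ⟨by positivity⟩
  have : NeZero (2 * 3 ^ e) := ⟨by positivity⟩
  have hiff : ∀ j₁ j₂ : (ZMod (2 * 3 ^ e * k))ˣ,
      Quotient.mk (OrientedMap.isoSetoid (G₃ k e u)) (M₃ k e u j₁) =
        Quotient.mk (OrientedMap.isoSetoid (G₃ k e u)) (M₃ k e u j₂) ↔
      ZMod.unitsMap hd j₁ = ZMod.unitsMap hd j₂ := fun j₁ j₂ => by
    rw [Quotient.eq]
    change (M₃ k e u j₁).IsIso (M₃ k e u j₂) ↔ _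
    rw [isIso_iff_modEq hk hu, ← ZMod.natCast_eq_natCast_iff, ZMod.natCast_val, ZMod.natCast_val,
      Units.ext_iff, ZMod.unitsMap_val, ZMod.unitsMap_val]
  -- Isomorphism classes correspond to units modulo `2 * 3 ^ e`, every one of which lifts to a unit
  -- modulo `2 * 3 ^ e * k`.
  choose s hs using ZMod.unitsMap_surjective hd
  have h1 : (Set.range fun j : (ZMod (2 * 3 ^ e * k))ˣ =>
      Quotient.mk (OrientedMap.isoSetoid (G₃ k e u)) (M₃ k e u j)) =
      Set.range fun j => Quotient.mk (OrientedMap.isoSetoid (G₃ k e u)) (M₃ k e u (s j)) := by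
    ext z
    constructor
    · rintro ⟨j, rfl⟩
      exact ⟨ZMod.unitsMap hd j, (hiff _ _).2 (hs _)⟩
    · rintro ⟨j, rfl⟩
      exact ⟨s j, rfl⟩
  rw [h1, ← Set.image_univ, Set.ncard_image_of_injective _ fun i j h => by
    rw [← hs i, ← hs j]; exact (hiff _ _).1 h, Set.ncard_univ, Nat.card_eq_fintype_card,
    ZMod.card_units_eq_totient, Nat.totient_mul (Nat.Coprime.pow_right _ (by norm_num)),
    Nat.totient_two, Nat.totient_prime_pow Nat.prime_three (by lia), one_mul, mul_comm]

end G₃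

/-! ### The underlying graph of the algebraic map of a tripartite pair. -/

theorem natCard_dart_completeEquipartiteGraph (n : ℕ) :
    Nat.card (SimpleGraph.completeEquipartiteGraph 3 n).Dart = 6 * n ^ 2 := by
  rw [Nat.card_eq_fintype_card, SimpleGraph.dart_card_eq_twice_card_edges,
    SimpleGraph.card_edgeFinset_completeEquipartiteGraph, show Nat.choose 3 2 = 3 by rfl]
  ring

theorem perm_three_eq_one_or_eq : ∀ (s t : Equiv.Perm (Fin 3)) (p : Fin 3), s p = p → t p = p →
    s ≠ 1 → t = 1 ∨ t = s := by decide

theorem perm_three_sq : ∀ (s : Equiv.Perm (Fin 3)) (p : Fin 3), s p = p → s * s = 1 := by decide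

theorem perm_three_eq_one_of_fixed : ∀ (s : Equiv.Perm (Fin 3)) (p q : Fin 3), s p = p → s q = q →
    p ≠ q → s = 1 := by decide

namespace TripartitePair

section Embedding

variable {G : Type*} [Group G] {a b : G} {n : ℕ} {σ : G →* Equiv.Perm (Fin 3)} {p₀ : Fin 3}

theorem even_of_map_zpow_eq_one (ha : σ a p₀ = p₀) (ha1 : σ a ≠ 1) {s : ℤ}
    (h : σ (a ^ s) = 1) : Even s := by
  rw [← Int.not_odd_iff_even]
  rintro ⟨r, rfl⟩
  rw [map_zpow, zpow_add_one, zpow_mul, zpow_ofNat, pow_two, perm_three_sq _ _ ha, one_zpow,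
    one_mul] at h
  exact ha1 h

theorem map_zpow_apply (ha : σ a p₀ = p₀) (s : ℤ) : σ (a ^ s) p₀ = p₀ := by
  rw [map_zpow]
  exact Equiv.Perm.zpow_apply_eq_self_of_apply_eq_self ha s

variable (T : TripartitePair a b σ.ker n)
include T

/-- Identifies the cosets `⟨a⟩g` with the vertices of the graph. The part is where `g⁻¹` sends `p₀`,
and the cosets over one part are represented by the `n` powers of `y` times a fixed transporter. -/
theorem exists_vertex (ha : σ a p₀ = p₀) (ha1 : σ a ≠ 1)
    (hσ : ∀ p, ∃ g, σ g p = p₀) :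
    ∃ ν : G → Fin 3 × Fin n, (∀ g, (ν g).1 = (σ g)⁻¹ p₀) ∧
      ∀ g g', ν g = ν g' ↔ ∃ s : ℤ, g' = a ^ s * g := by
  choose t ht using hσ
  have hn : NeZero n := ⟨T.pos.ne'⟩
  have hyf : ∀ j : ℤ, σ (rconj b (a ^ 2) ^ j) = 1 := fun j =>
    MonoidHom.mem_ker.1 (zpow_mem T.y_mem j)
  have hex : ∀ g : G, ∃ (s : ℤ) (j : Fin n),
      g = a ^ s * rconj b (a ^ 2) ^ ((j : ℕ) : ℤ) * t ((σ g)⁻¹ p₀) := by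
    intro g
    have hfix : σ (g * (t ((σ g)⁻¹ p₀))⁻¹) p₀ = p₀ := by
      rw [map_mul, map_inv, Equiv.Perm.mul_apply]
      have : (σ (t ((σ g)⁻¹ p₀)))⁻¹ p₀ = (σ g)⁻¹ p₀ := by
        rw [Equiv.Perm.inv_eq_iff_eq, ht]
      rw [this]; simp
    -- The stabiliser of a point in the symmetric group of degree three has order two and is
    -- generated by `σ a`, so the element lies in `K` or in `a * K`.
    obtain ⟨ε, i, j, hg⟩ : ∃ ε i j : ℤ, g * (t ((σ g)⁻¹ p₀))⁻¹ =
        a ^ ε * ((a ^ 2) ^ i * rconj b (a ^ 2) ^ j) := by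
      rcases perm_three_eq_one_or_eq _ _ _ ha hfix ha1 with h | h
      · obtain ⟨i, j, h⟩ := (T.mem_iff _).1 (MonoidHom.mem_ker.2 h)
        exact ⟨0, i, j, by rw [h, zpow_zero, one_mul]⟩
      · have h1 : a⁻¹ * (g * (t ((σ g)⁻¹ p₀))⁻¹) ∈ σ.ker := by
          rw [MonoidHom.mem_ker, map_mul, h, map_inv, inv_mul_cancel]
        obtain ⟨i, j, h⟩ := (T.mem_iff _).1 h1
        exact ⟨1, i, j, by rw [zpow_one, ← h, mul_inv_cancel_left]⟩
    have hj0 := Int.emod_nonneg j (Int.natCast_ne_zero.2 T.pos.ne')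
    have hj1 := Int.emod_lt_of_pos j (Int.natCast_pos.2 T.pos)
    refine ⟨ε + 2 * i, ⟨(j % n).toNat, by lia⟩, ?_⟩
    have hj : rconj b (a ^ 2) ^ (((j % n).toNat : ℕ) : ℤ) = rconj b (a ^ 2) ^ j := by
      rw [Int.toNat_of_nonneg hj0, ← mul_inv_eq_one, ← zpow_neg, ← zpow_add, T.y_zpow_eq_one_iff]
      exact ⟨-(j / n), by have := Int.emod_add_mul_ediv j n; linear_combination this⟩
    rw [← mul_inv_eq_iff_eq_mul, hg]
    simp only
    rw [hj, zpow_add, zpow_mul, zpow_ofNat, mul_assoc]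
  choose s j hsj using hex
  refine ⟨fun g => ((σ g)⁻¹ p₀, j g), fun g => rfl, fun g g' => ⟨fun h => ?_, ?_⟩⟩
  · obtain ⟨h1, h2⟩ := Prod.ext_iff.1 h
    simp only at h1 h2
    refine ⟨s g' - s g, ?_⟩
    have e1 := hsj g
    have e2 := hsj g'
    rw [← h1, ← h2] at e2
    rw [mul_assoc] at e1 e2
    rw [zpow_sub, mul_assoc, ← eq_inv_mul_of_mul_eq e1.symm]
    exact e2
  · rintro ⟨r, hr⟩
    have h1 : (σ g')⁻¹ p₀ = (σ g)⁻¹ p₀ := by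
      rw [hr, map_mul, mul_inv_rev, Equiv.Perm.mul_apply]
      congr 1
      rw [Equiv.Perm.inv_eq_iff_eq, map_zpow_apply ha]
    refine Prod.ext h1.symm ?_
    have e1 := hsj g
    have e2 := hsj g'
    rw [h1, hr] at e2
    nth_rewrite 1 [e1] at e2
    simp only [← mul_assoc] at e2
    have e3 := mul_right_cancel e2
    rw [← zpow_add] at e3
    have e4 : a ^ (-s (a ^ r * g) + (r + s g)) *
        rconj b (a ^ 2) ^ (((j g : ℕ) : ℤ) - (j (a ^ r * g) : ℕ)) = 1 := by
      rw [zpow_add, mul_assoc, zpow_sub, ← mul_assoc (a ^ (r + s g)), e3, zpow_neg]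
      group
    have e5 := congrArg σ e4
    rw [map_mul, hyf, mul_one, map_one] at e5
    obtain ⟨l, hl⟩ := even_of_map_zpow_eq_one ha ha1 e5
    rw [hl, ← two_mul, zpow_mul, zpow_ofNat] at e4
    have e6 := (T.dvd_of_eq_one _ _ e4).2
    rw [hr]
    simp only
    have := (j g).2
    have := (j (a ^ r * g)).2
    obtain ⟨w, hw⟩ := e6
    have : w = 0 := by
      by_contra h0
      have : 1 ≤ w ∨ w ≤ -1 := by lia
      rcases this with h | h <;> nlinarith
    subst this
    exact Fin.ext (by lia)

/-- The arc `g` joins the cosets of `g` and `b * g`. Arcs are determined by their ends because `⟨a⟩`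
meets its conjugate by `b` trivially, and then the count `6 * n ^ 2` shows that every arc of the
graph occurs. -/
theorem isEmbeddingOf (hcard : Nat.card G = 6 * n ^ 2) (ha : σ a p₀ = p₀) (ha1 : σ a ≠ 1)
    (hb : σ b p₀ ≠ p₀) (hσ : ∀ p, ∃ g, σ g p = p₀) {hb1 hb2 hgen} :
    (OrientedMap.algebraic a b hb1 hb2 hgen).IsEmbeddingOf
      (SimpleGraph.completeEquipartiteGraph 3 n) := by
  obtain ⟨ν, h1, h2⟩ := T.exists_vertex ha ha1 hσ
  have hbσ : σ b * σ b = 1 := by rw [← map_mul, T.b_mul_b, map_one]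
  let φ : G → (SimpleGraph.completeEquipartiteGraph 3 n).Dart := fun g =>
    ⟨(ν g, ν (b * g)), by
      rw [SimpleGraph.completeEquipartiteGraph_adj]
      simp only
      rw [h1, h1, map_mul, mul_inv_rev, Equiv.Perm.mul_apply]
      intro h
      have h3 := (σ g)⁻¹.injective h
      rw [← mul_eq_one_iff_eq_inv.1 hbσ] at h3
      exact hb h3.symm⟩
  have hφ : Function.Injective φ := by
    intro g g' h
    have h3 : ν g = ν g' := congrArg (fun d => d.fst) h
    have h4 : ν (b * g) = ν (b * g') := congrArg (fun d => d.snd) h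
    obtain ⟨s, hs⟩ := (h2 _ _).1 h3
    obtain ⟨t, ht⟩ := (h2 _ _).1 h4
    have h5 : rconj b (a ^ s) = a ^ t := by
      rw [rconj_apply, T.b_inv, ← mul_left_inj (b * g), ← ht, hs, mul_assoc (b * a ^ s),
        ← mul_assoc b b, T.b_mul_b, one_mul, mul_assoc]
    -- `a ^ s` fixes two of the three parts, hence all of them. So `s` is even, and the independence
    -- of `x` and `y` applies.
    have h6 : σ (a ^ s) = 1 := by
      refine perm_three_eq_one_of_fixed _ p₀ (σ b p₀) (map_zpow_apply ha s) ?_ hb.symm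
      have h7 := congrArg (fun g => σ g p₀) h5
      simp only [rconj_apply, map_mul, map_inv, Equiv.Perm.mul_apply] at h7
      rw [map_zpow_apply ha, Equiv.Perm.inv_eq_iff_eq] at h7
      exact h7
    have h7 : σ (a ^ t) = 1 := by rw [← h5, map_rconj, h6, map_one]
    obtain ⟨l, rfl⟩ := even_of_map_zpow_eq_one ha ha1 h6
    obtain ⟨r, rfl⟩ := even_of_map_zpow_eq_one ha ha1 h7
    rw [← two_mul, ← two_mul, zpow_mul, zpow_mul, zpow_ofNat, map_zpow] at h5
    have h8 := (T.dvd_of_eq_one (-r) l (by rw [h5, ← zpow_add, neg_add_cancel, zpow_zero])).2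
    rw [← two_mul, zpow_mul, zpow_ofNat, (T.x_zpow_eq_one_iff l).2 h8, one_mul] at hs
    exact hs.symm
  have hφb : Function.Bijective φ := (Nat.bijective_iff_injective_and_card φ).2
    ⟨hφ, by rw [hcard, natCard_dart_completeEquipartiteGraph]⟩
  refine ⟨Equiv.ofBijective φ hφb, fun g => ?_, fun g g' => ?_⟩
  · apply SimpleGraph.Dart.ext
    change (ν (b * g), ν (b * (b * g))) = (ν (b * g), ν g)
    rw [← mul_assoc, T.b_mul_b, one_mul]
  · change _ ↔ ν g = ν g'
    rw [h2]
    change (∃ i : ℤ, (Equiv.mulLeft a ^ i) g = g') ↔ _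
    simp only [Equiv.zpow_mulLeft, Equiv.coe_mulLeft, eq_comm]

end Embedding

end TripartitePair

/-! ### Automorphisms, type, chirality and Sylow exponent of `M₃`. -/

namespace OrientedMap

section Algebraic

variable {G : Type*} [Group G] {a b : G} {hb : b * b = 1} {hb1 : b ≠ 1}
  {hgen : Subgroup.closure {a, b} = ⊤}

theorem mulRight_mem_autPlus (g : G) :
    Equiv.mulRight g ∈ (algebraic a b hb hb1 hgen).autPlus := by
  rw [autPlus, Subgroup.mem_centralizer_iff]
  rintro h (rfl | rfl) <;> ext x <;> simp [algebraic, mul_assoc]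

theorem algebraic_isOrientablyRegular : (algebraic a b hb hb1 hgen).IsOrientablyRegular :=
  fun d d' => ⟨Equiv.mulRight (d⁻¹ * d'), mulRight_mem_autPlus _, by simp⟩

theorem apply_eq_of_mem_autPlus {f : Equiv.Perm G}
    (hf : f ∈ (algebraic a b hb hb1 hgen).autPlus) (g : G) : f g = g * f 1 := by
  rw [autPlus, Subgroup.mem_centralizer_iff] at hf
  have ha : ∀ x, f (a * x) = a * f x := fun x =>
    (congrArg (fun p : Equiv.Perm G => p x) (hf _ (Set.mem_insert _ _))).symm
  have hb : ∀ x, f (b * x) = b * f x := fun x =>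
    (congrArg (fun p : Equiv.Perm G => p x) (hf _ (Set.mem_insert_of_mem _ rfl))).symm
  have key : ∀ x, f (g * x) = g * f x := by
    have hg : g ∈ Subgroup.closure {a, b} := by rw [hgen]; trivial
    induction hg using Subgroup.closure_induction with
    | mem y hy =>
      rcases hy with rfl | rfl
      · exact ha
      · exact hb
    | one => simp
    | mul y z _ _ hy hz => intro x; rw [mul_assoc, hy, hz, mul_assoc]
    | inv y _ hy =>
      intro x
      rw [eq_inv_mul_iff_mul_eq, ← hy, mul_inv_cancel_left]
  simpa using key 1

/-- The automorphism group of an algebraic map acts by right multiplication. -/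
noncomputable def autPlusEquiv : (algebraic a b hb hb1 hgen).autPlus ≃* G :=
  (MulEquiv.ofBijective
    (MonoidHom.mk' (fun g : G => (⟨Equiv.mulRight g⁻¹, mulRight_mem_autPlus g⁻¹⟩ :
      (algebraic a b hb hb1 hgen).autPlus)) fun g h => by
        apply Subtype.ext
        ext x
        simp [mul_assoc])
    ⟨fun g h hgh => by
      have := congrArg (fun p : (algebraic a b hb hb1 hgen).autPlus => p.1 1) hgh
      simpa using this,
    fun f => ⟨(f.1 1)⁻¹, Subtype.ext (Equiv.ext fun x => by
      rw [apply_eq_of_mem_autPlus f.2 x]; simp)⟩⟩).symm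

theorem minimalPeriod_mul_left (g d : G) :
    Function.minimalPeriod (fun x => g * x) d = orderOf g := by
  rw [orderOf, Function.minimalPeriod_eq_minimalPeriod_iff]
  intro n
  rw [Function.IsPeriodicPt, Function.IsPeriodicPt, Function.IsFixedPt, Function.IsFixedPt,
    mul_left_iterate]
  simp

theorem algebraic_hasType :
    (algebraic a b hb hb1 hgen).HasType (orderOf (a * b)) (orderOf a) := by
  intro d
  refine ⟨?_, minimalPeriod_mul_left a d⟩
  rw [← minimalPeriod_mul_left (a * b) d]
  congr 1
  ext x
  simp [algebraic, mul_assoc]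

end Algebraic

end OrientedMap

theorem Sylow.exponent_eq {H : Type*} [Group H] [Finite H] {p m : ℕ} [Fact p.Prime] {g : H}
    (hg : orderOf g = p ^ m) (h : ∀ (x : H) (i : ℕ), x ^ p ^ i = 1 → x ^ p ^ m = 1)
    (P : Sylow p H) : Monoid.exponent P = p ^ m := by
  have hz : IsPGroup p (Subgroup.zpowers g) := IsPGroup.of_card (n := m) (by
    rw [Nat.card_zpowers, hg])
  obtain ⟨Q, hQ⟩ := hz.exists_le_sylow
  rw [Monoid.exponent_eq_of_mulEquiv (P.equiv Q)]
  refine Nat.dvd_antisymm (Monoid.exponent_dvd_of_forall_pow_eq_one fun x => ?_) ?_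
  · obtain ⟨i, hi⟩ := Q.isPGroup' x
    exact Subtype.ext (h x i (congrArg Subtype.val hi))
  · have h1 := Monoid.order_dvd_exponent (⟨g, hQ (Subgroup.mem_zpowers g)⟩ : Q)
    rwa [Subgroup.orderOf_mk, hg] at h1

namespace G₃

variable {k e : ℕ} {u : ℤ}

/-- The inverse acts as `s ↦ -1 - 2 ^ j * s`, with integral coefficients, so the orbit of `0`
consists of geometric sums with ratio `-2 ^ j`. -/
theorem inv_a_mul_b_pow_apply_zero {j : ℕ} (l : ℕ) :
    ((modHom k u (le_refl e) ((a k e u ^ j * b k e u)⁻¹)) ^ l) 0 =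
      ((-∑ i ∈ Finset.range l, (-(2 : ℤ) ^ j) ^ i : ℤ) : ZMod (3 ^ (e + 1))) := by
  have h1 : ∀ s, modHom k u (le_refl e) ((a k e u ^ j * b k e u)⁻¹) s = -1 - 2 ^ j * s := by
    intro s
    rw [map_inv, Equiv.Perm.inv_eq_iff_eq, map_mul, modHom_a_pow, modHom_b, Equiv.Perm.mul_apply]
    have h : ((two e ^ j)⁻¹ : (ZMod (3 ^ (e + 1)))ˣ) * (2 : ZMod (3 ^ (e + 1))) ^ j = 1 := by
      rw [← val_two, ← Units.val_pow_eq_pow_val, Units.inv_mul]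
    simp only [Units.mulLeft_apply, Equiv.subLeft_apply]
    rw [sub_sub_cancel, ← mul_assoc, h, one_mul]
  induction l with
  | zero => simp
  | succ l ih =>
    have h2 : ∑ i ∈ Finset.range (l + 1), (-(2 : ℤ) ^ j) ^ i =
        -(2 : ℤ) ^ j * ∑ i ∈ Finset.range l, (-(2 : ℤ) ^ j) ^ i + 1 := by
      rw [Finset.sum_range_succ', pow_zero, Finset.mul_sum]
      simp only [pow_succ']
    rw [pow_succ' (modHom k u le_rfl _) l, Equiv.Perm.mul_apply, ih, h1, h2]
    push_cast
    ring

/-- For odd `j` the ratio `-2 ^ j` is `1` modulo three, so the geometric sum of length `3 ^ e` is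
not divisible by `3 ^ (e + 1)` and the order cannot be smaller. -/
theorem orderOf_a_pow_mul_b (hk : ¬ 3 ∣ k) (hu : u * 3 ^ e ≡ 1 [ZMOD k]) {j : ℕ} (hj : Odd j) :
    orderOf (a k e u ^ j * b k e u) = 3 ^ (e + 1) := by
  obtain ⟨T, -⟩ := tripartitePair (e := e) hk hu
  have : Fact (Nat.Prime 3) := ⟨Nat.prime_three⟩
  refine orderOf_eq_prime_pow (fun h => ?_) (T.odd_pow_mul_pow_eq_one rfl hk hj)
  have h1 := inv_a_mul_b_pow_apply_zero (k := k) (e := e) (u := u) (j := j) (3 ^ e)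
  rw [← map_pow, inv_pow, h, inv_one, map_one, Equiv.Perm.one_apply, eq_comm,
    ZMod.intCast_zmod_eq_zero_iff_dvd, dvd_neg] at h1
  push_cast at h1
  refine not_three_pow_succ_dvd_geom_sum ?_ e h1
  have h2 : (2 + 1 : ℤ) ∣ 2 ^ j + 1 ^ j := hj.add_dvd_pow_add_pow 2 1
  rw [one_pow] at h2
  rw [show -(2 : ℤ) ^ j - 1 = -(2 ^ j + 1) by ring, dvd_neg]
  exact h2

/-- An enumeration of the three parts. -/
noncomputable def partEquiv : ZMod (3 ^ (0 + 1)) ≃ Fin 3 :=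
  Fintype.equivFinOfCardEq (by rw [ZMod.card]; rfl)

/-- The action of `G₃` on the three parts. -/
noncomputable def partHom (k e : ℕ) (u : ℤ) : G₃ k e u →* Equiv.Perm (Fin 3) :=
  partEquiv.permCongrHom.toMonoidHom.comp (modHom k u e.zero_le)

theorem partHom_apply (g : G₃ k e u) (p : Fin 3) :
    partHom k e u g p = partEquiv (modHom k u e.zero_le g (partEquiv.symm p)) := rfl

theorem ker_partHom : (partHom k e u).ker = (modHom k u e.zero_le).ker := by
  ext g
  rw [MonoidHom.mem_ker, MonoidHom.mem_ker]
  exact map_eq_one_iff (partEquiv.permCongrHom) (partEquiv.permCongrHom).injective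

theorem partHom_a_pow_apply (j : ℕ) :
    partHom k e u (a k e u ^ j) (partEquiv 0) = partEquiv 0 := by
  rw [partHom_apply, Equiv.symm_apply_apply, modHom_a_pow]
  simp

theorem partHom_a_ne_one : partHom k e u (a k e u) ≠ 1 := by
  rw [ne_eq, ← MonoidHom.mem_ker, ker_partHom, MonoidHom.mem_ker, modHom_a]
  intro h
  have h1 : (((two 0)⁻¹ : (ZMod (3 ^ (0 + 1)))ˣ) : ZMod (3 ^ (0 + 1))) = 1 := by
    simpa only [Units.mulLeft_apply, mul_one, Equiv.Perm.one_apply] using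
      congrArg (fun g : Equiv.Perm (ZMod (3 ^ (0 + 1))) => g 1) h
  rw [Units.val_eq_one, inv_eq_one, Units.ext_iff, val_two] at h1
  exact absurd h1 (by decide)

theorem exists_partHom_apply_eq (p : Fin 3) : ∃ g, partHom k e u g p = partEquiv 0 := by
  refine ⟨((a k e u ^ 1) ^ 3 ^ e * b k e u) ^ (-partEquiv.symm p).val, ?_⟩
  rw [partHom_apply, map_pow, modHom_c _ odd_one, Equiv.nsmul_addRight]
  simp

theorem orderOf_a (hk : ¬ 3 ∣ k) (hu : u * 3 ^ e ≡ 1 [ZMOD k]) :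
    orderOf (a k e u) = 2 * 3 ^ e * k := by
  obtain ⟨T, -⟩ := tripartitePair (e := e) hk hu
  refine Nat.dvd_antisymm (orderOf_dvd_of_pow_eq_one (a_pow k e u)) ?_
  have h := pow_orderOf_eq_one (a k e u)
  have hev : Even ((orderOf (a k e u) : ℕ) : ℤ) :=
    TripartitePair.even_of_map_zpow_eq_one (σ := partHom k e u)
      (by simpa using partHom_a_pow_apply (k := k) (e := e) (u := u) 1)
      partHom_a_ne_one (by rw [zpow_natCast, h, map_one])
  obtain ⟨l, hl⟩ := (Int.even_coe_nat _).1 hev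
  rw [hl, ← two_mul, pow_mul, ← zpow_natCast, T.x_zpow_eq_one_iff] at h
  rw [hl, ← two_mul, mul_assoc]
  exact mul_dvd_mul_left 2 (Int.natCast_dvd_natCast.1 h)

theorem isEmbeddingOf (hk : ¬ 3 ∣ k) (hu : u * 3 ^ e ≡ 1 [ZMOD k])
    (j : (ZMod (2 * 3 ^ e * k))ˣ) :
    (M₃ k e u j).IsEmbeddingOf (SimpleGraph.completeEquipartiteGraph 3 (3 ^ e * k)) := by
  obtain ⟨T, hcard⟩ := tripartitePair (e := e) hk hu
  rw [← ker_partHom] at T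
  refine TripartitePair.isEmbeddingOf (σ := partHom k e u) (p₀ := partEquiv 0)
    (T.pow_pair (coprime_val j)) hcard (partHom_a_pow_apply _) ?_ ?_ exists_partHom_apply_eq
  · have hx : partHom k e u (a k e u ^ 2) = 1 := MonoidHom.mem_ker.1 T.x_mem
    have h1 : partHom k e u (a k e u ^ (j : ZMod (2 * 3 ^ e * k)).val) =
        partHom k e u (a k e u) := by
      obtain ⟨l, hl⟩ := odd_val j
      rw [hl, pow_succ, pow_mul, map_mul, map_pow _ (_ ^ 2), hx, one_pow, one_mul]
    rw [h1]
    exact partHom_a_ne_one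
  · rw [partHom_apply, modHom_b, Equiv.symm_apply_apply, partEquiv.injective.ne_iff]
    decide

/-- Inverting the rotation replaces `j` by `-j`. An isomorphism would give `j = -j` modulo three, as
`e` is positive, although `j` is prime to three. -/
theorem isChiral (hk : ¬ 3 ∣ k) (he : 1 ≤ e) (hu : u * 3 ^ e ≡ 1 [ZMOD k])
    (j : (ZMod (2 * 3 ^ e * k))ˣ) : (M₃ k e u j).IsChiral := by
  have hk0 : 0 < k := Nat.pos_of_ne_zero (by rintro rfl; simp at hk)
  have : NeZero (2 * 3 ^ e * k) := ⟨by positivity⟩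
  have h3N : 3 ∣ 2 * 3 ^ e * k := ((dvd_pow_self 3 (by lia)).mul_left 2).mul_right k
  have hsum : 2 * 3 ^ e * k ∣ (j : ZMod (2 * 3 ^ e * k)).val +
      ((-j : (ZMod (2 * 3 ^ e * k))ˣ) : ZMod (2 * 3 ^ e * k)).val := by
    rw [← ZMod.natCast_eq_zero_iff]
    simp
  refine ⟨OrientedMap.algebraic_isOrientablyRegular, fun h => ?_⟩
  have h1 : (M₃ k e u j).mirror.IsIso (M₃ k e u (-j)) := by
    refine ⟨Equiv.refl _, fun g => ?_, fun g => rfl⟩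
    have h2 : (a k e u ^ (j : ZMod (2 * 3 ^ e * k)).val)⁻¹ =
        a k e u ^ ((-j : (ZMod (2 * 3 ^ e * k))ˣ) : ZMod (2 * 3 ^ e * k)).val := by
      rw [inv_eq_iff_mul_eq_one, ← pow_add]
      obtain ⟨w, hw⟩ := hsum
      rw [hw, pow_mul, a_pow, one_pow]
    change (a k e u ^ (j : ZMod (2 * 3 ^ e * k)).val)⁻¹ * g =
      a k e u ^ ((-j : (ZMod (2 * 3 ^ e * k))ˣ) : ZMod (2 * 3 ^ e * k)).val * g
    rw [h2]
  have h2 := (isIso_iff_modEq hk hu _ _).1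
    ((OrientedMap.isoSetoid (G₃ k e u)).iseqv.trans h h1)
  have h3 := h2.of_dvd ((dvd_pow_self 3 (by lia)).mul_left 2 : 3 ∣ 2 * 3 ^ e)
  have h4 := h3N.trans hsum
  have h5 : 3 ∣ (j : ZMod (2 * 3 ^ e * k)).val := by
    rw [Nat.ModEq] at h3
    lia
  have h6 := Nat.dvd_gcd h5 h3N
  rw [ZMod.val_coe_unit_coprime j] at h6
  norm_num at h6

theorem hasType (hk : ¬ 3 ∣ k) (hu : u * 3 ^ e ≡ 1 [ZMOD k])
    (j : (ZMod (2 * 3 ^ e * k))ˣ) :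
    (M₃ k e u j).HasType (3 ^ (e + 1)) (2 * 3 ^ e * k) := by
  have h := OrientedMap.algebraic_hasType (hb := b_mul_b k e u) (hb1 := b_ne_one k e u)
    (hgen := closure_eq_top k e u j)
  rwa [orderOf_a_pow_mul_b hk hu (odd_val j), Nat.Coprime.orderOf_pow, orderOf_a hk hu] at h
  rw [orderOf_a hk hu]
  exact (ZMod.val_coe_unit_coprime j).symm

theorem exponent_sylow (hk : ¬ 3 ∣ k) (hu : u * 3 ^ e ≡ 1 [ZMOD k])
    (j : (ZMod (2 * 3 ^ e * k))ˣ) (P : Sylow 3 (M₃ k e u j).autPlus) :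
    Monoid.exponent P = 3 ^ (e + 1) := by
  have hk0 : 0 < k := Nat.pos_of_ne_zero (by rintro rfl; simp at hk)
  obtain ⟨T, -⟩ := tripartitePair (e := e) hk hu
  have := (finite_and_card_le k e u hk0).1
  let F : (M₃ k e u j).autPlus ≃* G₃ k e u := OrientedMap.autPlusEquiv
  have : Finite (M₃ k e u j).autPlus := Finite.of_equiv _ F.symm.toEquiv
  have : Fact (Nat.Prime 3) := ⟨Nat.prime_three⟩
  refine Sylow.exponent_eq (g := F.symm (a k e u ^ 1 * b k e u)) ?_ (fun x i hx => ?_) P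
  · rw [MulEquiv.orderOf_eq, orderOf_a_pow_mul_b hk hu odd_one]
  · apply F.injective
    rw [map_pow, map_one]
    exact T.pow_three_pow_succ_eq_one rfl hk (i := i) (by rw [← map_pow, hx, map_one])

end G₃

/-! ### From an embedding back to a tripartite pair. -/

namespace OrientedMap

theorem IsIso.symm {D D' : Type*} {M : OrientedMap D} {N : OrientedMap D'} (h : M.IsIso N) :
    N.IsIso M := by
  obtain ⟨f, h1, h2⟩ := h
  refine ⟨f.symm, fun d => ?_, fun d => ?_⟩
  · rw [Equiv.symm_apply_eq, h1, Equiv.apply_symm_apply]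
  · rw [Equiv.symm_apply_eq, h2, Equiv.apply_symm_apply]

theorem IsIso.trans {D D' D'' : Type*} {M : OrientedMap D} {N : OrientedMap D'}
    {L : OrientedMap D''} (h : M.IsIso N) (h' : N.IsIso L) : M.IsIso L := by
  obtain ⟨f, h1, h2⟩ := h
  obtain ⟨g, h3, h4⟩ := h'
  exact ⟨f.trans g, fun d => by simp [h1, h3], fun d => by simp [h2, h4]⟩

section Automorphisms

variable {D : Type*} {M : OrientedMap D}

theorem autPlus_rot (f : M.autPlus) (d : D) : f.1 (M.rot d) = M.rot (f.1 d) :=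
  (congrArg (fun p : Equiv.Perm D => p d)
    (Subgroup.mem_centralizer_iff.1 f.2 _ (Set.mem_insert _ _))).symm

theorem autPlus_rev (f : M.autPlus) (d : D) : f.1 (M.rev d) = M.rev (f.1 d) :=
  (congrArg (fun p : Equiv.Perm D => p d)
    (Subgroup.mem_centralizer_iff.1 f.2 _ (Set.mem_insert_of_mem _ rfl))).symm

theorem autPlus_apply_injective (d₀ : D) : Function.Injective fun f : M.autPlus => f.1 d₀ := by
  intro f g h
  refine Subtype.ext (Equiv.ext fun d => ?_)
  obtain ⟨w, hw, rfl⟩ := M.connected d₀ d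
  have hcomm : ∀ f : M.autPlus, f.1 (w d₀) = w (f.1 d₀) := fun f => by
    have h1 : f.1 ∈ Subgroup.centralizer
        (Subgroup.closure ({M.rot, M.rev} : Set (Equiv.Perm D)) : Set (Equiv.Perm D)) := by
      rw [Subgroup.centralizer_closure]; exact f.2
    exact (congrArg (fun p : Equiv.Perm D => p d₀) (Subgroup.mem_centralizer_iff.1 h1 w hw)).symm
  rw [hcomm, hcomm]
  exact congrArg w h

theorem sameCycle_autPlus (f : M.autPlus) {d d' : D} (h : M.rot.SameCycle d d') :
    M.rot.SameCycle (f.1 d) (f.1 d') := by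
  obtain ⟨i, rfl⟩ := h
  refine ⟨i, ?_⟩
  have h1 : Commute M.rot f.1 := Subgroup.mem_centralizer_iff.1 f.2 _ (Set.mem_insert _ _)
  exact congrArg (fun p : Equiv.Perm D => p d) (h1.zpow_left i).eq

theorem zpow_apply_of_apply_rot {a : M.autPlus} {d₀ : D} (ha : a.1 (M.rot d₀) = d₀) (i : ℤ) :
    (a ^ i).1 ((M.rot ^ i) d₀) = d₀ := by
  have h1 : Commute a.1 M.rot :=
    (Subgroup.mem_centralizer_iff.1 a.2 _ (Set.mem_insert _ _) : Commute M.rot a.1).symm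
  have h2 := congrArg (fun p : Equiv.Perm D => p d₀) (h1.mul_zpow i)
  rw [Subgroup.coe_zpow]
  refine Eq.trans h2.symm ?_
  exact Equiv.Perm.zpow_apply_eq_self_of_apply_eq_self ha i

theorem sameCycle_zpow_apply {a : M.autPlus} {d₀ : D} (ha : a.1 (M.rot d₀) = d₀) (i : ℤ) :
    M.rot.SameCycle ((a ^ i).1 d₀) d₀ := by
  have h := sameCycle_autPlus (a ^ i) (d := d₀) ⟨i, rfl⟩
  rwa [zpow_apply_of_apply_rot ha] at h

theorem exists_zpow_of_sameCycle {a : M.autPlus} {d₀ d : D} (ha : a.1 (M.rot d₀) = d₀)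
    (h : M.rot.SameCycle d₀ d) : ∃ i : ℤ, (a ^ i).1 d₀ = d := by
  obtain ⟨i, rfl⟩ := h
  refine ⟨-i, ?_⟩
  have h1 := congrArg (a ^ (-i)).1 (zpow_apply_of_apply_rot ha i)
  rw [← h1, ← Equiv.Perm.mul_apply, ← Subgroup.coe_mul, zpow_neg, inv_mul_cancel]
  rfl

/-- Standard generators of the automorphism group of an orientably-regular map. -/
theorem exists_generators (hM : M.IsOrientablyRegular) (d₀ : D) :
    ∃ (a b : M.autPlus) (hb : b * b = 1) (hb1 : b ≠ 1)
      (hgen : Subgroup.closure {a, b} = ⊤), a.1 (M.rot d₀) = d₀ ∧ b.1 d₀ = M.rev d₀ ∧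
      M.IsIso (algebraic a b hb hb1 hgen) := by
  obtain ⟨a, ha, had⟩ := hM (M.rot d₀) d₀
  obtain ⟨b, hb, hbd⟩ := hM d₀ (M.rev d₀)
  lift a to M.autPlus using ha
  lift b to M.autPlus using hb
  have hbb : b * b = 1 := autPlus_apply_injective d₀ (by
    change b.1 (b.1 d₀) = d₀
    rw [hbd, autPlus_rev, hbd, M.rev_rev])
  have hb1 : b ≠ 1 := by
    rintro rfl
    exact M.rev_ne d₀ hbd.symm
  -- Arcs are labelled by `g ↦ g⁻¹ d₀`. This is why `a` is chosen to undo the rotation at `d₀`: left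
  -- multiplication by `a` on labels then becomes the rotation.
  have ha' : ∀ g : M.autPlus, (a * g)⁻¹.1 d₀ = M.rot (g⁻¹.1 d₀) := fun g => by
    rw [mul_inv_rev, ← autPlus_rot, Subgroup.coe_mul, Equiv.Perm.mul_apply]
    congr 1
    rw [Subgroup.coe_inv, Equiv.Perm.inv_eq_iff_eq, had]
  have hb' : ∀ g : M.autPlus, (b * g)⁻¹.1 d₀ = M.rev (g⁻¹.1 d₀) := fun g => by
    rw [mul_inv_rev, ← autPlus_rev, Subgroup.coe_mul, Equiv.Perm.mul_apply,
      inv_eq_of_mul_eq_one_left hbb, hbd]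
  have hgen : Subgroup.closure {a, b} = ⊤ := by
    have ham : a ∈ Subgroup.closure {a, b} := Subgroup.subset_closure (Set.mem_insert _ _)
    have hbm : b ∈ Subgroup.closure {a, b} :=
      Subgroup.subset_closure (Set.mem_insert_of_mem _ rfl)
    have key : ∀ w ∈ Subgroup.closure ({M.rot, M.rev} : Set (Equiv.Perm D)),
        ∃ h ∈ Subgroup.closure {a, b}, ∀ g : M.autPlus, w (g⁻¹.1 d₀) = (h * g)⁻¹.1 d₀ := by
      intro w hw
      induction hw using Subgroup.closure_induction with
      | mem x hx =>
        rcases hx with rfl | rfl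
        · exact ⟨a, ham, fun g => (ha' g).symm⟩
        · exact ⟨b, hbm, fun g => (hb' g).symm⟩
      | one => exact ⟨1, one_mem _, fun g => by rw [one_mul]; rfl⟩
      | mul x y _ _ hx hy =>
        obtain ⟨h, hh, hx⟩ := hx
        obtain ⟨h', hh', hy⟩ := hy
        exact ⟨h * h', mul_mem hh hh', fun g => by
          rw [Equiv.Perm.mul_apply, hy, hx, mul_assoc]⟩
      | inv x _ hx =>
        obtain ⟨h, hh, hx⟩ := hx
        exact ⟨h⁻¹, inv_mem hh, fun g => by
          rw [Equiv.Perm.inv_eq_iff_eq, hx, mul_inv_cancel_left]⟩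
    rw [eq_top_iff]
    rintro g -
    obtain ⟨w, hw, hwd⟩ := M.connected d₀ (g⁻¹.1 d₀)
    obtain ⟨h, hh, hwh⟩ := key w hw
    have h1 := hwh 1
    rw [inv_one, mul_one] at h1
    have h2 : g⁻¹ = h⁻¹ := autPlus_apply_injective d₀ (hwd.symm.trans h1)
    rw [inv_inj.1 h2]
    exact hh
  refine ⟨a, b, hbb, hb1, hgen, had, hbd, IsIso.symm ?_⟩
  refine ⟨Equiv.ofBijective (fun g : M.autPlus => g⁻¹.1 d₀)
    ⟨fun g h hgh => inv_injective (autPlus_apply_injective d₀ hgh), fun d => ?_⟩, ha', hb'⟩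
  obtain ⟨f, hf, hfd⟩ := hM d₀ d
  exact ⟨(⟨f, hf⟩ : M.autPlus)⁻¹, by simpa using hfd⟩

end Automorphisms

end OrientedMap

theorem perm_three_cube : ∀ (s t : Equiv.Perm (Fin 3)) (p : Fin 3), s p = p → t * t = 1 → t p ≠ p →
    s ≠ 1 → (s * t) ^ 3 = 1 := by decide

theorem perm_three_mul_ne_one : ∀ (s t : Equiv.Perm (Fin 3)) (p : Fin 3), s p = p → t p ≠ p →
    s * t ≠ 1 := by decide

namespace OrientedMap

section Tripartite

variable {D : Type*} {M : OrientedMap D} {n : ℕ}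
  {φ : D ≃ (SimpleGraph.completeEquipartiteGraph 3 n).Dart}
  (hrev : ∀ d, φ (M.rev d) = (φ d).symm)
  (hrot : ∀ d d', M.rot.SameCycle d d' ↔ (φ d).fst = (φ d').fst)
include hrev hrot

/-- Lying in the same part means having non-adjacent initial vertices, which is expressed by
rotation and reversal alone; hence automorphisms respect the parts. -/
theorem fst_eq_iff_part (d d' : D) : (φ d).fst.1 = (φ d').fst.1 ↔
    ¬ ∃ d'', M.rot.SameCycle d d'' ∧ M.rot.SameCycle (M.rev d'') d' := by
  constructor
  · rintro h ⟨d'', h1, h2⟩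
    rw [hrot] at h1 h2
    rw [hrev] at h2
    have h3 := (φ d'').adj
    rw [SimpleGraph.completeEquipartiteGraph_adj, ← h1] at h3
    change (φ d'').snd = _ at h2
    rw [h2] at h3
    exact h3 h
  · intro h
    by_contra hne
    refine h ⟨φ.symm ⟨((φ d).fst, (φ d').fst), hne⟩, ?_, ?_⟩
    · rw [hrot, Equiv.apply_symm_apply]
    · rw [hrot, hrev, Equiv.apply_symm_apply]; rfl

theorem part_autPlus (f : M.autPlus) {d d' : D} (h : (φ d).fst.1 = (φ d').fst.1) :
    (φ (f.1 d)).fst.1 = (φ (f.1 d')).fst.1 := by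
  rw [fst_eq_iff_part hrev hrot] at h ⊢
  rintro ⟨d'', h1, h2⟩
  have hinv : ∀ x, f⁻¹.1 (f.1 x) = x := fun x => by simp
  refine h ⟨f⁻¹.1 d'', ?_, ?_⟩
  · have := sameCycle_autPlus f⁻¹ h1
    rwa [hinv] at this
  · have := sameCycle_autPlus f⁻¹ h2
    rwa [autPlus_rev, hinv] at this

/-- Automorphisms permute the three parts. -/
theorem exists_part_hom (hn : 0 < n) : ∃ τ : M.autPlus →* Equiv.Perm (Fin 3),
    ∀ f d, τ f (φ d).fst.1 = (φ (f.1 d)).fst.1 := by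
  have hsurj : ∀ p : Fin 3, ∃ d : D, (φ d).fst.1 = p := fun p => by
    refine ⟨φ.symm ⟨((p, ⟨0, hn⟩), (p + 1, ⟨0, hn⟩)), ?_⟩, by rw [Equiv.apply_symm_apply]⟩
    change p ≠ p + 1
    revert p; decide
  choose r hr using hsurj
  let τ : M.autPlus →* Function.End (Fin 3) :=
    { toFun := fun f p => (φ (f.1 (r p))).fst.1
      map_one' := funext fun p => hr p
      map_mul' := fun f g => funext fun p => part_autPlus hrev hrot f (hr _).symm }
  exact ⟨τ.toHomPerm, fun f d => part_autPlus hrev hrot f (hr _)⟩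

omit hrev in
-- The powers of `a` act simply transitively on the arcs leaving the initial vertex of `d₀`, whose
-- degree is `2 * n`.
theorem orderOf_eq_two_mul {a : M.autPlus} {d₀ : D} (ha : a.1 (M.rot d₀) = d₀) :
    orderOf a = 2 * n := by
  have h1 : Function.Bijective (fun g : Subgroup.zpowers a =>
      (⟨φ (g.1.1 d₀), by
        obtain ⟨i, hi⟩ := g.2
        rw [← hi]
        exact (hrot _ _).1 (sameCycle_zpow_apply ha i)⟩ :
      {d : (SimpleGraph.completeEquipartiteGraph 3 n).Dart // d.fst = (φ d₀).fst})) := by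
    constructor
    · intro g h hgh
      exact Subtype.ext (autPlus_apply_injective d₀ (φ.injective (congrArg Subtype.val hgh)))
    · rintro ⟨d, hd⟩
      obtain ⟨i, hi⟩ := exists_zpow_of_sameCycle (d := φ.symm d) ha (by
        rw [hrot, Equiv.apply_symm_apply, hd])
      exact ⟨⟨a ^ i, i, rfl⟩, Subtype.ext (by
        change φ ((a ^ i).1 d₀) = d
        rw [hi, Equiv.apply_symm_apply])⟩
  rw [← Nat.card_zpowers, Nat.card_congr (Equiv.ofBijective _ h1), Nat.card_eq_fintype_card,
    Fintype.card_subtype, SimpleGraph.dart_fst_fiber_card_eq_degree,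
    SimpleGraph.degree_completeEquipartiteGraph]

theorem exists_tripartitePair (hn : 0 < n) (hM : M.IsOrientablyRegular) {a b : M.autPlus}
    {d₀ : D} (hb : b * b = 1) (hgen : Subgroup.closure {a, b} = ⊤) (had : a.1 (M.rot d₀) = d₀)
    (hbd : b.1 d₀ = M.rev d₀) :
    ∃ K : Subgroup M.autPlus, TripartitePair a b K n ∧ Nat.card M.autPlus = 6 * n ^ 2 := by
  have hcard : Nat.card M.autPlus = 6 * n ^ 2 := by
    rw [← natCard_dart_completeEquipartiteGraph]
    refine Nat.card_congr (Equiv.ofBijective (fun f : M.autPlus => φ (f.1 d₀)) ⟨?_, fun d => ?_⟩)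
    · exact φ.injective.comp (autPlus_apply_injective d₀)
    · obtain ⟨f, hf, h⟩ := hM d₀ (φ.symm d)
      exact ⟨⟨f, hf⟩, by simp [h]⟩
  have : Finite M.autPlus := Nat.finite_of_card_ne_zero (by rw [hcard]; positivity)
  obtain ⟨τ, hτ⟩ := exists_part_hom hrev hrot hn
  have hord := orderOf_eq_two_mul hrot had
  have ha0 : τ a (φ d₀).fst.1 = (φ d₀).fst.1 := by
    have h1 : (φ d₀).fst = (φ (M.rot d₀)).fst := (hrot _ _).1 ⟨1, by simp⟩
    rw [h1, hτ, had, h1]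
  have hb0 : τ b (φ d₀).fst.1 ≠ (φ d₀).fst.1 := by
    rw [hτ, hbd, hrev]
    exact (φ d₀).adj.symm
  have hbτ : τ b * τ b = 1 := by rw [← map_mul, hb, map_one]
  -- If `a` preserved every part, the group would act on the parts through `τ b` alone and could not
  -- reach the third part from that of `d₀`.
  have ha1 : τ a ≠ 1 := by
    intro h
    have h1 : ∀ g : M.autPlus, τ g = 1 ∨ τ g = τ b := by
      intro g
      have hg : g ∈ Subgroup.closure {a, b} := by rw [hgen]; trivial
      induction hg using Subgroup.closure_induction with
      | mem x hx =>
        rcases hx with rfl | rfl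
        · exact Or.inl h
        · exact Or.inr rfl
      | one => exact Or.inl (map_one _)
      | mul x y _ _ hx hy =>
        rw [map_mul]
        rcases hx with hx | hx <;> rcases hy with hy | hy <;> simp [hx, hy, hbτ]
      | inv x _ hx =>
        rw [map_inv]
        rcases hx with hx | hx
        · simp [hx]
        · exact Or.inr (by rw [hx, inv_eq_of_mul_eq_one_left hbτ])
    obtain ⟨p, hp1, hp2⟩ : ∃ p, p ≠ (φ d₀).fst.1 ∧ p ≠ τ b (φ d₀).fst.1 := by
      generalize (φ d₀).fst.1 = q, τ b _ = r
      revert q r; decide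
    have hadj : (SimpleGraph.completeEquipartiteGraph 3 n).Adj (p, ⟨0, hn⟩) (φ d₀).fst := hp1
    obtain ⟨f, hf, hfd⟩ := hM d₀ (φ.symm ⟨((p, ⟨0, hn⟩), (φ d₀).fst), hadj⟩)
    have h2 := hτ ⟨f, hf⟩ d₀
    simp only [hfd, Equiv.apply_symm_apply] at h2
    rcases h1 ⟨f, hf⟩ with h3 | h3
    · rw [h3] at h2; exact hp1 h2.symm
    · rw [h3] at h2; exact hp2 h2.symm
  have h3 := perm_three_cube _ _ _ ha0 hbτ hb0 ha1
  have h4 := perm_three_mul_ne_one _ _ _ ha0 hb0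
  have hxz : ∀ i : ℤ, (a ^ 2) ^ i = 1 ↔ (n : ℤ) ∣ i := fun i => by
    rw [← zpow_natCast, ← zpow_mul, ← orderOf_dvd_iff_zpow_eq_one, hord]
    push_cast
    exact mul_dvd_mul_iff_left (by norm_num)
  -- An element of `⟨a⟩` that also lies in its conjugate by `b` fixes both ends of `d₀`. The graph
  -- is simple, so it fixes `d₀` and is trivial.
  have hdvd : ∀ i j : ℤ, (a ^ 2) ^ i * rconj b (a ^ 2) ^ j = 1 → (n : ℤ) ∣ i ∧ (n : ℤ) ∣ j := by
    intro i j h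
    have e1 : (a ^ 2) ^ i = a ^ (2 * i) := by rw [zpow_mul, zpow_ofNat]
    have e2 : (a ^ 2) ^ i = b⁻¹ * a ^ (2 * -j) * b := by
      rw [eq_inv_of_mul_eq_one_left h, ← zpow_neg, ← map_zpow, rconj_apply, zpow_mul a, zpow_ofNat]
    have h5 : (φ (((a ^ 2) ^ i).1 d₀)).fst = (φ d₀).fst := by
      rw [e1]; exact (hrot _ _).1 (sameCycle_zpow_apply had _)
    have h6 : (φ (((a ^ 2) ^ i).1 d₀)).snd = (φ d₀).snd := by
      have h7 : M.rot.SameCycle (((a ^ 2) ^ i).1 (M.rev d₀)) (M.rev d₀) := by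
        have hb2 : b.1 (M.rev d₀) = d₀ := by rw [autPlus_rev, hbd, M.rev_rev]
        have hb3 : b⁻¹.1 d₀ = M.rev d₀ := by rw [inv_eq_of_mul_eq_one_left hb, hbd]
        have h8 := sameCycle_autPlus b⁻¹ (sameCycle_zpow_apply had (2 * -j))
        rw [hb3] at h8
        rw [e2, Subgroup.coe_mul, Subgroup.coe_mul, Equiv.Perm.mul_apply, Equiv.Perm.mul_apply, hb2]
        exact h8
      rw [autPlus_rev, hrot, hrev, hrev] at h7
      exact h7
    have h7 : (a ^ 2) ^ i = 1 := autPlus_apply_injective d₀ (φ.injective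
      (SimpleGraph.Dart.ext _ _ (Prod.ext h5 h6)))
    refine ⟨(hxz i).1 h7, (hxz j).1 ?_⟩
    rw [h7, one_mul, ← map_zpow] at h
    exact (map_eq_one_iff _ (rconj_injective b)).1 h
  obtain ⟨T, -⟩ := TripartitePair.of_card_le τ hgen hb hn
    (by rw [← zpow_natCast]; exact (hxz n).2 dvd_rfl) hdvd
    (by rw [pow_two]; exact perm_three_sq _ _ ha0)
    (fun h => hb0 (by rw [h]; rfl)) (by rw [map_mul]; exact h3) (by rw [map_mul]; exact h4) hcard.le
  exact ⟨_, T, hcard⟩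

end Tripartite

theorem classification {k e : ℕ} (hk : ¬ 3 ∣ k) (he : 1 ≤ e) {u : ℤ} (hu : u * 3 ^ e ≡ 1 [ZMOD k])
    {D : Type*} (M : OrientedMap D) (P : Sylow 3 M.autPlus) (hM : M.IsOrientablyRegular)
    (hemb : M.IsEmbeddingOf (SimpleGraph.completeEquipartiteGraph 3 (3 ^ e * k)))
    (hP : Monoid.exponent P = 3 ^ (e + 1)) :
    Nonempty (M.autPlus ≃* G₃ k e u) ∧
      ∃ j : (ZMod (2 * 3 ^ e * k))ˣ, M.IsIso (M₃ k e u j) := by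
  have hk0 : 0 < k := Nat.pos_of_ne_zero (by rintro rfl; simp at hk)
  have hn : 0 < 3 ^ e * k := by positivity
  obtain ⟨φ, hrev, hrot⟩ := hemb
  have d₀ : D := φ.symm ⟨((0, ⟨0, hn⟩), (1, ⟨0, hn⟩)), by
    rw [SimpleGraph.completeEquipartiteGraph_adj]; simp⟩
  obtain ⟨a, b, hb, hb1, hgen, had, hbd, hiso⟩ := exists_generators hM d₀
  obtain ⟨K, T, hcard⟩ := exists_tripartitePair hrev hrot hn hM hb hgen had hbd
  obtain ⟨g, i, hgi, hge⟩ : ∃ (g : M.autPlus) (i : ℕ), g ^ 3 ^ i = 1 ∧ g ^ 3 ^ e ≠ 1 := by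
    by_contra! hall
    have h1 : Monoid.exponent P ∣ 3 ^ e := Monoid.exponent_dvd_of_forall_pow_eq_one fun x => by
      obtain ⟨i, hi⟩ := P.isPGroup' x
      exact Subtype.ext (hall x i (congrArg Subtype.val hi))
    rw [hP, Nat.pow_dvd_pow_iff_le_right (by norm_num)] at h1
    lia
  obtain ⟨j, hj, hpq⟩ := T.exists_coprime_rconj_eq rfl hk he hgi hge
  obtain ⟨f, hf, hfa, hfb⟩ := (T.pow_pair hj).exists_bijective_hom rfl hk hcard hpq hu
  have hj' : j.Coprime (2 * 3 ^ e * k) := by rwa [mul_assoc]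
  -- The isomorphism sends the generator of `G₃` to `a ^ j`, so `a` itself corresponds to the power
  -- of the generator whose exponent inverts `j`.
  refine ⟨⟨(MulEquiv.ofBijective f hf).symm⟩, (ZMod.unitOfCoprime j hj')⁻¹,
    hiso.trans (IsIso.symm (isIso_of_bijective f hf ?_ hfb))⟩
  have : NeZero (2 * 3 ^ e * k) := ⟨by positivity⟩
  rw [map_pow, hfa, ← pow_mul]
  nth_rewrite 2 [← pow_one a]
  refine pow_eq_pow_iff_modEq.2
    (Nat.ModEq.of_dvd (orderOf_dvd_of_pow_eq_one (n := 2 * 3 ^ e * k)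
      (by rw [mul_assoc, T.a_pow_eq_one])) ?_)
  rw [← ZMod.natCast_eq_natCast_iff]
  push_cast
  rw [ZMod.natCast_zmod_val]
  have h := Units.mul_inv (ZMod.unitOfCoprime j hj')
  rwa [ZMod.coe_unitOfCoprime] at h

end OrientedMap

theorem theorem4p1 (k e : ℕ) (hk : ¬ 3 ∣ k) (he : 1 ≤ e) (u : ℤ) (hu : u * 3 ^ e ≡ 1 [ZMOD k]) :
    (∀ (D : Type*) (M : OrientedMap D) (P : Sylow 3 M.autPlus),
      M.IsOrientablyRegular →
      M.IsEmbeddingOf (SimpleGraph.completeEquipartiteGraph 3 (3 ^ e * k)) →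
      Monoid.exponent P = 3 ^ (e + 1) →
      Nonempty (M.autPlus ≃* G₃ k e u) ∧
        ∃ j : (ZMod (2 * 3 ^ e * k))ˣ, M.IsIso (M₃ k e u j)) ∧
    (∀ j₁ j₂ : (ZMod (2 * 3 ^ e * k))ˣ, (M₃ k e u j₁).IsIso (M₃ k e u j₂) ↔
      (j₁ : ZMod (2 * 3 ^ e * k)).val ≡ (j₂ : ZMod (2 * 3 ^ e * k)).val [MOD 2 * 3 ^ e]) ∧
    (∀ j : (ZMod (2 * 3 ^ e * k))ˣ,
      (M₃ k e u j).IsOrientablyRegular ∧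
      (M₃ k e u j).IsEmbeddingOf (SimpleGraph.completeEquipartiteGraph 3 (3 ^ e * k)) ∧
      (M₃ k e u j).IsChiral ∧
      (M₃ k e u j).HasType (3 ^ (e + 1)) (2 * 3 ^ e * k) ∧
      ∀ P : Sylow 3 (M₃ k e u j).autPlus, Monoid.exponent P = 3 ^ (e + 1)) ∧
    (Set.range fun j : (ZMod (2 * 3 ^ e * k))ˣ =>
      Quotient.mk (OrientedMap.isoSetoid (G₃ k e u)) (M₃ k e u j)).ncard = 2 * 3 ^ (e - 1) := by
  exact ⟨fun D M P hM hemb hP => OrientedMap.classification hk he hu M P hM hemb hP,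
    G₃.isIso_iff_modEq hk hu,
    fun j => ⟨OrientedMap.algebraic_isOrientablyRegular, G₃.isEmbeddingOf hk hu j,
      G₃.isChiral hk he hu j, G₃.hasType hk hu j, G₃.exponent_sylow hk hu j⟩,
    G₃.ncard_range hk he hu⟩
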